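/- Let $Q$ be a smooth $D$-dimensional manifold, $P_L=TQ$, $P_C=T^*Q$ with $\omega=dq^a\wedge dp_a$, and $L$ a smooth function on $P_L$ with fibre derivative $\mathcal L(q,v)=(q,\partial L/\partial v)$, energy $E=v^a\,\partial L/\partial v^a-L$, Hessian $M_{ab}=\partial^2L/\partial v^a\partial v^b$ and $\Omega_L=-d\theta_L$, $\theta_L=(\partial L/\partial v^a)\,dq^a$. Assume that $L$ is almost regular: $\Omega_L$ has constant rank, $P_C^{[0]}=\mathcal L(P_L)$ is an embedded submanifold of $P_C$, $\mathcal L$ is a submersion onto it, and the preimages $\mathcal L^{-1}(s)$, $s\in P_C^{[0]}$, are connected. Write $\dim\ker M=N_0$ and $\dim\ker\Omega_L=N_0+r$ (in the situation considered in the paper, $r=N_0$). Notation. $\mathcal G$ is the distribution of the vectors $z^a\,\partial/\partial v^a$ with $z\in\ker M$. $P_L^{[1]}$ is the set where $z^a\big(\partial E/\partial q^a+F_{ab}v^b\big)=0$ for all $z\in\ker M$, with $F_{ab}=\partial^2L/\partial v^a\partial q^b-\partial^2L/\partial v^b\partial q^a$. A SOELVF is a smooth vector field $X$ on $P_L$ with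 $i_X\Omega_L=dE$ on $P_L^{[1]}$ and $[G,X]$ vertical for all sections $G$ of $\mathcal G$. Over an open set of $P_L$, a reduced kernel field is a smooth section $P$ of $\ker\Omega_L$ there with $[G,P]$ vertical for all local sections $G$ of $\mathcal G$. Primary constraints on an open set $W\subset P_C$ are smooth functions $\gamma^{[0]}_1,\dots,\gamma^{[0]}_{N_0}$ on $W$ with common zero set $P_C^{[0]}\cap W$ and with differentials independent at its points. An adapted system over $W$ consists of primary constraints on $W$, reduced kernel fields $P_{(1)},\dots,P_{(r)}$ over $\mathcal L^{-1}(W)$ whose classes form a basis of $\ker\Omega_L/\mathcal G$ at each point, and smooth functions $f_1,\dots,f_r$ on $W$ such that $i_{\mathcal L_*P_{(m)}}\omega=f_m\,d\gamma^{[0]}_m$ on $P_C^{[0]}\cap W$ (where the $\gamma^{[0]}_n$ are numbered suitably). Then: 1. $E$ is constant on the preimages of $\mathcal L$, so that the canonical Hamiltonian $H_C=E\circ\mathcal L^{-1}$ is well defined on $P_C^{[0]}$, and near each point of $P_C^{[0]}$ it has a smooth extension to an open subset of $P_C$. Adapted systems exist near each point of $P_C^{[0]}$. 2. Every SOELVF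 $X$ is projectable over $P_L^{[1]}$: there is a vector field $\mathcal L_*X$ on $\mathcal L(P_L^{[1]})$ with $d\mathcal L_u(X(u))=(\mathcal L_*X)(\mathcal L(u))$ for $u\in P_L^{[1]}$. For all $u\in P_L$ the vector $d\mathcal L_u(X(u))$ is tangent to $P_C^{[0]}$, i.e. is annihilated by the differentials of all primary constraints near $\mathcal L(u)$. 3. Let $\overline X_L$ be a SOELVF. Along $\mathcal L(P_L^{[1]})$ the field $\mathfrak X_C=\mathcal L_*\overline X_L$ is the Hamiltonian vector field of $H_C$: the one-forms $i_{\mathfrak X_C}\omega$ and $dH_C$ agree on the vectors tangent to $P_C^{[0]}$, and near each point of $P_C^{[0]}$ there is a smooth local extension of $H_C$ to $P_C$, again denoted $H_C$, such that $i_{\mathfrak X_C}\omega=dH_C$ at the points of $\mathcal L(P_L^{[1]})$. 4. Let $\overline X_L$ and $\overline X_{EL}$ be SOELVFs, let $W\subset P_C$ be open, let $H_C$ denote an extension to $W$ as in 3 (that is, with $i_{\mathcal L_*\overline X_L}\omega=dH_C$ on $\mathcal L(P_L^{[1]})\cap W$), and let an adapted system over $W$ be given. Near each point of $P_C^{[0]}\cap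 W$ there are smooth functions $u^m$ on an open set $W'\subset W$ with $$\overline X_{EL}=\overline X_L+\sum_{m=1}^{r}(u^m\circ\mathcal L)\,P_{(m)}\quad\text{modulo }\mathcal G\ \text{ on } P_L^{[1]}\cap\mathcal L^{-1}(W').$$ For every open $W'\subset W$ and all such $u^m$, $\mathfrak X_{H_T}=\mathcal L_*\overline X_{EL}$ is on $\mathcal L(P_L^{[1]})\cap W'$ the Hamiltonian vector field of the total Hamiltonian $$H_T=H_C+\sum_{m=1}^{r}u^m f_m\,\gamma^{[0]}_m,\qquad i_{\mathfrak X_{H_T}}\omega=dH_T .$$ -/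

import Mathlib

open Set Topology Manifold ContDiff Bundle

noncomputable section

namespace SingularLagrangian

/-- The model space `ℝ^D` of the configuration space. -/
abbrev Coord (D : ℕ) : Type := EuclideanSpace ℝ (Fin D)

/-- The Lagrangian (velocity) phase space `P_L = TQ`. -/
abbrev VelocitySpace (D : ℕ) (Q : Type*) [TopologicalSpace Q] [ChartedSpace (Coord D) Q]
    [IsManifold (𝓡 D) ∞ Q] :=
  TangentBundle (𝓡 D) Q

/-- The canonical phase space `P_C = T*Q`. -/
abbrev PhaseSpace (D : ℕ) (Q : Type*) [TopologicalSpace Q] [ChartedSpace (Coord D) Q]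
    [IsManifold (𝓡 D) ∞ Q] :=
  TotalSpace (Coord D →L[ℝ] ℝ)
    (fun q : Q => TangentSpace (𝓡 D) q →L[ℝ] Trivial Q ℝ q)

/-- The model with corners of `P_L = TQ`; its model vector space is `ℝ^D × ℝ^D`. -/
abbrev modelL (D : ℕ) := (𝓡 D).tangent

/-- The model with corners of `P_C = T*Q`; its model vector space is `ℝ^D × (ℝ^D)*`. -/
abbrev modelC (D : ℕ) := (𝓡 D).prod 𝓘(ℝ, Coord D →L[ℝ] ℝ)

variable {D : ℕ} {Q : Type*} [TopologicalSpace Q] [ChartedSpace (Coord D) Q]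
  [IsManifold (𝓡 D) ∞ Q]

/-- The tangent space of `P_L` at `u`. The bundle chart of `TQ` at `u` induced by the chart of `Q`
at the base point of `u` identifies it with `ℝ^D × ℝ^D`, the pair `(a, b)` being
`a · ∂/∂q + b · ∂/∂v`. -/
abbrev TL (u : VelocitySpace D Q) := TangentSpace (modelL D) u

/-- The tangent space of `P_C` at `s`. The bundle chart of `T*Q` at `s` induced by the chart of `Q`
at the base point of `s` identifies it with `ℝ^D × (ℝ^D)*`, the pair `(a, b)` being
`a · ∂/∂q + b · ∂/∂p`. -/
abbrev TC (s : PhaseSpace D Q) := TangentSpace (modelC D) s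

/-- Vector fields (not necessarily smooth) on `P_L`. -/
abbrev VectorFieldL (D : ℕ) (Q : Type*) [TopologicalSpace Q] [ChartedSpace (Coord D) Q]
    [IsManifold (𝓡 D) ∞ Q] := (u : VelocitySpace D Q) → TL u

/-- Vector fields (not necessarily smooth) on `P_C`. -/
abbrev VectorFieldC (D : ℕ) (Q : Type*) [TopologicalSpace Q] [ChartedSpace (Coord D) Q]
    [IsManifold (𝓡 D) ∞ Q] := (s : PhaseSpace D Q) → TC s

/-- Smoothness of a vector field on a subset of `P_L`. -/
def SmoothFieldOn (X : VectorFieldL D Q) (O : Set (VelocitySpace D Q)) : Prop :=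
  ContMDiffOn (modelL D) (modelL D).tangent ∞
    (fun u => (⟨u, X u⟩ : TangentBundle (modelL D) (VelocitySpace D Q))) O

/-- Smoothness of a real function on a subset of `P_C`. -/
def SmoothFunOn (h : PhaseSpace D Q → ℝ) (W : Set (PhaseSpace D Q)) : Prop :=
  ContMDiffOn (modelC D) 𝓘(ℝ, ℝ) ∞ h W

/-- The differential `dh` at `s` of a function on `P_C`, as a one-form. -/
def dC (h : PhaseSpace D Q → ℝ) (s : PhaseSpace D Q) : TC s →L[ℝ] ℝ :=
  mfderiv (modelC D) 𝓘(ℝ, ℝ) h s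

/-- The differential `dh` at `u` of a function on `P_L`, as a one-form. -/
def dL (h : VelocitySpace D Q → ℝ) (u : VelocitySpace D Q) : TL u →L[ℝ] ℝ :=
  mfderiv (modelL D) 𝓘(ℝ, ℝ) h u

/-! ### Lagrangian structures -/

/-- The restriction of `L` to the tangent space at `q`, as a function on `ℝ^D`. -/
def onFibre (L : VelocitySpace D Q → ℝ) (q : Q) : Coord D → ℝ :=
  fun v => L (⟨q, v⟩ : VelocitySpace D Q)

/-- The fibre derivative `(q, v) ↦ (q, p = ∂L/∂v)`. -/
def fibreDerivative (L : VelocitySpace D Q → ℝ) (u : VelocitySpace D Q) : PhaseSpace D Q :=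
  ⟨u.1, (fderiv ℝ (onFibre L u.1) (u.2 : Coord D) : Coord D →L[ℝ] ℝ)⟩

/-- The pushforward by the fibre derivative of a tangent vector at `u`. -/
def push (L : VelocitySpace D Q → ℝ) (u : VelocitySpace D Q) :
    TL u →L[ℝ] TC (fibreDerivative L u) :=
  mfderiv (modelL D) (modelC D) (fibreDerivative L) u

/-- The energy `E = v^a ∂L/∂v^a - L`. -/
def energy (L : VelocitySpace D Q → ℝ) (u : VelocitySpace D Q) : ℝ :=
  fderiv ℝ (onFibre L u.1) (u.2 : Coord D) (u.2 : Coord D) - L u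

/-- The Hessian `M_ab = ∂²L/∂v^a∂v^b` at `u`. -/
def hessian (L : VelocitySpace D Q → ℝ) (u : VelocitySpace D Q) :
    Coord D →L[ℝ] Coord D →L[ℝ] ℝ :=
  fderiv ℝ (fderiv ℝ (onFibre L u.1)) (u.2 : Coord D)

/-- The kernel of the Hessian at `u`. -/
def kerHessian (L : VelocitySpace D Q → ℝ) (u : VelocitySpace D Q) : Submodule ℝ (Coord D) :=
  LinearMap.ker (hessian L u : Coord D →ₗ[ℝ] (Coord D →L[ℝ] ℝ))

/-- The Lagrangian in the bundle chart of `TQ` at `u`, as a function of `(q, v)`. -/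
def localLagrangian (L : VelocitySpace D Q → ℝ) (u : VelocitySpace D Q) :
    Coord D × Coord D → ℝ :=
  fun y => L ((extChartAt (modelL D) u).symm y)

/-- The one-form `θ_L = (∂L/∂v^a) dq^a` in the bundle chart of `TQ` at `u`. -/
def localTheta (L : VelocitySpace D Q → ℝ) (u : VelocitySpace D Q) (y : Coord D × Coord D) :
    (Coord D × Coord D) →L[ℝ] ℝ :=
  (fderiv ℝ (localLagrangian L u) y).comp
    ((ContinuousLinearMap.inr ℝ (Coord D) (Coord D)).comp
      (ContinuousLinearMap.fst ℝ (Coord D) (Coord D)))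

/-- The derivative of `θ_L` at `u` in the bundle chart of `TQ` at `u`. -/
def derivTheta (L : VelocitySpace D Q → ℝ) (u : VelocitySpace D Q) :
    (Coord D × Coord D) →L[ℝ] (Coord D × Coord D) →L[ℝ] ℝ :=
  fderiv ℝ (localTheta L u) (extChartAt (modelL D) u u)

/-- The Lagrange two-form `Ω_L = -dθ_L` at `u`:
`Ω_L(X, Y) = -(X θ_L(Y) - Y θ_L(X))` for constant `X`, `Y` in the chart at `u`. -/
def lagrangeForm (L : VelocitySpace D Q → ℝ) (u : VelocitySpace D Q) :
    TL u →L[ℝ] TL u →L[ℝ] ℝ :=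
  ((derivTheta L u).flip - derivTheta L u :
    (Coord D × Coord D) →L[ℝ] (Coord D × Coord D) →L[ℝ] ℝ)

/-- The kernel of `Ω_L` at `u`. -/
def kerForm (L : VelocitySpace D Q → ℝ) (u : VelocitySpace D Q) : Submodule ℝ (TL u) :=
  LinearMap.ker (lagrangeForm L u : TL u →ₗ[ℝ] (TL u →L[ℝ] ℝ))

/-- The vector `z · ∂/∂v` at `u`. -/
def verticalLift (u : VelocitySpace D Q) : Coord D →ₗ[ℝ] TL u :=
  (LinearMap.inr ℝ (Coord D) (Coord D) : Coord D →ₗ[ℝ] (Coord D × Coord D))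

/-- The vertical subspace of the tangent space at `u`. -/
def verticalSpace (u : VelocitySpace D Q) : Submodule ℝ (TL u) :=
  LinearMap.ker (mfderiv (modelL D) (𝓡 D)
    (TotalSpace.proj : VelocitySpace D Q → Q) u : TL u →ₗ[ℝ] TangentSpace (𝓡 D) u.1)

/-- The space `𝒢` at `u`: the vectors `z · ∂/∂v` with `z` in the kernel of the Hessian. -/
def verticalKernel (L : VelocitySpace D Q → ℝ) (u : VelocitySpace D Q) : Submodule ℝ (TL u) :=
  (kerHessian L u).map (verticalLift u)

/-- `γ_1, …, γ_c` are independent smooth functions on the open set `W` whose common zero set is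
`S ∩ W`; so `S ∩ W` is an embedded submanifold of codimension `c`. -/
def IsDefiningSystem (S W : Set (PhaseSpace D Q)) {c : ℕ} (γ : Fin c → PhaseSpace D Q → ℝ) :
    Prop :=
  IsOpen W ∧ (∀ n, SmoothFunOn (γ n) W) ∧ (∀ s ∈ W, s ∈ S ↔ ∀ n, γ n s = 0) ∧
    ∀ s ∈ W, s ∈ S → LinearIndependent ℝ (fun n => dC (γ n) s)

/-- The primary constraint surface `P_C^[0]`, the image of the fibre derivative. -/
def primarySurface (L : VelocitySpace D Q → ℝ) : Set (PhaseSpace D Q) :=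
  range (fibreDerivative L)

/-- A Lagrangian is almost regular (with `Ω_L` of constant rank): it is smooth, `Ω_L` has constant
rank, the image of the fibre derivative is an embedded submanifold of `T*Q` onto which the fibre
derivative is a submersion, and the preimages of the points of the image are connected. -/
structure IsAlmostRegular (L : VelocitySpace D Q → ℝ) : Prop where
  smooth : ContMDiff (modelL D) 𝓘(ℝ, ℝ) ∞ L
  constant_rank : ∃ k : ℕ, ∀ u, Module.finrank ℝ (kerForm L u) = k
  submersion : ∀ s ∈ primarySurface L, ∃ (W : Set (PhaseSpace D Q)) (c : ℕ)
    (γ : Fin c → PhaseSpace D Q → ℝ), s ∈ W ∧ IsDefiningSystem (primarySurface L) W γ ∧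
      ∀ u, fibreDerivative L u ∈ W → ∀ w : TC (fibreDerivative L u),
        (∀ n, dC (γ n) (fibreDerivative L u) w = 0) → ∃ Y : TL u, push L u Y = w
  connected_fibres : ∀ s ∈ primarySurface L, IsConnected (fibreDerivative L ⁻¹' {s})

/-! ### The energy equation and second-order, Euler-Lagrange vector fields -/

/-- The vector `a · ∂/∂q` at `u`, in the bundle chart of `TQ` at `u`. -/
def horizontal (u : VelocitySpace D Q) : Coord D →ₗ[ℝ] TL u :=
  (LinearMap.inl ℝ (Coord D) (Coord D) : Coord D →ₗ[ℝ] (Coord D × Coord D))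

/-- The first-order constraint function attached to `z ∈ ker M(u)`, namely
`z^a (∂E/∂q^a + F_ab v^b)`, as the contraction of `z · ∂/∂q` with the one-form
`dE - Ω_L(v · ∂/∂q, ·)`. -/
def firstOrderConstraint (L : VelocitySpace D Q → ℝ) (u : VelocitySpace D Q) (z : Coord D) : ℝ :=
  dL (energy L) u (horizontal u z) -
    lagrangeForm L u (horizontal u (u.2 : Coord D)) (horizontal u z)

/-- The first-order Lagrangian constraint submanifold `P_L^[1]`. -/
def firstOrderSurface (L : VelocitySpace D Q → ℝ) : Set (VelocitySpace D Q) :=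
  {u | ∀ z ∈ kerHessian L u, firstOrderConstraint L u z = 0}

/-- The bracket of `X` with every smooth local section of `𝒢` in `O` is vertical. -/
def BracketsVertical (L : VelocitySpace D Q → ℝ) (O : Set (VelocitySpace D Q))
    (X : VectorFieldL D Q) : Prop :=
  ∀ (V : Set (VelocitySpace D Q)) (G : VectorFieldL D Q), IsOpen V → V ⊆ O →
    SmoothFieldOn G V → (∀ u ∈ V, G u ∈ verticalKernel L u) →
    ∀ u ∈ V, VectorField.mlieBracket (modelL D) G X u ∈ verticalSpace u

/-- Second-order, Euler-Lagrange vector fields: smooth vector fields `X` on `P_L` with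
`i_X Ω_L = dE` on `P_L^[1]` and `[G, X]` vertical for all `G` in `𝒢`. -/
structure IsSOELVF (L : VelocitySpace D Q → ℝ) (X : VectorFieldL D Q) : Prop where
  smooth : SmoothFieldOn X univ
  energy_equation : ∀ u ∈ firstOrderSurface L, lagrangeForm L u (X u) = dL (energy L) u
  bracket : BracketsVertical L univ X

/-- Smooth sections over `O` of `ker Ω_L` whose brackets with `𝒢` are vertical. -/
structure IsReducedKernelField (L : VelocitySpace D Q → ℝ) (O : Set (VelocitySpace D Q))
    (P : VectorFieldL D Q) : Prop where
  smooth : SmoothFieldOn P O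
  mem_ker : ∀ u ∈ O, P u ∈ kerForm L u
  bracket : BracketsVertical L O P

/-! ### Hamiltonian structures -/

/-- The canonical two-form `ω = dq^a ∧ dp_a` on `T*Q`, at `s`, in the bundle chart of `T*Q`
at `s`. -/
def canonicalForm (s : PhaseSpace D Q) (X Y : TC s) : ℝ :=
  (Y : Coord D × (Coord D →L[ℝ] ℝ)).2 (X : Coord D × (Coord D →L[ℝ] ℝ)).1 -
    (X : Coord D × (Coord D →L[ℝ] ℝ)).2 (Y : Coord D × (Coord D →L[ℝ] ℝ)).1

/-- `𝔛` is, at the points of `S`, the Hamiltonian vector field of `H`: `i_𝔛 ω = dH`. -/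
def IsHamiltonianFieldOn (𝔛 : VectorFieldC D Q) (H : PhaseSpace D Q → ℝ)
    (S : Set (PhaseSpace D Q)) : Prop :=
  ∀ s ∈ S, ∀ w : TC s, canonicalForm s (𝔛 s) w = dC H s w

/-- `𝔛` is the projection of `X`, where both are considered over `P_L^[1]`: the pushforward of
`X u` depends only on the image point `s` of `u ∈ P_L^[1]` and equals `𝔛 s`. -/
def ProjectsTo (L : VelocitySpace D Q → ℝ) (X : VectorFieldL D Q) (𝔛 : VectorFieldC D Q) : Prop :=
  ∀ u ∈ firstOrderSurface L, push L u (X u) = 𝔛 (fibreDerivative L u)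

/-- The image of `P_L^[1]` under the fibre derivative. -/
def projectedSurface (L : VelocitySpace D Q → ℝ) : Set (PhaseSpace D Q) :=
  fibreDerivative L '' firstOrderSurface L

open Classical in
/-- The canonical Hamiltonian `H_C = E ∘ 𝓛⁻¹` on `P_C^[0]` (extended by `0` off `P_C^[0]`): the
value of the energy at some preimage. -/
def canonicalHamiltonian (L : VelocitySpace D Q → ℝ) (s : PhaseSpace D Q) : ℝ :=
  if h : ∃ u, fibreDerivative L u = s then energy L h.choose else 0

/-- `H` is smooth on the open set `W` and represents there the canonical Hamiltonian, i.e. agrees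
with it on `P_C^[0] ∩ W`. -/
def RepresentsCanonical (L : VelocitySpace D Q → ℝ) (W : Set (PhaseSpace D Q))
    (H : PhaseSpace D Q → ℝ) : Prop :=
  IsOpen W ∧ SmoothFunOn H W ∧ ∀ s ∈ W, s ∈ primarySurface L → H s = canonicalHamiltonian L s

/-- Over `W`: primary constraints `γ_n` (`n < N`), fields `P_m` (`m < r`) that represent a basis of
the reduced kernel modulo `𝒢`, and smooth `f_m` with `i_{𝓛_* P_m} ω = f_m dγ_{e(m)}` along
`P_C^[0] ∩ W`. -/
structure IsAdaptedSystem (L : VelocitySpace D Q → ℝ) (W : Set (PhaseSpace D Q)) {N r : ℕ}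
    (γ : Fin N → PhaseSpace D Q → ℝ) (e : Fin r ↪ Fin N) (P : Fin r → VectorFieldL D Q)
    (f : Fin r → PhaseSpace D Q → ℝ) : Prop where
  constraints : IsDefiningSystem (primarySurface L) W γ
  reduced : ∀ m, IsReducedKernelField L (fibreDerivative L ⁻¹' W) (P m)
  independent : ∀ u, fibreDerivative L u ∈ W →
    LinearIndependent ℝ (fun m => (verticalKernel L u).mkQ (P m u))
  spanning : ∀ u, fibreDerivative L u ∈ W →
    verticalKernel L u ⊔ Submodule.span ℝ (range fun m => P m u) = kerForm L u
  smooth : ∀ m, SmoothFunOn (f m) W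
  contraction : ∀ m u, fibreDerivative L u ∈ W → ∀ w : TC (fibreDerivative L u),
    canonicalForm (fibreDerivative L u) (push L u (P m u)) w =
      f m (fibreDerivative L u) * dC (γ (e m)) (fibreDerivative L u) w

/-- The coefficients `c_m`, smooth functions on `W`, express the SOELVF `X` through `X₀` over `W`:
on `P_L^[1]`, modulo `𝒢`, `X = X₀ + ∑ c_m P_m`. -/
def IsDecompositionOn (L : VelocitySpace D Q → ℝ) (W : Set (PhaseSpace D Q)) {r : ℕ}
    (X X₀ : VectorFieldL D Q) (P : Fin r → VectorFieldL D Q) (c : Fin r → PhaseSpace D Q → ℝ) :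
    Prop :=
  (∀ m, SmoothFunOn (c m) W) ∧ ∀ u ∈ firstOrderSurface L, fibreDerivative L u ∈ W →
    X u - (X₀ u + ∑ m, c m (fibreDerivative L u) • P m u) ∈ verticalKernel L u

/-- The total Hamiltonian `H_T = H_C + ∑ c_m f_m γ_{e(m)}`. -/
def totalHamiltonian {N r : ℕ} (H : PhaseSpace D Q → ℝ) (c f : Fin r → PhaseSpace D Q → ℝ)
    (γ : Fin N → PhaseSpace D Q → ℝ) (e : Fin r ↪ Fin N) (s : PhaseSpace D Q) : ℝ :=
  H s + ∑ m, c m s * f m s * γ (e m) s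

end SingularLagrangian

end

open SingularLagrangian

set_option linter.unusedSectionVars false

/-! Everything rests on two facts about the fibre derivative 𝓛. It pulls ω back to Ω_L
(`lagrangeForm_eq`), and the kernel of its differential is exactly 𝒢 (`push_eq_zero_iff`), of
dimension N everywhere. So 𝓛 has constant rank, the image of its differential is the tangent space
of the primary surface, and N independent constraints cut that surface out. By the rank theorem and
connectedness of the preimages, a smooth function on TQ whose differential kills 𝒢 is constant on
the preimages of 𝓛 (`eq_of_fibreDerivative_eq`). Composing it with a local section of 𝓛 gives a
smooth function near each point of the primary surface (`exists_descent`). The energy is such a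
function, since dE(z ∂/∂v) = z^a M_ab v^b.

The bracket condition on a SOELVF X says that 𝒢 annihilates the components X^a along ∂/∂q, so these
descend too. Its momentum components are controlled only on P_L^[1]. There ω(d𝓛 X, w) = dH_C(w) for
every w tangent to the primary surface, and such w have arbitrary base component. Hence d𝓛 X is
determined by the point of T*Q and by the X^a: X is projectable
(`IsSOELVF.push_eq_of_fibreDerivative_eq`).

The covector i_𝔛 ω - dH_C kills the tangent space of the primary surface, so it equals ∑ b_n dγ_n.
The dγ_n stay independent on momentum directions, because the tangent space maps onto the base
directions. Hence the b_n can be solved for from X^a - ∂H_C/∂p_a, which is smooth on an open set of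
T*Q. The b_n therefore extend to smooth functions c_n, and H_C + ∑ c_n γ_n is the required extension
(`exists_smooth_multipliers`). The same device makes the coefficients u^m smooth: two SOELVFs differ
on P_L^[1] by an element of ker Ω_L, and their u^m f_m are multipliers of this kind, with f_m
nonzero. The formula for H_T is then the product rule at a common zero of the constraints.

Adapted systems come from symplectic linear algebra: ker Ω_L / 𝒢 is isomorphic to the kernel of the
matrix of brackets of the constraints (`finrank_ker_pullback`), which thus has constant dimension r
along the surface. Recombining the constraints by a smooth family of kernel vectors produces r
constraints whose Hamiltonian vectors are tangent to the surface (`exists_adapted_constraints`).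
Smooth lifts of these vectors are the reduced kernel fields (`exists_lift_field`). Their brackets
with 𝒢 are vertical because their base components are functions on T*Q. -/

namespace SingularLagrangian

/-! ### Inverse function theorem and its consequences in vector spaces -/

section Flat

variable {V V' S : Type*} [NormedAddCommGroup V] [NormedSpace ℝ V] [FiniteDimensional ℝ V]
  [NormedAddCommGroup V'] [NormedSpace ℝ V'] [FiniteDimensional ℝ V']
  [NormedAddCommGroup S] [NormedSpace ℝ S]

/-- The inverse function theorem, with a smooth local inverse on an open set. -/
theorem exists_smooth_localInverse {f : V → V'} {O : Set V} (hO : IsOpen O)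
    (hf : ContDiffOn ℝ ∞ f O) {x₀ : V} (hx₀ : x₀ ∈ O) {e : V ≃L[ℝ] V'}
    (he : HasFDerivAt f (e : V →L[ℝ] V') x₀) :
    ∃ (g : V' → V) (U : Set V'), IsOpen U ∧ f x₀ ∈ U ∧ ContDiffOn ℝ ∞ g U ∧ g (f x₀) = x₀ ∧
      (∀ y ∈ U, g y ∈ O ∧ f (g y) = y) ∧ ∀ᶠ x in 𝓝 x₀, f x ∈ U ∧ g (f x) = x := by
  have : CompleteSpace V := FiniteDimensional.complete ℝ V
  have hat : ∀ x ∈ O, ContDiffAt ℝ ∞ f x := fun x hx => hf.contDiffAt (hO.mem_nhds hx)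
  let φ := (hat x₀ hx₀).toOpenPartialHomeomorph f he (by simp)
  have hφ : ∀ x, φ x = f x := fun x => rfl
  have hsrc : x₀ ∈ φ.source := (hat x₀ hx₀).mem_toOpenPartialHomeomorph_source he (by simp)
  have hcont : ContinuousOn (fderiv ℝ f) O :=
    hf.continuousOn_fderiv_of_isOpen hO (by simp)
  -- The local inverse is known to be smooth only where the derivative of `f` is invertible. This is
  -- an open condition, so the target is cut down to it.
  let O' := O ∩ fderiv ℝ f ⁻¹' range ((↑) : (V ≃L[ℝ] V') → (V →L[ℝ] V'))
  have hO' : IsOpen O' := hcont.isOpen_inter_preimage hO ContinuousLinearEquiv.isOpen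
  have hx₀' : x₀ ∈ O' := ⟨hx₀, e, he.fderiv.symm⟩
  have hsymm : φ.symm (f x₀) = x₀ := φ.left_inv hsrc
  refine ⟨φ.symm, φ.target ∩ φ.symm ⁻¹' O', φ.isOpen_inter_preimage_symm hO',
    ⟨φ.map_source hsrc, by rwa [mem_preimage, hsymm]⟩, ?_, hsymm, ?_, ?_⟩
  · rintro y ⟨hy, hyO, e', he'⟩
    refine ContDiffAt.contDiffWithinAt (φ.contDiffAt_symm hy (f₀' := e') ?_ (hat _ hyO))
    rw [he']
    exact ((hat _ hyO).differentiableAt (by simp)).hasFDerivAt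
  · rintro y ⟨hy, hyO, -⟩
    exact ⟨hyO, φ.right_inv hy⟩
  · filter_upwards [φ.open_source.mem_nhds hsrc, hO'.mem_nhds hx₀'] with x hx hxO
    exact ⟨⟨φ.map_source hx, by rw [mem_preimage, ← hφ, φ.left_inv hx]; exact hxO⟩, φ.left_inv hx⟩

/-- Every linear map has a generalized inverse. -/
theorem exists_generalizedInverse (A : V →L[ℝ] V') :
    ∃ J : V' →L[ℝ] V, ∀ v, A (J (A v)) = A v := by
  obtain ⟨j, hj⟩ := (A : V →ₗ[ℝ] V').rangeRestrict.exists_rightInverse_of_surjective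
    (LinearMap.range_rangeRestrict _)
  obtain ⟨p, hp⟩ := (LinearMap.range (A : V →ₗ[ℝ] V')).subtype.exists_leftInverse_of_injective
    (Submodule.ker_subtype _)
  refine ⟨LinearMap.toContinuousLinearMap (j ∘ₗ p), fun v => ?_⟩
  have h1 : p (A v) = (A : V →ₗ[ℝ] V').rangeRestrict v :=
    LinearMap.congr_fun hp ((A : V →ₗ[ℝ] V').rangeRestrict v)
  have h2 := congrArg Subtype.val (LinearMap.congr_fun hj (p (A v)))
  rw [h1] at h2
  simpa [h1] using h2

theorem exists_leftInverse_clm (A : V →L[ℝ] V') (hA : Function.Injective A) :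
    ∃ J : V' →L[ℝ] V, ∀ v, J (A v) = v := by
  obtain ⟨J, hJ⟩ := exists_generalizedInverse A
  exact ⟨J, fun v => hA (hJ v)⟩

theorem isInvertible_of_injective (A : V →L[ℝ] V) (hA : Function.Injective A) :
    A.IsInvertible :=
  ⟨(LinearEquiv.ofInjectiveEndo (A : V →ₗ[ℝ] V) hA).toContinuousLinearEquiv, by ext; rfl⟩

/-- If `A'` is close to `A`, in the sense that `J A' + 1 - J A` is injective for a generalized
inverse `J` of `A`, and has a kernel of the same dimension, then `A J A' v = 0` only if
`A' v = 0`. -/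
theorem apply_eq_zero_of_finrank_ker_eq {A A' : V →L[ℝ] V'} {J : V' →L[ℝ] V}
    (hJ : ∀ v, A (J (A v)) = A v)
    (hT : Function.Injective fun v => J (A' v) + (v - J (A v)))
    (hrank : Module.finrank ℝ (LinearMap.ker (A' : V →ₗ[ℝ] V')) =
      Module.finrank ℝ (LinearMap.ker (A : V →ₗ[ℝ] V')))
    {v : V} (hv : A (J (A' v)) = 0) : A' v = 0 := by
  -- The kernel of B = A J A' contains ker A', and `T` = J A' + 1 - J A maps it injectively into ker
  -- A. Equality of the dimensions of ker A and ker A' then forces ker B = ker A'.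
  let B : V →ₗ[ℝ] V' := (A : V →ₗ[ℝ] V') ∘ₗ (J : V' →ₗ[ℝ] V) ∘ₗ (A' : V →ₗ[ℝ] V')
  have hle : LinearMap.ker (A' : V →ₗ[ℝ] V') ≤ LinearMap.ker B := by
    intro w hw
    have hw' : A' w = 0 := hw
    simp [B, hw']
  let T : V →ₗ[ℝ] V := (J : V' →ₗ[ℝ] V) ∘ₗ (A' : V →ₗ[ℝ] V') +
    (LinearMap.id - (J : V' →ₗ[ℝ] V) ∘ₗ (A : V →ₗ[ℝ] V'))
  have hTinj : Function.Injective T := hT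
  have hTker : (LinearMap.ker B).map T ≤ LinearMap.ker (A : V →ₗ[ℝ] V') := by
    rintro _ ⟨w, hw, rfl⟩
    have hw' : A (J (A' w)) = 0 := hw
    change A (J (A' w) + (w - J (A w))) = 0
    simp [hw', hJ]
  have h1 : Module.finrank ℝ (LinearMap.ker B) ≤
      Module.finrank ℝ (LinearMap.ker (A' : V →ₗ[ℝ] V')) := by
    rw [hrank, (Submodule.equivMapOfInjective T hTinj (LinearMap.ker B)).finrank_eq]
    exact Submodule.finrank_mono hTker
  have := Submodule.eq_of_le_of_finrank_le hle h1
  have hmem : v ∈ LinearMap.ker B := hv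
  rw [← this] at hmem
  exact hmem

theorem contDiffOn_inverse {A : S → V →L[ℝ] V'} {O : Set S} (hA : ContDiffOn ℝ ∞ A O)
    (hinv : ∀ s ∈ O, (A s).IsInvertible) :
    ContDiffOn ℝ ∞ (fun s => (A s).inverse) O := by
  have : CompleteSpace V := FiniteDimensional.complete ℝ V
  intro s hs
  obtain ⟨e, he⟩ := hinv s hs
  refine ContDiffAt.comp_contDiffWithinAt (g := ContinuousLinearMap.inverse) s ?_ (hA s hs)
  rw [← he]
  exact contDiffAt_map_inverse e

theorem isOpen_inter_isInvertible {A : S → V →L[ℝ] V'} {O : Set S} (hO : IsOpen O)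
    (hA : ContinuousOn A O) : IsOpen (O ∩ {s | (A s).IsInvertible}) := by
  have : CompleteSpace V := FiniteDimensional.complete ℝ V
  exact hA.isOpen_inter_preimage hO ContinuousLinearEquiv.isOpen

/-- Kernel vectors of a smooth family of linear maps extend smoothly, as kernel vectors wherever
the dimension of the kernel is the same. -/
theorem exists_kernel_transport {A : S → V →L[ℝ] V'} {O : Set S} (hO : IsOpen O)
    (hA : ContDiffOn ℝ ∞ A O) {s₀ : S} (hs₀ : s₀ ∈ O) :
    ∃ (U : Set S) (Z : S → V →L[ℝ] V), IsOpen U ∧ s₀ ∈ U ∧ U ⊆ O ∧ ContDiffOn ℝ ∞ Z U ∧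
      Z s₀ = ContinuousLinearMap.id ℝ V ∧ ∀ s ∈ U, (Z s).IsInvertible ∧
        (Module.finrank ℝ (LinearMap.ker (A s : V →ₗ[ℝ] V')) =
          Module.finrank ℝ (LinearMap.ker (A s₀ : V →ₗ[ℝ] V')) →
          ∀ z, A s₀ z = 0 → A s (Z s z) = 0) := by
  obtain ⟨J, hJ⟩ := exists_generalizedInverse (A s₀)
  -- T is the identity at `s₀`, hence invertible nearby, and Z is its inverse. For z in ker A(s₀),
  -- applying A(s₀) to T(Z z) = z leaves A(s₀) J A(s) Z z = 0, which the rank hypothesis improves to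
  -- A(s) Z z = 0.
  let T : S → V →L[ℝ] V := fun s =>
    J.comp (A s) + (ContinuousLinearMap.id ℝ V - J.comp (A s₀))
  have hT : ContDiffOn ℝ ∞ T O := (contDiffOn_const.clm_comp hA).add contDiffOn_const
  have hT₀ : T s₀ = ContinuousLinearMap.id ℝ V := by simp [T]
  refine ⟨O ∩ {s | (T s).IsInvertible}, fun s => (T s).inverse,
    isOpen_inter_isInvertible hO hT.continuousOn,
    ⟨hs₀, ContinuousLinearEquiv.refl ℝ V, by rw [hT₀]; rfl⟩, inter_subset_left,
    contDiffOn_inverse (hT.mono inter_subset_left) fun s hs => hs.2, ?_, ?_⟩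
  · simp [hT₀]
  · rintro s ⟨-, hs⟩
    refine ⟨?_, fun hrank z hz => ?_⟩
    · obtain ⟨e, he⟩ := hs
      exact ⟨e.symm, by simp [← he]⟩
    · refine apply_eq_zero_of_finrank_ker_eq hJ (?_ : Function.Injective (T s)) hrank ?_
      · obtain ⟨e, he⟩ := hs
        rw [← he]
        exact e.injective
      · have h1 : T s ((T s).inverse z) = z := hs.self_apply_inverse z
        have h2 := congrArg (A s₀) h1
        simpa [T, hJ, hz] using h2

/-- A smooth family of linear maps has a smooth left inverse near a point where it is injective. -/
theorem exists_smooth_leftInverse {A : S → V →L[ℝ] V'} {O : Set S} (hO : IsOpen O)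
    (hA : ContDiffOn ℝ ∞ A O) {s₀ : S} (hs₀ : s₀ ∈ O) (hinj : Function.Injective (A s₀)) :
    ∃ (U : Set S) (R : S → V' →L[ℝ] V), IsOpen U ∧ s₀ ∈ U ∧ U ⊆ O ∧ ContDiffOn ℝ ∞ R U ∧
      ∀ s ∈ U, ∀ v, R s (A s v) = v := by
  obtain ⟨J, hJ⟩ := exists_leftInverse_clm (A s₀) hinj
  have hT : ContDiffOn ℝ ∞ (fun s => J.comp (A s)) O := contDiffOn_const.clm_comp hA
  refine ⟨O ∩ {s | (J.comp (A s)).IsInvertible}, fun s => (J.comp (A s)).inverse.comp J,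
    isOpen_inter_isInvertible hO hT.continuousOn,
    ⟨hs₀, ContinuousLinearEquiv.refl ℝ V, ?_⟩, inter_subset_left,
    (contDiffOn_inverse (hT.mono inter_subset_left) fun s hs => hs.2).clm_comp contDiffOn_const, ?_⟩
  · ext v
    simp [hJ]
  · rintro s ⟨-, hs⟩ v
    exact hs.inverse_apply_self v

/-- A smooth map `F` onto a submanifold, given by `γ = 0`, that is a submersion at `y₀` has a smooth
local section. -/
theorem exists_smooth_section {G : Type*} [NormedAddCommGroup G] [NormedSpace ℝ G]
    [FiniteDimensional ℝ G] {F : V → V'} {O : Set V} (hO : IsOpen O) (hF : ContDiffOn ℝ ∞ F O)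
    {y₀ : V} (hy₀ : y₀ ∈ O) {γ : V' → G} {W : Set V'} (hW : IsOpen W) (hγ : ContDiffOn ℝ ∞ γ W)
    (hyW : F y₀ ∈ W) (hzero : ∀ y ∈ O, F y ∈ W → γ (F y) = 0)
    (hrange : ∀ w, fderiv ℝ γ (F y₀) w = 0 → ∃ v, fderiv ℝ F y₀ v = w) :
    ∃ (σ : V' → V) (U : Set V'), IsOpen U ∧ F y₀ ∈ U ∧ U ⊆ W ∧ ContDiffOn ℝ ∞ σ U ∧
      σ (F y₀) = y₀ ∧ MapsTo σ U O ∧ ∀ s ∈ U, γ s = 0 → F (σ s) = s := by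
  set A := fderiv ℝ F y₀ with hAdef
  obtain ⟨J, hJ⟩ := exists_generalizedInverse A
  have hFat : ∀ y ∈ O, ContDiffAt ℝ ∞ F y := fun y hy => hF.contDiffAt (hO.mem_nhds hy)
  have hFd : HasFDerivAt F A y₀ := ((hFat y₀ hy₀).differentiableAt (by simp)).hasFDerivAt
  set AJ : V' →L[ℝ] V' := A.comp J with hAJ
  have hAJA : ∀ w, AJ (AJ w) = AJ w := fun w => by simp [hAJ, hJ]
  -- a local right inverse of the projection of `F` to the range of its derivative
  let i : V' → V := fun w => y₀ + J w
  have hi : ContDiff ℝ ∞ i := contDiff_const.add J.contDiff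
  have hO₁ : IsOpen (i ⁻¹' O) := hO.preimage hi.continuous
  have h0 : (0 : V') ∈ i ⁻¹' O := by simpa [i] using hy₀
  let f : V' → V' := fun w => AJ (F (i w)) + (w - AJ w)
  have hf : ContDiffOn ℝ ∞ f (i ⁻¹' O) :=
    (AJ.contDiff.comp_contDiffOn (hF.comp hi.contDiffOn fun w hw => hw)).add
      (contDiff_id.sub AJ.contDiff).contDiffOn
  have hfd : HasFDerivAt f ((ContinuousLinearEquiv.refl ℝ V' : V' ≃L[ℝ] V') : V' →L[ℝ] V') 0 := by
    have h1 : HasFDerivAt i J 0 := (J.hasFDerivAt).const_add y₀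
    have h2 : HasFDerivAt F A (i 0) := by simpa [i] using hFd
    have h3 := ((AJ.hasFDerivAt.comp _ (h2.comp _ h1))).add
      ((hasFDerivAt_id (0 : V')).sub AJ.hasFDerivAt)
    refine h3.congr_fderiv ?_
    ext w
    simp [hAJ, hJ]
  obtain ⟨τ, U₁, hU₁, hfU₁, hτ, hτ0, hτr, -⟩ := exists_smooth_localInverse hO₁ hf h0 hfd
  have hf0 : f 0 = AJ (F y₀) := by simp [f, i]
  -- injectivity of `(A J, γ)` near `F y₀`
  have hγd : HasFDerivAt γ (fderiv ℝ γ (F y₀)) (F y₀) :=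
    ((hγ.contDiffAt (hW.mem_nhds hyW)).differentiableAt (by simp)).hasFDerivAt
  let Θ' : V' →L[ℝ] V' × G := AJ.prod (fderiv ℝ γ (F y₀))
  have hΘ' : Function.Injective Θ' := by
    rw [injective_iff_map_eq_zero]
    intro w hw
    have hw1 : AJ w = 0 := congrArg Prod.fst hw
    have hw2 : fderiv ℝ γ (F y₀) w = 0 := congrArg Prod.snd hw
    obtain ⟨v, rfl⟩ := hrange w hw2
    simpa [hAJ, hJ] using hw1
  obtain ⟨Λ, hΛ⟩ := exists_leftInverse_clm Θ' hΘ'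
  let θ : V' → V' := fun s => Λ (AJ s, γ s)
  have hθ : ContDiffOn ℝ ∞ θ W :=
    Λ.contDiff.comp_contDiffOn (AJ.contDiff.contDiffOn.prodMk hγ)
  have hθd : HasFDerivAt θ ((ContinuousLinearEquiv.refl ℝ V' : V' ≃L[ℝ] V') : V' →L[ℝ] V')
      (F y₀) := by
    refine (Λ.hasFDerivAt.comp _ (AJ.hasFDerivAt.prodMk hγd)).congr_fderiv ?_
    ext w
    exact hΛ w
  obtain ⟨ρ, U₂, hU₂, hθU₂, -, -, -, hρ⟩ := exists_smooth_localInverse hW hθ hyW hθd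
  obtain ⟨U₃, hU₃sub, hU₃, hyU₃⟩ := eventually_nhds_iff.1 hρ
  -- the section
  let σ : V' → V := fun s => i (τ (AJ s))
  let U₄ := AJ ⁻¹' U₁
  have hU₄ : IsOpen U₄ := hU₁.preimage AJ.continuous
  have hσ : ContDiffOn ℝ ∞ σ U₄ :=
    hi.comp_contDiffOn (hτ.comp AJ.contDiff.contDiffOn fun s hs => hs)
  have hσO : MapsTo σ U₄ O := fun s hs => (hτr _ hs).1
  have hσ0 : σ (F y₀) = y₀ := by
    have : τ (AJ (F y₀)) = 0 := by rw [← hf0, hτ0]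
    simp [σ, this, i]
  have hyU₄ : F y₀ ∈ U₄ := by simpa [U₄, hf0] using hfU₁
  have hFσ : ContinuousOn (F ∘ σ) U₄ := hF.continuousOn.comp hσ.continuousOn hσO
  let U := U₄ ∩ (F ∘ σ) ⁻¹' (U₃ ∩ W) ∩ (U₃ ∩ W)
  refine ⟨σ, U, (hFσ.isOpen_inter_preimage hU₄ (hU₃.inter hW)).inter (hU₃.inter hW),
    ⟨⟨hyU₄, ?_⟩, hyU₃, hyW⟩, fun s hs => hs.2.2, hσ.mono fun s hs => hs.1.1, hσ0,
    fun s hs => hσO hs.1.1, ?_⟩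
  · simpa [hσ0] using ⟨hyU₃, hyW⟩
  · rintro s ⟨⟨hs4, hFs3, hFsW⟩, hs3, hsW⟩ hγs
    -- F(σ s) and s have the same image under the projection `AJ`, and γ vanishes at both. So θ does
    -- not separate them, and θ is injective near F y₀.
    have h1 : AJ (F (σ s)) = AJ s := by
      have h2 := congrArg AJ (hτr _ hs4).2
      simpa [f, hAJA] using h2
    have h2 : θ (F (σ s)) = θ s := by
      simp only [θ, h1, hγs, hzero _ (hσO hs4) hFsW]
    have h3 := (hU₃sub _ hFs3).2
    have h4 := (hU₃sub _ hs3).2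
    simp only [Function.comp_apply] at h3
    exact h3.symm.trans ((congrArg ρ h2).trans h4)

/-- A function whose derivative kills the kernel of the derivative of a map `F` of constant rank
is locally constant on the fibres of `F`. -/
theorem eventually_eq_of_ker_le {G : Type*} [NormedAddCommGroup G] [NormedSpace ℝ G]
    {F : V → V'} {h : V → G} {O : Set V} (hO : IsOpen O) (hF : ContDiffOn ℝ ∞ F O)
    (hh : DifferentiableOn ℝ h O) {y₀ : V} (hy₀ : y₀ ∈ O)
    (hrank : ∀ y ∈ O, Module.finrank ℝ (LinearMap.ker (fderiv ℝ F y : V →ₗ[ℝ] V')) =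
      Module.finrank ℝ (LinearMap.ker (fderiv ℝ F y₀ : V →ₗ[ℝ] V')))
    (hker : ∀ y ∈ O, ∀ v, fderiv ℝ F y v = 0 → fderiv ℝ h y v = 0) :
    ∀ᶠ y in 𝓝 y₀, F y = F y₀ → h y = h y₀ := by
  set A := fderiv ℝ F y₀ with hAdef
  obtain ⟨J, hJ⟩ := exists_generalizedInverse A
  have hFat : ∀ y ∈ O, HasFDerivAt F (fderiv ℝ F y) y := fun y hy =>
    ((hF.contDiffAt (hO.mem_nhds hy)).differentiableAt (by simp)).hasFDerivAt
  let P : V →L[ℝ] V := ContinuousLinearMap.id ℝ V - J.comp A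
  -- Coordinates that straighten the fibres: the derivative of Θ at y₀ is the identity. Points of
  -- one fibre of F differ under Θ by a vector P(y - y₀), which lies in ker A.
  let Θ : V → V := fun y => J (F y) + P y
  let T : V → V →L[ℝ] V := fun y => J.comp (fderiv ℝ F y) + P
  have hΘd : ∀ y ∈ O, HasFDerivAt Θ (T y) y := fun y hy =>
    (J.hasFDerivAt.comp _ (hFat y hy)).add P.hasFDerivAt
  have hT : ContinuousOn T O :=
    (continuousOn_const.clm_comp (hF.continuousOn_fderiv_of_isOpen hO (by simp))).add
      continuousOn_const
  let O' := O ∩ {y | (T y).IsInvertible}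
  have hO' : IsOpen O' := isOpen_inter_isInvertible hO hT
  have hT₀ : T y₀ = ((ContinuousLinearEquiv.refl ℝ V : V ≃L[ℝ] V) : V →L[ℝ] V) := by
    ext v
    simp [T, P, ← hAdef]
  have hy₀' : y₀ ∈ O' := ⟨hy₀, _, hT₀.symm⟩
  have hΘs : ContDiffOn ℝ ∞ Θ O' :=
    ((J.contDiff.comp_contDiffOn hF).add P.contDiff.contDiffOn).mono inter_subset_left
  obtain ⟨τ, U, hU, hΘU, hτ, -, hτr, hτl⟩ :=
    exists_smooth_localInverse hO' hΘs hy₀' (hT₀ ▸ hΘd y₀ hy₀)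
  obtain ⟨ε, hε, hball⟩ := Metric.isOpen_iff.1 hU _ hΘU
  have hcont : ContinuousAt Θ y₀ := (hΘd y₀ hy₀).continuousAt
  filter_upwards [hτl, hcont.preimage_mem_nhds (Metric.ball_mem_nhds _ hε)]
    with y hy hyball hFy
  have hAP : ∀ v, A (P v) = 0 := fun v => by simp [P, hJ]
  have hdiff : Θ y - Θ y₀ = P (y - y₀) := by simp [Θ, hFy]
  -- the segment from `Θ y₀` to `Θ y`
  let c : ℝ → V := fun t => Θ y₀ + t • P (y - y₀)
  have hc : ∀ t ∈ Icc (0 : ℝ) 1, c t ∈ Metric.ball (Θ y₀) ε := by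
    intro t ht
    have := (convex_ball (Θ y₀) ε).add_smul_sub_mem (Metric.mem_ball_self hε) hyball ht
    simpa only [c, ← hdiff] using this
  have hcd : ∀ t, HasDerivAt c (P (y - y₀)) t := fun t => by
    have := ((hasDerivAt_id t).smul_const (P (y - y₀))).const_add (Θ y₀)
    rwa [one_smul] at this
  have hderiv : ∀ t ∈ Icc (0 : ℝ) 1, HasDerivAt (fun t => h (τ (c t))) 0 t := by
    intro t ht
    have hct := hball (hc t ht)
    obtain ⟨⟨hτO, hτinv⟩, hΘτ⟩ := hτr _ hct
    have hτd : HasFDerivAt τ (fderiv ℝ τ (c t)) (c t) :=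
      ((hτ.contDiffAt (hU.mem_nhds hct)).differentiableAt (by simp)).hasFDerivAt
    set ξ := fderiv ℝ τ (c t) (P (y - y₀)) with hξ
    have h1 : T (τ (c t)) ξ = P (y - y₀) := by
      have h2 : HasFDerivAt (fun p => Θ (τ p)) ((T (τ (c t))).comp (fderiv ℝ τ (c t))) (c t) :=
        (hΘd _ hτO).comp (c t) hτd
      have h3 : HasFDerivAt (fun p => Θ (τ p)) (ContinuousLinearMap.id ℝ V) (c t) :=
        (hasFDerivAt_id (c t)).congr_of_eventuallyEq
          (Filter.eventuallyEq_of_mem (hU.mem_nhds hct) fun p hp => (hτr p hp).2)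
      exact congrArg (fun B : V →L[ℝ] V => B (P (y - y₀))) (h2.unique h3)
    -- Applying A to T ξ = P(y - y₀) and using A P = 0 shows that A J kills F'ξ. Since the rank is
    -- constant, F'ξ itself vanishes, so the segment pulls back to a curve along which h has zero
    -- derivative.
    have h2 : fderiv ℝ F (τ (c t)) ξ = 0 := by
      refine apply_eq_zero_of_finrank_ker_eq hJ (?_ : Function.Injective (T (τ (c t))))
        (hrank _ hτO) ?_
      · obtain ⟨e, he⟩ := hτinv
        rw [← he]
        exact e.injective
      · have h3 := congrArg A h1
        rw [hAP] at h3
        simpa [T, hAP] using h3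
    have h3 : HasDerivAt (fun t => h (τ (c t))) (fderiv ℝ h (τ (c t)) ξ) t :=
      ((hh.differentiableAt (hO.mem_nhds hτO)).hasFDerivAt.comp (c t) hτd).comp_hasDerivAt t (hcd t)
    rwa [hker _ hτO _ h2] at h3
  have hconst := (convex_Icc (0 : ℝ) 1).is_const_of_fderivWithin_eq_zero (𝕜 := ℝ)
    (f := fun t => h (τ (c t)))
    (fun t ht => (hderiv t ht).differentiableAt.differentiableWithinAt)
    (fun t ht => by
      have := (hderiv t ht).hasFDerivAt.hasFDerivWithinAt.fderivWithin
        (uniqueDiffOn_Icc zero_lt_one t ht)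
      rw [this]; ext; simp)
    (right_mem_Icc.2 zero_le_one) (left_mem_Icc.2 zero_le_one)
  have hc1 : c 1 = Θ y := by
    simp only [c, one_smul, ← hdiff]
    abel
  have hc0 : c 0 = Θ y₀ := by simp [c]
  simp only [hc1, hc0] at hconst
  rwa [hy.2, hτl.self_of_nhds.2] at hconst

end Flat

end SingularLagrangian

namespace SingularLagrangian

/-! ### Derivatives in charts -/

section Charts

variable {E H M : Type*} [NormedAddCommGroup E] [NormedSpace ℝ E] [TopologicalSpace H]
  {I : ModelWithCorners ℝ E H} [I.Boundaryless] [TopologicalSpace M] [ChartedSpace H M]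
  [IsManifold I ∞ M]
  {E' H' M' : Type*} [NormedAddCommGroup E'] [NormedSpace ℝ E'] [TopologicalSpace H']
  {I' : ModelWithCorners ℝ E' H'} [I'.Boundaryless] [TopologicalSpace M'] [ChartedSpace H' M']
  [IsManifold I' ∞ M']
  {F : Type*} [NormedAddCommGroup F] [NormedSpace ℝ F]

variable (I) in
theorem mdifferentiableAt_extChartAt_of_mem {x₀ x : M} (hx : x ∈ (extChartAt I x₀).source) :
    MDifferentiableAt I 𝓘(ℝ, E) (extChartAt I x₀) x :=
  mdifferentiableAt_extChartAt (by rwa [extChartAt_source] at hx)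

variable (I) in
theorem mdifferentiableAt_extChartAt_symm_of_mem {x₀ : M} {y : E}
    (hy : y ∈ (extChartAt I x₀).target) :
    MDifferentiableAt 𝓘(ℝ, E) I (extChartAt I x₀).symm y := by
  have := mdifferentiableWithinAt_extChartAt_symm hy
  rwa [I.range_eq_univ, mdifferentiableWithinAt_univ] at this

/-- The differential of a vector-valued function in a chart. -/
theorem mfderiv_apply_eq_fderiv_chart {f : M → F} {x₀ x : M}
    (hx : x ∈ (extChartAt I x₀).source) (hf : MDifferentiableAt I 𝓘(ℝ, F) f x)
    (w : TangentSpace I x) :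
    mfderiv I 𝓘(ℝ, F) f x w =
      fderiv ℝ (f ∘ (extChartAt I x₀).symm) (extChartAt I x₀ x)
        (mfderiv I 𝓘(ℝ, E) (extChartAt I x₀) x w) := by
  have hsymm := mdifferentiableAt_extChartAt_symm_of_mem I ((extChartAt I x₀).map_source hx)
  have hf' : MDifferentiableAt I 𝓘(ℝ, F) f ((extChartAt I x₀).symm (extChartAt I x₀ x)) := by
    rwa [(extChartAt I x₀).left_inv hx]
  have hcomp := hf'.comp _ hsymm
  have heq : f =ᶠ[𝓝 x] (f ∘ (extChartAt I x₀).symm) ∘ extChartAt I x₀ := by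
    filter_upwards [(isOpen_extChartAt_source x₀).mem_nhds hx] with z hz
    exact congrArg f ((extChartAt I x₀).left_inv hz).symm
  rw [heq.mfderiv_eq, mfderiv_comp x hcomp (mdifferentiableAt_extChartAt_of_mem I hx),
    mfderiv_eq_fderiv]
  rfl

/-- The differential of a map in charts. -/
theorem mfderiv_chart_comp_mfderiv {f : M → M'} {x₀ x : M} {y₀ : M'}
    (hx : x ∈ (extChartAt I x₀).source) (hy : f x ∈ (extChartAt I' y₀).source)
    (hf : MDifferentiableAt I I' f x) (w : TangentSpace I x) :
    mfderiv I' 𝓘(ℝ, E') (extChartAt I' y₀) (f x) (mfderiv I I' f x w) =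
      fderiv ℝ (extChartAt I' y₀ ∘ f ∘ (extChartAt I x₀).symm) (extChartAt I x₀ x)
        (mfderiv I 𝓘(ℝ, E) (extChartAt I x₀) x w) := by
  have hΦ := mdifferentiableAt_extChartAt_of_mem I' hy
  have h := mfderiv_apply_eq_fderiv_chart hx (hΦ.comp x hf) w
  rw [mfderiv_comp x hΦ hf] at h
  exact h

theorem contDiffOn_comp_chart_symm {f : M → F} {O : Set M} (hf : ContMDiffOn I 𝓘(ℝ, F) ∞ f O)
    (x₀ : M) : ContDiffOn ℝ ∞ (f ∘ (extChartAt I x₀).symm)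
      ((extChartAt I x₀).target ∩ (extChartAt I x₀).symm ⁻¹' O) := by
  rw [← contMDiffOn_iff_contDiffOn]
  exact hf.comp ((contMDiffOn_extChartAt_symm x₀).mono inter_subset_left) fun y hy => hy.2

theorem contMDiffOn_comp_chart {g : E → F} {O : Set E} (hg : ContDiffOn ℝ ∞ g O) (x₀ : M) :
    ContMDiffOn I 𝓘(ℝ, F) ∞ (g ∘ extChartAt I x₀)
      ((extChartAt I x₀).source ∩ extChartAt I x₀ ⁻¹' O) :=
  hg.contMDiffOn.comp ((contMDiffOn_extChartAt (x := x₀)).mono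
    (by rw [extChartAt_source]; exact inter_subset_left)) fun y hy => hy.2

theorem isOpen_chart_preimage {O : Set E} (hO : IsOpen O) (x₀ : M) :
    IsOpen ((extChartAt I x₀).source ∩ extChartAt I x₀ ⁻¹' O) :=
  isOpen_extChartAt_preimage' x₀ hO

theorem isOpen_chart_symm_preimage {O : Set M} (hO : IsOpen O) (x₀ : M) :
    IsOpen ((extChartAt I x₀).target ∩ (extChartAt I x₀).symm ⁻¹' O) :=
  (continuousOn_extChartAt_symm x₀).isOpen_inter_preimage (isOpen_extChartAt_target x₀) hO

variable (I) in
theorem mfderiv_extChartAt_injective {x₀ x : M} (hx : x ∈ (extChartAt I x₀).source) :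
    Function.Injective (mfderiv I 𝓘(ℝ, E) (extChartAt I x₀) x) := by
  obtain ⟨e, he⟩ := isInvertible_mfderiv_extChartAt hx
  rw [← he]
  exact e.injective

variable (I) in
theorem mfderiv_extChartAt_surjective {x₀ x : M} (hx : x ∈ (extChartAt I x₀).source) :
    Function.Surjective (mfderiv I 𝓘(ℝ, E) (extChartAt I x₀) x) := by
  obtain ⟨e, he⟩ := isInvertible_mfderiv_extChartAt hx
  rw [← he]
  exact e.surjective

end Charts

/-! ### The fibre derivative in bundle charts -/

variable {D : ℕ} {Q : Type*} [TopologicalSpace Q] [ChartedSpace (Coord D) Q]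
  [IsManifold (𝓡 D) ∞ Q]

/-- The linear identification of the tangent space at `q` with `ℝ^D` given by the chart at `q₀`. -/
noncomputable def frame (q₀ q : Q) : Coord D →L[ℝ] Coord D :=
  (trivializationAt (Coord D) (TangentSpace (𝓡 D)) q₀).symmL ℝ q

theorem frame_apply {q₀ q : Q} (hq : q ∈ (chartAt (Coord D) q₀).source) (v : Coord D) :
    frame q₀ q v = (trivializationAt (Coord D) (TangentSpace (𝓡 D)) q₀).symm q v :=
  Trivialization.symmL_apply _ hq v

theorem mem_extChartAt_source_L {u₀ u : VelocitySpace D Q} :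
    u ∈ (extChartAt (modelL D) u₀).source ↔ u.1 ∈ (chartAt (Coord D) u₀.1).source := by
  rw [extChartAt_source, TangentBundle.mem_chart_source_iff]

theorem extChartAt_L_apply (u₀ u : VelocitySpace D Q) :
    extChartAt (modelL D) u₀ u = (extChartAt (𝓡 D) u₀.1 u.1,
      (trivializationAt (Coord D) (TangentSpace (𝓡 D)) u₀.1 u).2) := by
  rw [FiberBundle.extChartAt]
  rfl

theorem mem_extChartAt_source_C {s₀ s : PhaseSpace D Q} :
    s ∈ (extChartAt (modelC D) s₀).source ↔ s.1 ∈ (chartAt (Coord D) s₀.1).source := by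
  rw [FiberBundle.extChartAt, PartialEquiv.trans_source, Trivialization.source_eq,
    hom_trivializationAt_baseSet]
  simp only [PartialEquiv.prod_source, extChartAt_source, PartialEquiv.refl_source, mem_inter_iff,
    mem_preimage, mem_prod, mem_univ, and_true,
    TangentBundle.trivializationAt_baseSet]
  rw [show (trivializationAt ℝ (Trivial Q ℝ) s₀.proj).baseSet = univ from rfl]
  simp only [mem_univ, and_true]
  exact and_iff_left_of_imp fun h => by
    change ((trivializationAt (Coord D →L[ℝ] ℝ)
      (fun x => TangentSpace (𝓡 D) x →L[ℝ] Trivial Q ℝ x) s₀.proj s).1) ∈ _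
    rwa [hom_trivializationAt_apply]

/-- The trivialization of the dual bundle reads a covector in the frame of the tangent bundle; the
trivial factor ℝ contributes the identity. -/
theorem extChartAt_C_apply (s₀ s : PhaseSpace D Q) :
    extChartAt (modelC D) s₀ s = (extChartAt (𝓡 D) s₀.1 s.1, s.2.comp (frame s₀.1 s.1)) := by
  rw [FiberBundle.extChartAt]
  change Prod.map (extChartAt (𝓡 D) s₀.1) id
    (trivializationAt (Coord D →L[ℝ] ℝ) (fun x => TangentSpace (𝓡 D) x →L[ℝ] Trivial Q ℝ x)
      s₀.proj s) = _
  rw [hom_trivializationAt_apply]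
  have key : (trivializationAt ℝ (Trivial Q ℝ) s₀.proj).continuousLinearMapAt ℝ s.proj =
      ContinuousLinearMap.id ℝ ℝ := Trivial.continuousLinearMapAt_trivialization ℝ Q ℝ s.proj
  simp only [Prod.map, id, ContinuousLinearMap.inCoordinates]
  rw [key]
  rfl

theorem mem_extChartAt_target_L {u₀ : VelocitySpace D Q} {y : Coord D × Coord D} :
    y ∈ (extChartAt (modelL D) u₀).target ↔ y.1 ∈ (extChartAt (𝓡 D) u₀.1).target := by
  rw [FiberBundle.extChartAt_target]
  simp only [mem_prod, mem_inter_iff, mem_preimage, mem_univ, and_true]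
  exact and_iff_left_of_imp fun h => by
    have := (extChartAt (𝓡 D) u₀.1).map_target h
    rwa [extChartAt_source] at this

theorem extChartAt_L_symm_apply {u₀ : VelocitySpace D Q} {y : Coord D × Coord D}
    (hy : y.1 ∈ (extChartAt (𝓡 D) u₀.1).target) :
    (extChartAt (modelL D) u₀).symm y = ⟨(extChartAt (𝓡 D) u₀.1).symm y.1,
      frame u₀.1 ((extChartAt (𝓡 D) u₀.1).symm y.1) y.2⟩ := by
  rw [FiberBundle.extChartAt]
  change (trivializationAt (Coord D) (TangentSpace (𝓡 D)) u₀.1).toOpenPartialHomeomorph.symm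
    ((extChartAt (𝓡 D) u₀.1).symm y.1, y.2) = _
  have := (extChartAt (𝓡 D) u₀.1).map_target hy
  rw [extChartAt_source] at this
  refine (Trivialization.mk_symm (trivializationAt (Coord D) (TangentSpace (𝓡 D)) u₀.1) this
    y.2).symm.trans ?_
  rw [frame_apply this]

theorem frame_self (q : Q) : frame (D := D) q q = ContinuousLinearMap.id ℝ (Coord D) := by
  rw [frame, TangentBundle.symmL_trivializationAt_eq_core (mem_chart_source _ q)]
  ext1 v
  exact (tangentBundleCore (𝓡 D) Q).coordChange_self _ q (mem_chart_source _ q) v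

/-- The inverse of the identification `frame`. -/
noncomputable def coframe (q₀ q : Q) : Coord D →L[ℝ] Coord D :=
  (trivializationAt (Coord D) (TangentSpace (𝓡 D)) q₀).continuousLinearMapAt ℝ q

theorem frame_coframe {q₀ q : Q} (hq : q ∈ (chartAt (Coord D) q₀).source) (v : Coord D) :
    frame q₀ q (coframe q₀ q v) = v :=
  (trivializationAt (Coord D) (TangentSpace (𝓡 D)) q₀).symmL_continuousLinearMapAt hq v

theorem coframe_frame {q₀ q : Q} (hq : q ∈ (chartAt (Coord D) q₀).source) (v : Coord D) :
    coframe q₀ q (frame q₀ q v) = v :=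
  (trivializationAt (Coord D) (TangentSpace (𝓡 D)) q₀).continuousLinearMapAt_symmL hq v

theorem extChartAt_L_apply_of_mem {u₀ u : VelocitySpace D Q}
    (hu : u.1 ∈ (chartAt (Coord D) u₀.1).source) :
    extChartAt (modelL D) u₀ u = (extChartAt (𝓡 D) u₀.1 u.1, coframe u₀.1 u.1 u.2) := by
  rw [extChartAt_L_apply]
  have h : coframe u₀.1 u.1 u.2 = (trivializationAt (Coord D) (TangentSpace (𝓡 D)) u₀.1 u).2 := by
    have h1 := Trivialization.continuousLinearMapAt_apply ℝ
      (trivializationAt (Coord D) (TangentSpace (𝓡 D)) u₀.1) u.1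
    rw [Trivialization.coe_linearMapAt_of_mem
      (trivializationAt (Coord D) (TangentSpace (𝓡 D)) u₀.1) hu] at h1
    exact congrFun h1 u.2
  rw [h]

/-! ### Derivatives of the Lagrangian -/

variable {L : VelocitySpace D Q → ℝ}

/-- The fibre derivative in the bundle charts at `u₀`. -/
noncomputable def localFibreDerivative (L : VelocitySpace D Q → ℝ) (u₀ : VelocitySpace D Q)
    (y : Coord D × Coord D) : Coord D × (Coord D →L[ℝ] ℝ) :=
  (y.1, (fderiv ℝ (localLagrangian L u₀) y).comp (ContinuousLinearMap.inr ℝ (Coord D) (Coord D)))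

theorem contDiffOn_localLagrangian (hL : ContMDiff (modelL D) 𝓘(ℝ, ℝ) ∞ L)
    (u₀ : VelocitySpace D Q) :
    ContDiffOn ℝ ∞ (localLagrangian L u₀) (extChartAt (modelL D) u₀).target := by
  have := contDiffOn_comp_chart_symm (hL.contMDiffOn (s := univ)) u₀
  rwa [preimage_univ, inter_univ] at this

theorem contDiffAt_localLagrangian (hL : ContMDiff (modelL D) 𝓘(ℝ, ℝ) ∞ L)
    {u₀ : VelocitySpace D Q} {y : Coord D × Coord D} (hy : y ∈ (extChartAt (modelL D) u₀).target) :
    ContDiffAt ℝ ∞ (localLagrangian L u₀) y :=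
  (contDiffOn_localLagrangian hL u₀).contDiffAt ((isOpen_extChartAt_target u₀).mem_nhds hy)

theorem contDiffOn_fderiv_localLagrangian (hL : ContMDiff (modelL D) 𝓘(ℝ, ℝ) ∞ L)
    (u₀ : VelocitySpace D Q) :
    ContDiffOn ℝ ∞ (fderiv ℝ (localLagrangian L u₀)) (extChartAt (modelL D) u₀).target :=
  (contDiffOn_localLagrangian hL u₀).fderiv_of_isOpen (isOpen_extChartAt_target u₀) (by simp)

theorem contDiffOn_localFibreDerivative (hL : ContMDiff (modelL D) 𝓘(ℝ, ℝ) ∞ L)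
    (u₀ : VelocitySpace D Q) :
    ContDiffOn ℝ ∞ (localFibreDerivative L u₀) (extChartAt (modelL D) u₀).target :=
  contDiff_fst.contDiffOn.prodMk
    ((contDiffOn_fderiv_localLagrangian hL u₀).clm_comp contDiffOn_const)

theorem fderiv_localFibreDerivative_apply (hL : ContMDiff (modelL D) 𝓘(ℝ, ℝ) ∞ L)
    {u₀ : VelocitySpace D Q} {y : Coord D × Coord D} (hy : y ∈ (extChartAt (modelL D) u₀).target)
    (c : Coord D × Coord D) :
    fderiv ℝ (localFibreDerivative L u₀) y c =
      (c.1, (fderiv ℝ (fderiv ℝ (localLagrangian L u₀)) y c).comp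
        (ContinuousLinearMap.inr ℝ (Coord D) (Coord D))) := by
  have h2 : HasFDerivAt (fderiv ℝ (localLagrangian L u₀))
      (fderiv ℝ (fderiv ℝ (localLagrangian L u₀)) y) y :=
    (((contDiffOn_fderiv_localLagrangian hL u₀).contDiffAt
      ((isOpen_extChartAt_target u₀).mem_nhds hy)).differentiableAt (by simp)).hasFDerivAt
  have h3 := hasFDerivAt_fst (𝕜 := ℝ) (p := y) |>.prodMk
    (h2.clm_comp (hasFDerivAt_const (ContinuousLinearMap.inr ℝ (Coord D) (Coord D)) y))
  have h4 : HasFDerivAt (localFibreDerivative L u₀) _ y := h3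
  rw [h4.fderiv]
  ext <;> simp

/-- The symmetry of M, i.e. of second derivatives. It is what lets elements of ker M be recognized
by pairing with the image of M. -/
theorem fderiv_localFibreDerivative_symm (hL : ContMDiff (modelL D) 𝓘(ℝ, ℝ) ∞ L)
    {u₀ : VelocitySpace D Q} {y : Coord D × Coord D} (hy : y ∈ (extChartAt (modelL D) u₀).target)
    (b b' : Coord D) :
    (fderiv ℝ (localFibreDerivative L u₀) y (0, b)).2 b' =
      (fderiv ℝ (localFibreDerivative L u₀) y (0, b')).2 b := by
  rw [fderiv_localFibreDerivative_apply hL hy, fderiv_localFibreDerivative_apply hL hy]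
  have := (contDiffAt_localLagrangian hL hy).isSymmSndFDerivAt (by
    rw [minSmoothness_of_isRCLikeNormedField]; exact WithTop.coe_le_coe.2 (le_top : (2 : ℕ∞) ≤ ⊤))
  exact this (0, b) (0, b')

/-- On the fibre over q the Lagrangian is the chart Lagrangian composed with the linear map
`coframe`. The chain rule thus relates fibre derivatives, taken in the identification of T_qQ with
ℝ^D built into the types, to partial derivatives in one fixed bundle chart. -/
theorem hasFDerivAt_onFibre (hL : ContMDiff (modelL D) 𝓘(ℝ, ℝ) ∞ L)
    {u₀ : VelocitySpace D Q} {q : Q} (hq : q ∈ (chartAt (Coord D) u₀.1).source) (v : Coord D) :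
    HasFDerivAt (onFibre L q) ((fderiv ℝ (localLagrangian L u₀)
      (extChartAt (𝓡 D) u₀.1 q, coframe u₀.1 q v)).comp
        ((ContinuousLinearMap.inr ℝ (Coord D) (Coord D)).comp (coframe u₀.1 q))) v := by
  have hq' : q ∈ (extChartAt (𝓡 D) u₀.1).source := by rwa [extChartAt_source]
  have heq : onFibre L q =
      fun v => localLagrangian L u₀ (extChartAt (𝓡 D) u₀.1 q, coframe u₀.1 q v) := by
    funext v
    rw [localLagrangian, extChartAt_L_symm_apply ((extChartAt (𝓡 D) u₀.1).map_source hq')]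
    change onFibre L q v = onFibre L ((extChartAt (𝓡 D) u₀.1).symm (extChartAt (𝓡 D) u₀.1 q))
      (frame u₀.1 ((extChartAt (𝓡 D) u₀.1).symm (extChartAt (𝓡 D) u₀.1 q)) (coframe u₀.1 q v))
    rw [(extChartAt (𝓡 D) u₀.1).left_inv hq', frame_coframe hq]
  have hy : (extChartAt (𝓡 D) u₀.1 q, coframe u₀.1 q v) ∈ (extChartAt (modelL D) u₀).target :=
    mem_extChartAt_target_L.2 ((extChartAt (𝓡 D) u₀.1).map_source hq')
  rw [heq]
  have h1 := ((contDiffAt_localLagrangian hL hy).differentiableAt (by simp)).hasFDerivAt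
  have h2 : HasFDerivAt (fun v : Coord D => (extChartAt (𝓡 D) u₀.1 q, coframe u₀.1 q v))
      ((ContinuousLinearMap.inr ℝ (Coord D) (Coord D)).comp (coframe u₀.1 q)) v := by
    refine ((hasFDerivAt_const (extChartAt (𝓡 D) u₀.1 q) v).prodMk
      (coframe u₀.1 q).hasFDerivAt).congr_fderiv ?_
    rfl
  exact h1.comp v h2

/-- In the bundle charts at `u₀` the fibre derivative is `localFibreDerivative`. -/
theorem extChartAt_fibreDerivative (hL : ContMDiff (modelL D) 𝓘(ℝ, ℝ) ∞ L)
    {u₀ u : VelocitySpace D Q} (hu : u.1 ∈ (chartAt (Coord D) u₀.1).source) :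
    extChartAt (modelC D) (fibreDerivative L u₀) (fibreDerivative L u) =
      localFibreDerivative L u₀ (extChartAt (modelL D) u₀ u) := by
  rw [extChartAt_C_apply, extChartAt_L_apply_of_mem hu]
  simp only [localFibreDerivative, fibreDerivative]
  congr 1
  ext1 b
  refine (congrArg (fun A : Coord D →L[ℝ] ℝ => A (frame u₀.1 u.1 b))
    (hasFDerivAt_onFibre hL hu u.2).fderiv).trans ?_
  simp only [ContinuousLinearMap.comp_apply, coframe_frame hu b]

/-- The contraction of the velocity with the fibre derivative does not depend on the linear
coordinates chosen in the fibre. -/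
theorem energy_eq_local (hL : ContMDiff (modelL D) 𝓘(ℝ, ℝ) ∞ L)
    {u₀ u : VelocitySpace D Q} (hu : u.1 ∈ (chartAt (Coord D) u₀.1).source) :
    energy L u = fderiv ℝ (localLagrangian L u₀) (extChartAt (modelL D) u₀ u)
      (0, (extChartAt (modelL D) u₀ u).2) - localLagrangian L u₀ (extChartAt (modelL D) u₀ u) := by
  have h1 := congrArg (fun A : Coord D →L[ℝ] ℝ => A (u.2 : Coord D))
    (hasFDerivAt_onFibre hL hu u.2).fderiv
  have h2 : localLagrangian L u₀ (extChartAt (modelL D) u₀ u) = L u := by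
    rw [localLagrangian, (extChartAt (modelL D) u₀).left_inv (mem_extChartAt_source_L.2 hu)]
  rw [h2, extChartAt_L_apply_of_mem hu]
  exact congrArg (fun t => t - L u) h1

theorem contMDiff_fibreDerivative (hL : ContMDiff (modelL D) 𝓘(ℝ, ℝ) ∞ L) :
    ContMDiff (modelL D) (modelC D) ∞ (fibreDerivative L) := by
  intro u
  rw [contMDiffAt_totalSpace]
  refine ⟨contMDiffAt_proj _, ?_⟩
  have hsrc : (extChartAt (modelL D) u).source ∈ 𝓝 u := extChartAt_source_mem_nhds u
  have h1 : ContMDiffAt (modelL D) 𝓘(ℝ, Coord D →L[ℝ] ℝ) ∞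
      ((fun y => (localFibreDerivative L u y).2) ∘ extChartAt (modelL D) u) u :=
    (contMDiffOn_comp_chart (contDiff_snd.comp_contDiffOn
      (contDiffOn_localFibreDerivative hL u)) u).contMDiffAt
      (Filter.mem_of_superset hsrc fun z hz => ⟨hz, (extChartAt (modelL D) u).map_source hz⟩)
  refine h1.congr_of_eventuallyEq ?_
  filter_upwards [hsrc] with z hz
  have := extChartAt_fibreDerivative hL (mem_extChartAt_source_L.1 hz)
  simp only [Function.comp_apply, ← this]
  rw [FiberBundle.extChartAt]
  rfl

theorem contMDiff_energy (hL : ContMDiff (modelL D) 𝓘(ℝ, ℝ) ∞ L) :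
    ContMDiff (modelL D) 𝓘(ℝ, ℝ) ∞ (energy L) := by
  intro u
  have hsrc : (extChartAt (modelL D) u).source ∈ 𝓝 u := extChartAt_source_mem_nhds u
  have h0 : ContDiffOn ℝ ∞ (fun y => fderiv ℝ (localLagrangian L u) y (0, y.2) -
      localLagrangian L u y) (extChartAt (modelL D) u).target :=
    ((contDiffOn_fderiv_localLagrangian hL u).clm_apply
      (contDiff_const.prodMk contDiff_snd).contDiffOn).sub (contDiffOn_localLagrangian hL u)
  have h1 := (contMDiffOn_comp_chart h0 u).contMDiffAt
      (Filter.mem_of_superset hsrc fun z hz => ⟨hz, (extChartAt (modelL D) u).map_source hz⟩)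
  refine h1.congr_of_eventuallyEq ?_
  filter_upwards [hsrc] with z hz
  exact energy_eq_local hL (mem_extChartAt_source_L.1 hz)

end SingularLagrangian

namespace SingularLagrangian

/-- The inverse of an identification of a vector space with its algebraic dual, on covectors. -/
noncomputable def sharpOfDual {V : Type*} [NormedAddCommGroup V] [NormedSpace ℝ V]
    [FiniteDimensional ℝ V] (e : V ≃ₗ[ℝ] (V →ₗ[ℝ] ℝ)) : (V →L[ℝ] ℝ) →L[ℝ] V :=
  LinearMap.toContinuousLinearMap
    ((e.symm : (V →ₗ[ℝ] ℝ) →ₗ[ℝ] V) ∘ₗ ContinuousLinearMap.coeLM ℝ)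

/-! ### The standard symplectic form on `E × E*` -/

section Symplectic

variable {E : Type*} [NormedAddCommGroup E] [NormedSpace ℝ E] [FiniteDimensional ℝ E]

/-- The standard symplectic form on `E × E*`. -/
def stdForm (X Y : E × (E →L[ℝ] ℝ)) : ℝ := Y.2 X.1 - X.2 Y.1

theorem stdForm_add_left (X X' Y : E × (E →L[ℝ] ℝ)) :
    stdForm (X + X') Y = stdForm X Y + stdForm X' Y := by
  simp [stdForm]; ring

theorem stdForm_sub_left (X X' Y : E × (E →L[ℝ] ℝ)) :
    stdForm (X - X') Y = stdForm X Y - stdForm X' Y := by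
  simp [stdForm]; ring

theorem stdForm_smul_left (c : ℝ) (X Y : E × (E →L[ℝ] ℝ)) :
    stdForm (c • X) Y = c * stdForm X Y := by
  simp [stdForm]; ring

theorem stdForm_swap (X Y : E × (E →L[ℝ] ℝ)) : stdForm X Y = -stdForm Y X := by
  simp [stdForm]

/-- The standard symplectic form as a bilinear form. -/
noncomputable def stdBilin (E : Type*) [NormedAddCommGroup E] [NormedSpace ℝ E]
    [FiniteDimensional ℝ E] :
    (E × (E →L[ℝ] ℝ)) →ₗ[ℝ] (E × (E →L[ℝ] ℝ)) →ₗ[ℝ] ℝ :=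
  LinearMap.mk₂ ℝ stdForm stdForm_add_left stdForm_smul_left
    (fun X Y Z => by rw [stdForm_swap, stdForm_add_left, stdForm_swap Y, stdForm_swap Z]; ring)
    (fun c X Y => by
      rw [stdForm_swap, stdForm_smul_left, stdForm_swap Y, mul_neg, neg_neg, smul_eq_mul])

theorem eq_zero_of_forall_apply_eq_zero {a : E} (h : ∀ η : E →L[ℝ] ℝ, η a = 0) : a = 0 :=
  SeparatingDual.eq_zero_of_forall_dual_eq_zero (R := ℝ) h

theorem eq_zero_of_stdForm_eq_zero {X : E × (E →L[ℝ] ℝ)} (h : ∀ Y, stdForm X Y = 0) : X = 0 := by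
  have h1 : X.1 = 0 := eq_zero_of_forall_apply_eq_zero fun η => by
    have := h (0, η)
    rwa [stdForm, map_zero, sub_zero] at this
  have h2 : X.2 = 0 := ContinuousLinearMap.ext fun a => by
    have := h (a, 0)
    rw [stdForm] at this
    simpa using this
  exact Prod.ext h1 h2

theorem stdBilin_injective : Function.Injective (stdBilin E) := by
  rw [injective_iff_map_eq_zero]
  intro X hX
  exact eq_zero_of_stdForm_eq_zero fun Y =>
    congrArg (fun β : (E × (E →L[ℝ] ℝ)) →ₗ[ℝ] ℝ => β Y) hX

/-- The identification of vectors with covectors by the standard symplectic form. -/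
noncomputable def stdDual (E : Type*) [NormedAddCommGroup E] [NormedSpace ℝ E]
    [FiniteDimensional ℝ E] :
    (E × (E →L[ℝ] ℝ)) ≃ₗ[ℝ] ((E × (E →L[ℝ] ℝ)) →ₗ[ℝ] ℝ) :=
  LinearEquiv.ofInjectiveOfFinrankEq (stdBilin E) stdBilin_injective
    Subspace.dual_finrank_eq.symm

/-- The vector that corresponds to a covector under the standard symplectic form. -/
noncomputable def stdSharp : ((E × (E →L[ℝ] ℝ)) →L[ℝ] ℝ) →L[ℝ] (E × (E →L[ℝ] ℝ)) :=
  sharpOfDual (stdDual E)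

theorem stdForm_stdSharp (α : (E × (E →L[ℝ] ℝ)) →L[ℝ] ℝ) (Y : E × (E →L[ℝ] ℝ)) :
    stdForm (stdSharp α) Y = α Y :=
  congrArg (fun β : (E × (E →L[ℝ] ℝ)) →ₗ[ℝ] ℝ => β Y)
    ((stdDual E).apply_symm_apply (α : (E × (E →L[ℝ] ℝ)) →ₗ[ℝ] ℝ))

/-- The first half of Hamilton's equations: the base component of the Hamiltonian vector is the
restriction of the covector to momentum directions. -/
theorem apply_stdSharp_fst (α : (E × (E →L[ℝ] ℝ)) →L[ℝ] ℝ) (η : E →L[ℝ] ℝ) :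
    η (stdSharp α).1 = α (0, η) := by
  have := stdForm_stdSharp α (0, η)
  rwa [stdForm, map_zero, sub_zero] at this

/-- The lift `(x, p) ↦ (τ x, p ∘ (Dτ x)⁻¹)` of `τ` to `E × E*` is symplectic. -/
theorem stdForm_cotangentLift {τ : E → E} {x₀ : E} (hτ : ContDiffAt ℝ ∞ τ x₀) {R : E → E →L[ℝ] E}
    (hRτ : ∀ᶠ x in 𝓝 x₀, (R x).comp (fderiv ℝ τ x) = ContinuousLinearMap.id ℝ E)
    {Ψ : E × (E →L[ℝ] ℝ) → E × (E →L[ℝ] ℝ)} {p₀ : E →L[ℝ] ℝ}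
    (hΨ : Ψ =ᶠ[𝓝 (x₀, p₀)] fun y => (τ y.1, y.2.comp (R y.1))) (X Y : E × (E →L[ℝ] ℝ)) :
    stdForm (fderiv ℝ Ψ (x₀, p₀) X) (fderiv ℝ Ψ (x₀, p₀) Y) = stdForm X Y := by
  have hτd : HasFDerivAt τ (fderiv ℝ τ x₀) x₀ := (hτ.differentiableAt (by simp)).hasFDerivAt
  have hDτ : HasFDerivAt (fderiv ℝ τ) (fderiv ℝ (fderiv ℝ τ) x₀) x₀ :=
    ((hτ.fderiv_right (m := ∞) (by simp)).differentiableAt (by simp)).hasFDerivAt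
  -- R is assumed only to be a left inverse. In finite dimension it is then the inverse of Dτ, and
  -- inversion is smooth, so R inherits differentiability from Dτ.
  obtain ⟨R', hR⟩ : ∃ R', HasFDerivAt R R' x₀ := by
    have hinvt : ∀ᶠ x in 𝓝 x₀, (fderiv ℝ τ x).IsInvertible ∧ R x = (fderiv ℝ τ x).inverse := by
      filter_upwards [hRτ] with x hx
      have hx' : ∀ a, R x (fderiv ℝ τ x a) = a := fun a =>
        congrArg (fun A : E →L[ℝ] E => A a) hx
      have h1 := isInvertible_of_injective (fderiv ℝ τ x)
        (Function.LeftInverse.injective hx')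
      refine ⟨h1, ContinuousLinearMap.ext fun a => ?_⟩
      have h2 := hx' ((fderiv ℝ τ x).inverse a)
      rwa [h1.self_apply_inverse] at h2
    obtain ⟨e, he⟩ := hinvt.self_of_nhds.1
    have : CompleteSpace E := FiniteDimensional.complete ℝ E
    have h3 : ContDiffAt ℝ ∞ (fun x => (fderiv ℝ τ x).inverse) x₀ := by
      refine ContDiffAt.comp (g := ContinuousLinearMap.inverse) x₀ ?_
        (hτ.fderiv_right (m := ∞) (by simp))
      rw [← he]
      exact contDiffAt_map_inverse e
    exact ⟨_, ((h3.differentiableAt (by simp)).congr_of_eventuallyEq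
      (hinvt.mono fun x hx => hx.2)).hasFDerivAt⟩
  have hΨd : ∀ Z : E × (E →L[ℝ] ℝ), fderiv ℝ Ψ (x₀, p₀) Z =
      (fderiv ℝ τ x₀ Z.1, Z.2.comp (R x₀) + p₀.comp (R' Z.1)) := by
    intro Z
    have h1 : HasFDerivAt (fun y : E × (E →L[ℝ] ℝ) => τ y.1) _ (x₀, p₀) :=
      hτd.comp (x₀, p₀) hasFDerivAt_fst
    have h2 : HasFDerivAt (fun y : E × (E →L[ℝ] ℝ) => R y.1) _ (x₀, p₀) :=
      hR.comp (x₀, p₀) hasFDerivAt_fst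
    have h3 := (hasFDerivAt_snd (𝕜 := ℝ) (p := (x₀, p₀))).clm_comp h2
    rw [hΨ.fderiv_eq, (h1.prodMk h3).fderiv]
    ext <;> simp [add_comm]
  have hinv : ∀ a, R x₀ (fderiv ℝ τ x₀ a) = a := fun a =>
    congrArg (fun A : E →L[ℝ] E => A a) hRτ.self_of_nhds
  -- Differentiating R ∘ Dτ = 1 expresses R' through the second derivative of τ. The symmetry of D²τ
  -- then cancels the two terms containing p₀ in the pulled-back form.
  have hderiv : ∀ a a', R' a (fderiv ℝ τ x₀ a') = -R x₀ (fderiv ℝ (fderiv ℝ τ) x₀ a a') := by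
    intro a a'
    have h1 := hR.clm_comp hDτ
    have h2 := h1.unique ((hasFDerivAt_const (ContinuousLinearMap.id ℝ E) x₀).congr_of_eventuallyEq
      hRτ)
    have h3 := congrArg (fun A : E →L[ℝ] E →L[ℝ] E => A a a') h2
    simp only [add_apply, ContinuousLinearMap.comp_apply,
      ContinuousLinearMap.compL_apply, ContinuousLinearMap.flip_apply,
      zero_apply] at h3
    exact eq_neg_of_add_eq_zero_right h3
  have hsymm : ∀ a a', fderiv ℝ (fderiv ℝ τ) x₀ a a' = fderiv ℝ (fderiv ℝ τ) x₀ a' a :=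
    hτ.isSymmSndFDerivAt (by
      rw [minSmoothness_of_isRCLikeNormedField]
      exact WithTop.coe_le_coe.2 (le_top : (2 : ℕ∞) ≤ ⊤))
  rw [hΨd, hΨd]
  simp only [stdForm, add_apply, ContinuousLinearMap.comp_apply, hinv, hderiv,
    hsymm X.1 Y.1]
  ring

end Symplectic

end SingularLagrangian

namespace SingularLagrangian

variable {D : ℕ} {Q : Type*} [TopologicalSpace Q] [ChartedSpace (Coord D) Q]
  [IsManifold (𝓡 D) ∞ Q] {L : VelocitySpace D Q → ℝ}

/-! ### Chart coordinates of tangent vectors -/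

/-- The coordinates of a tangent vector of `TQ` in the bundle chart at `u₀`. -/
noncomputable def coordL (u₀ u : VelocitySpace D Q) : TL u →L[ℝ] Coord D × Coord D :=
  mfderiv (modelL D) 𝓘(ℝ, Coord D × Coord D) (extChartAt (modelL D) u₀) u

/-- The coordinates of a tangent vector of `T*Q` in the bundle chart at `s₀`. -/
noncomputable def coordC (s₀ s : PhaseSpace D Q) : TC s →L[ℝ] Coord D × (Coord D →L[ℝ] ℝ) :=
  mfderiv (modelC D) 𝓘(ℝ, Coord D × (Coord D →L[ℝ] ℝ)) (extChartAt (modelC D) s₀) s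

theorem coordL_injective {u₀ u : VelocitySpace D Q}
    (hu : u.1 ∈ (chartAt (Coord D) u₀.1).source) : Function.Injective (coordL u₀ u) :=
  mfderiv_extChartAt_injective (modelL D) (mem_extChartAt_source_L.2 hu)

theorem coordL_surjective {u₀ u : VelocitySpace D Q}
    (hu : u.1 ∈ (chartAt (Coord D) u₀.1).source) : Function.Surjective (coordL u₀ u) :=
  mfderiv_extChartAt_surjective (modelL D) (mem_extChartAt_source_L.2 hu)

theorem coordC_injective {s₀ s : PhaseSpace D Q}
    (hs : s.1 ∈ (chartAt (Coord D) s₀.1).source) : Function.Injective (coordC s₀ s) :=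
  mfderiv_extChartAt_injective (modelC D) (mem_extChartAt_source_C.2 hs)

theorem coordC_surjective {s₀ s : PhaseSpace D Q}
    (hs : s.1 ∈ (chartAt (Coord D) s₀.1).source) : Function.Surjective (coordC s₀ s) :=
  mfderiv_extChartAt_surjective (modelC D) (mem_extChartAt_source_C.2 hs)

theorem coordL_self (u : VelocitySpace D Q) (w : TL u) : coordL u u w = w := by
  rw [coordL, mfderiv_extChartAt_self]
  rfl

theorem coordC_self (s : PhaseSpace D Q) (w : TC s) : coordC s s w = w := by
  rw [coordC, mfderiv_extChartAt_self]
  rfl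

theorem canonicalForm_eq_stdForm (s : PhaseSpace D Q) (X Y : TC s) :
    canonicalForm s X Y =
      stdForm (E := Coord D) (X : Coord D × (Coord D →L[ℝ] ℝ)) (Y : Coord D × (Coord D →L[ℝ] ℝ)) :=
  rfl

theorem base_mem_source (q : Q) : q ∈ (chartAt (Coord D) q).source := mem_chart_source _ q

/-! ### The differential of the fibre derivative -/

theorem coordC_push (hL : ContMDiff (modelL D) 𝓘(ℝ, ℝ) ∞ L) {u₀ u : VelocitySpace D Q}
    (hu : u.1 ∈ (chartAt (Coord D) u₀.1).source) (w : TL u) :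
    coordC (fibreDerivative L u₀) (fibreDerivative L u) (push L u w) =
      fderiv ℝ (localFibreDerivative L u₀) (extChartAt (modelL D) u₀ u) (coordL u₀ u w) := by
  have hmem := mem_extChartAt_source_L.2 hu
  have hmemC : fibreDerivative L u ∈ (extChartAt (modelC D) (fibreDerivative L u₀)).source :=
    mem_extChartAt_source_C.2 hu
  have h1 := mfderiv_chart_comp_mfderiv (I := modelL D) (I' := modelC D) hmem hmemC
    ((contMDiff_fibreDerivative hL).mdifferentiableAt (by simp)) w
  refine h1.trans ?_
  have heq : extChartAt (modelC D) (fibreDerivative L u₀) ∘ fibreDerivative L ∘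
      (extChartAt (modelL D) u₀).symm =ᶠ[𝓝 (extChartAt (modelL D) u₀ u)]
        localFibreDerivative L u₀ := by
    filter_upwards [(isOpen_extChartAt_target u₀).mem_nhds
      ((extChartAt (modelL D) u₀).map_source hmem)] with y hy
    have hy' := (extChartAt (modelL D) u₀).map_target hy
    have h2 := extChartAt_fibreDerivative hL (mem_extChartAt_source_L.1 hy')
    rw [(extChartAt (modelL D) u₀).right_inv hy] at h2
    exact h2
  rw [heq.fderiv_eq]
  rfl

theorem push_eq (hL : ContMDiff (modelL D) 𝓘(ℝ, ℝ) ∞ L) (u : VelocitySpace D Q) (w : TL u) :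
    (push L u w : Coord D × (Coord D →L[ℝ] ℝ)) =
      fderiv ℝ (localFibreDerivative L u) (extChartAt (modelL D) u u)
        (w : Coord D × Coord D) := by
  have h := coordC_push hL (base_mem_source u.1) w
  rw [coordC_self, coordL_self] at h
  exact h

theorem extChartAt_self_mem_target (u : VelocitySpace D Q) :
    extChartAt (modelL D) u u ∈ (extChartAt (modelL D) u).target :=
  mem_extChartAt_target u

theorem push_eq_prod (hL : ContMDiff (modelL D) 𝓘(ℝ, ℝ) ∞ L) (u : VelocitySpace D Q) (w : TL u) :
    (push L u w : Coord D × (Coord D →L[ℝ] ℝ)) =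
      ((w : Coord D × Coord D).1, (fderiv ℝ (fderiv ℝ (localLagrangian L u))
        (extChartAt (modelL D) u u) (w : Coord D × Coord D)).comp
          (ContinuousLinearMap.inr ℝ (Coord D) (Coord D))) :=
  (push_eq hL u w).trans (fderiv_localFibreDerivative_apply hL (extChartAt_self_mem_target u) w)

theorem derivTheta_apply (hL : ContMDiff (modelL D) 𝓘(ℝ, ℝ) ∞ L) (u : VelocitySpace D Q)
    (X Y : Coord D × Coord D) :
    derivTheta L u X Y =
      fderiv ℝ (fderiv ℝ (localLagrangian L u)) (extChartAt (modelL D) u u) X (0, Y.1) := by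
  have h2 : HasFDerivAt (fderiv ℝ (localLagrangian L u))
      (fderiv ℝ (fderiv ℝ (localLagrangian L u)) (extChartAt (modelL D) u u))
        (extChartAt (modelL D) u u) :=
    (((contDiffOn_fderiv_localLagrangian hL u).contDiffAt
      ((isOpen_extChartAt_target u).mem_nhds (extChartAt_self_mem_target u))).differentiableAt
        (by simp)).hasFDerivAt
  have h3 := h2.clm_comp (hasFDerivAt_const ((ContinuousLinearMap.inr ℝ (Coord D) (Coord D)).comp
    (ContinuousLinearMap.fst ℝ (Coord D) (Coord D))) (extChartAt (modelL D) u u))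
  have h4 : HasFDerivAt (localTheta L u) _ (extChartAt (modelL D) u u) := h3
  rw [derivTheta, h4.fderiv]
  simp

/-- `Ω_L` is the pullback of `ω` by the fibre derivative. -/
theorem lagrangeForm_eq (hL : ContMDiff (modelL D) 𝓘(ℝ, ℝ) ∞ L) (u : VelocitySpace D Q)
    (X Y : TL u) :
    lagrangeForm L u X Y = canonicalForm (fibreDerivative L u) (push L u X) (push L u Y) := by
  have h1 : lagrangeForm L u X Y = derivTheta L u Y X - derivTheta L u X Y := rfl
  -- Both sides are differences of second derivatives of L with one slot vertical: the momentum part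
  -- of d𝓛(X), evaluated on the base part of Y, is the derivative of θ_L(Y) along X.
  rw [h1, canonicalForm_eq_stdForm, push_eq_prod hL, push_eq_prod hL]
  exact congrArg₂ (fun a b => a - b) (derivTheta_apply hL u Y X) (derivTheta_apply hL u X Y)

theorem hessian_apply (hL : ContMDiff (modelL D) 𝓘(ℝ, ℝ) ∞ L) (u : VelocitySpace D Q)
    (z z' : Coord D) :
    hessian L u z z' = fderiv ℝ (fderiv ℝ (localLagrangian L u)) (extChartAt (modelL D) u u)
      (0, z) (0, z') := by
  have hself : coframe (D := D) u.1 u.1 = ContinuousLinearMap.id ℝ (Coord D) := by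
    ext1 v
    have := frame_coframe (base_mem_source u.1) v
    rw [frame_self] at this
    exact this
  obtain ⟨v₀, hv₀⟩ : ∃ v₀ : Coord D, v₀ = u.2 := ⟨_, rfl⟩
  have hpt : extChartAt (modelL D) u u = (extChartAt (𝓡 D) u.1 u.1, v₀) := by
    rw [hv₀, extChartAt_L_apply_of_mem (base_mem_source u.1), hself]
    rfl
  have heq : fderiv ℝ (onFibre L u.1) = fun v => (fderiv ℝ (localLagrangian L u)
      (extChartAt (𝓡 D) u.1 u.1, v)).comp (ContinuousLinearMap.inr ℝ (Coord D) (Coord D)) := by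
    funext v
    rw [(hasFDerivAt_onFibre hL (base_mem_source u.1) v).fderiv, hself]
    rfl
  have h2 : HasFDerivAt (fderiv ℝ (localLagrangian L u))
      (fderiv ℝ (fderiv ℝ (localLagrangian L u)) (extChartAt (𝓡 D) u.1 u.1, v₀))
        (extChartAt (𝓡 D) u.1 u.1, v₀) := by
    have := (((contDiffOn_fderiv_localLagrangian hL u).contDiffAt
      ((isOpen_extChartAt_target u).mem_nhds (extChartAt_self_mem_target u))).differentiableAt
        (by simp)).hasFDerivAt
    rwa [hpt] at this
  have h3 : HasFDerivAt (fun v : Coord D => (extChartAt (𝓡 D) u.1 u.1, v))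
      (ContinuousLinearMap.inr ℝ (Coord D) (Coord D)) v₀ :=
    hasFDerivAt_prodMk_right _ _
  have h4 := (h2.comp v₀ h3).clm_comp
    (hasFDerivAt_const (ContinuousLinearMap.inr ℝ (Coord D) (Coord D)) v₀)
  have h5 : HasFDerivAt (fderiv ℝ (onFibre L u.1)) _ v₀ := heq ▸ h4
  change fderiv ℝ (fderiv ℝ (onFibre L u.1)) (u.2 : Coord D) z z' = _
  rw [← hv₀, h5.fderiv, hpt]
  simp

/-- In the chart at u, d𝓛(a, b) = (a, D²L(a, b)(0, ·)). Its vanishing gives a = 0, and what remains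
is M b = 0. -/
theorem push_eq_zero_iff (hL : ContMDiff (modelL D) 𝓘(ℝ, ℝ) ∞ L) (u : VelocitySpace D Q)
    (w : TL u) : push L u w = 0 ↔ w ∈ verticalKernel L u := by
  constructor
  · intro h
    have h' := push_eq_prod hL u w
    rw [h] at h'
    have h1 : (w : Coord D × Coord D).1 = 0 := (congrArg Prod.fst h').symm
    have h2 := congrArg Prod.snd h'
    refine ⟨(w : Coord D × Coord D).2, ?_, ?_⟩
    · refine ContinuousLinearMap.ext fun z' => ?_
      rw [ContinuousLinearMap.coe_coe, hessian_apply hL]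
      have h3 := congrArg (fun A : Coord D →L[ℝ] ℝ => A z') h2
      have h4 : (w : Coord D × Coord D) = (0, (w : Coord D × Coord D).2) := Prod.ext h1 rfl
      rw [h4] at h3
      exact h3.symm
    · exact Prod.ext h1.symm rfl
  · rintro ⟨z, hz, rfl⟩
    refine (push_eq_prod hL u _).trans ?_
    refine Prod.ext rfl (ContinuousLinearMap.ext fun z' => ?_)
    have h1 : hessian L u z = 0 := hz
    have h2 := hessian_apply hL u z z'
    rw [h1] at h2
    exact h2.symm

theorem ker_push (hL : ContMDiff (modelL D) 𝓘(ℝ, ℝ) ∞ L) (u : VelocitySpace D Q) :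
    LinearMap.ker (push L u : TL u →ₗ[ℝ] TC (fibreDerivative L u)) = verticalKernel L u := by
  ext w
  exact push_eq_zero_iff hL u w

theorem finrank_verticalKernel (u : VelocitySpace D Q) :
    Module.finrank ℝ (verticalKernel L u) = Module.finrank ℝ (kerHessian L u) :=
  (Submodule.equivMapOfInjective (verticalLift u) LinearMap.inr_injective
    (kerHessian L u)).finrank_eq.symm

/-- For w = (0, z) the two terms ∂L/∂v · z of dE cancel and z^a M_ab v^b is left, which vanishes for
z in ker M. This is why E descends to the primary surface. -/
theorem dL_energy_eq_zero (hL : ContMDiff (modelL D) 𝓘(ℝ, ℝ) ∞ L) (u : VelocitySpace D Q)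
    {w : TL u} (hw : push L u w = 0) : dL (energy L) u w = 0 := by
  set y := extChartAt (modelL D) u u with hy
  have hyt := extChartAt_self_mem_target u
  have h1 := mfderiv_apply_eq_fderiv_chart (mem_extChartAt_source (I := modelL D) u)
    ((contMDiff_energy hL).mdifferentiableAt (by simp) (x := u)) w
  rw [mfderiv_extChartAt_self] at h1
  refine h1.trans ?_
  have heq : energy L ∘ (extChartAt (modelL D) u).symm =ᶠ[𝓝 y] fun y =>
      fderiv ℝ (localLagrangian L u) y (0, y.2) - localLagrangian L u y := by
    filter_upwards [(isOpen_extChartAt_target u).mem_nhds hyt] with y hy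
    have hy' := (extChartAt (modelL D) u).map_target hy
    have h2 := energy_eq_local hL (mem_extChartAt_source_L.1 hy')
    rw [(extChartAt (modelL D) u).right_inv hy] at h2
    exact h2
  have h2 : HasFDerivAt (fderiv ℝ (localLagrangian L u))
      (fderiv ℝ (fderiv ℝ (localLagrangian L u)) y) y :=
    (((contDiffOn_fderiv_localLagrangian hL u).contDiffAt
      ((isOpen_extChartAt_target u).mem_nhds hyt)).differentiableAt (by simp)).hasFDerivAt
  have h3 : HasFDerivAt (localLagrangian L u) (fderiv ℝ (localLagrangian L u) y) y :=
    ((contDiffAt_localLagrangian hL hyt).differentiableAt (by simp)).hasFDerivAt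
  have h4 : HasFDerivAt (fun y : Coord D × Coord D => ((0 : Coord D), y.2))
      ((ContinuousLinearMap.inr ℝ (Coord D) (Coord D)).comp
        (ContinuousLinearMap.snd ℝ (Coord D) (Coord D))) y :=
    ((ContinuousLinearMap.inr ℝ (Coord D) (Coord D)).comp
        (ContinuousLinearMap.snd ℝ (Coord D) (Coord D))).hasFDerivAt
  have h34 : HasFDerivAt (fun y => fderiv ℝ (localLagrangian L u) y (0, y.2) -
      localLagrangian L u y) _ y := (h2.clm_apply h4).sub h3
  rw [← hy, heq.fderiv_eq, h34.fderiv]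
  have h5 := push_eq_prod hL u w
  rw [hw] at h5
  have h6 : (w : Coord D × Coord D) = (0, (w : Coord D × Coord D).2) :=
    Prod.ext (congrArg Prod.fst h5).symm rfl
  have h7 := congrArg (fun A : Coord D × (Coord D →L[ℝ] ℝ) => A.2 y.2) h5
  have h8 : fderiv ℝ (localLagrangian L u) y (0, (w : Coord D × Coord D).2) +
      fderiv ℝ (fderiv ℝ (localLagrangian L u)) y w (0, y.2) -
        fderiv ℝ (localLagrangian L u) y w = 0 := by
    rw [← h6]
    have h9 : fderiv ℝ (fderiv ℝ (localLagrangian L u)) y w (0, y.2) = 0 := h7.symm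
    rw [h9]
    ring
  exact h8

/-! ### Vertical vectors -/

theorem coordL_fst {u₀ u : VelocitySpace D Q} (hu : u.1 ∈ (chartAt (Coord D) u₀.1).source)
    (w : TL u) : (coordL u₀ u w).1 = mfderiv (𝓡 D) 𝓘(ℝ, Coord D) (extChartAt (𝓡 D) u₀.1) u.1
      (mfderiv (modelL D) (𝓡 D) (TotalSpace.proj : VelocitySpace D Q → Q) u w) := by
  have hmem := mem_extChartAt_source_L.2 hu
  have hq : u.1 ∈ (extChartAt (𝓡 D) u₀.1).source := by rwa [extChartAt_source]
  have h1 : MDifferentiableAt (modelL D) 𝓘(ℝ, Coord D × Coord D) (extChartAt (modelL D) u₀) u :=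
    mdifferentiableAt_extChartAt_of_mem (modelL D) hmem
  have h2 : MDifferentiableAt (modelL D) (𝓡 D) (TotalSpace.proj : VelocitySpace D Q → Q) u :=
    (contMDiff_proj (TangentSpace (𝓡 D) : Q → Type _) (n := 1)).mdifferentiableAt (by simp)
  have h3 := mdifferentiableAt_extChartAt_of_mem (𝓡 D) hq
  have heq : (ContinuousLinearMap.fst ℝ (Coord D) (Coord D)) ∘ extChartAt (modelL D) u₀ =
      extChartAt (𝓡 D) u₀.1 ∘ (TotalSpace.proj : VelocitySpace D Q → Q) := by
    funext z
    simp only [Function.comp_apply, extChartAt_L_apply]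
    rfl
  have h4 := mfderiv_comp u h3 h2
  have h5 := mfderiv_comp u (I' := 𝓘(ℝ, Coord D × Coord D))
    (ContinuousLinearMap.fst ℝ (Coord D) (Coord D)).mdifferentiableAt h1
  rw [← heq, h5] at h4
  have h6 := congrArg (fun A => A w) h4
  simp only [ContinuousLinearMap.mfderiv_eq] at h6
  exact h6

theorem mem_verticalSpace_iff {u₀ u : VelocitySpace D Q}
    (hu : u.1 ∈ (chartAt (Coord D) u₀.1).source) (w : TL u) :
    w ∈ verticalSpace u ↔ (coordL u₀ u w).1 = 0 := by
  rw [coordL_fst hu]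
  have hq : u.1 ∈ (extChartAt (𝓡 D) u₀.1).source := by rwa [extChartAt_source]
  exact (map_eq_zero_iff _ (mfderiv_extChartAt_injective (𝓡 D) hq)).symm

theorem coordC_push_fst (hL : ContMDiff (modelL D) 𝓘(ℝ, ℝ) ∞ L) {u₀ u : VelocitySpace D Q}
    (hu : u.1 ∈ (chartAt (Coord D) u₀.1).source) (w : TL u) :
    (coordC (fibreDerivative L u₀) (fibreDerivative L u) (push L u w)).1 = (coordL u₀ u w).1 := by
  rw [coordC_push hL hu, fderiv_localFibreDerivative_apply hL
    ((extChartAt (modelL D) u₀).map_source (mem_extChartAt_source_L.2 hu))]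

end SingularLagrangian

namespace SingularLagrangian

/-! ### Independent covectors -/

section Covectors

variable {V V' : Type*} [NormedAddCommGroup V] [NormedSpace ℝ V] [FiniteDimensional ℝ V]
  [NormedAddCommGroup V'] [NormedSpace ℝ V'] [FiniteDimensional ℝ V'] {N : ℕ}

/-- The common kernel of finitely many covectors. -/
def commonKer (f : Fin N → V' →L[ℝ] ℝ) : Submodule ℝ V' where
  carrier := {w | ∀ n, f n w = 0}
  add_mem' ha hb n := by rw [map_add, ha n, hb n, add_zero]
  zero_mem' n := map_zero _
  smul_mem' c w hw n := by rw [map_smul, hw n, smul_zero]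

theorem mem_commonKer {f : Fin N → V' →L[ℝ] ℝ} {w : V'} : w ∈ commonKer f ↔ ∀ n, f n w = 0 :=
  Iff.rfl

theorem linearIndependent_coe {f : Fin N → V' →L[ℝ] ℝ} (hf : LinearIndependent ℝ f) :
    LinearIndependent ℝ (fun n => (f n : V' →ₗ[ℝ] ℝ)) :=
  hf.map' (ContinuousLinearMap.coeLM ℝ) (LinearMap.ker_eq_bot.2 ContinuousLinearMap.coe_injective)

theorem finrank_commonKer {f : Fin N → V' →L[ℝ] ℝ} (hf : LinearIndependent ℝ f) :
    N + Module.finrank ℝ (commonKer f) = Module.finrank ℝ V' := by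
  have h1 := finrank_span_eq_card (linearIndependent_coe hf)
  have h2 := Subspace.finrank_add_finrank_dualCoannihilator_eq
    (Submodule.span ℝ (range fun n => (f n : Module.Dual ℝ V')))
  have h3 : (Submodule.span ℝ (range fun n => (f n : Module.Dual ℝ V'))).dualCoannihilator =
      commonKer f := by
    ext w
    rw [Submodule.mem_dualCoannihilator, mem_commonKer]
    constructor
    · exact fun h n => h _ (Submodule.subset_span ⟨n, rfl⟩)
    · intro h φ hφ
      induction hφ using Submodule.span_induction with
      | mem x hx => obtain ⟨n, rfl⟩ := hx; exact h n
      | zero => rfl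
      | add x y _ _ hx hy => rw [LinearMap.add_apply, hx, hy, add_zero]
      | smul c x _ hx => rw [LinearMap.smul_apply, hx, smul_zero]
  rw [h3] at h2
  rw [← h2]
  congr 1
  exact (h1.trans (Fintype.card_fin N)).symm

theorem exists_eq_sum_of_commonKer_le {f : Fin N → V' →L[ℝ] ℝ} {α : V' →L[ℝ] ℝ}
    (hα : ∀ w, (∀ n, f n w = 0) → α w = 0) :
    ∃ c : Fin N → ℝ, ∀ w, α w = ∑ n, c n * f n w := by
  have h1 : (α : V' →ₗ[ℝ] ℝ) ∈ Submodule.span ℝ (range fun n => (f n : V' →ₗ[ℝ] ℝ)) := by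
    refine mem_span_of_iInf_ker_le_ker fun w hw => hα w fun n => ?_
    exact (Submodule.mem_iInf _).1 hw n
  obtain ⟨c, hc⟩ := (Submodule.mem_span_range_iff_exists_fun ℝ).1 h1
  refine ⟨c, fun w => ?_⟩
  have := LinearMap.congr_fun hc w
  simpa using this.symm

theorem range_le_commonKer {f : Fin N → V' →L[ℝ] ℝ} {A : V →L[ℝ] V'}
    (hA : ∀ n v, f n (A v) = 0) : LinearMap.range (A : V →ₗ[ℝ] V') ≤ commonKer f := by
  rintro _ ⟨v, rfl⟩ n
  exact hA n v

/-- A map into the common kernel of `N` independent covectors is onto it if its kernel has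
dimension `N`. -/
theorem exists_apply_eq_of_finrank_ker {f : Fin N → V' →L[ℝ] ℝ} (hf : LinearIndependent ℝ f)
    {A : V →L[ℝ] V'} (hA : ∀ n v, f n (A v) = 0)
    (hV : Module.finrank ℝ V = Module.finrank ℝ V')
    (hN : Module.finrank ℝ (LinearMap.ker (A : V →ₗ[ℝ] V')) = N) {w : V'}
    (hw : ∀ n, f n w = 0) : ∃ v, A v = w := by
  have h1 := (A : V →ₗ[ℝ] V').finrank_range_add_finrank_ker
  have h2 := finrank_commonKer hf
  have h3 := Submodule.eq_of_le_of_finrank_eq (range_le_commonKer hA) (by omega)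
  have hw' : w ∈ commonKer f := hw
  rw [← h3] at hw'
  exact hw'

theorem eq_finrank_ker_of_forall_exists {f : Fin N → V' →L[ℝ] ℝ} (hf : LinearIndependent ℝ f)
    {A : V →L[ℝ] V'} (hA : ∀ n v, f n (A v) = 0)
    (hV : Module.finrank ℝ V = Module.finrank ℝ V')
    (hsurj : ∀ w, (∀ n, f n w = 0) → ∃ v, A v = w) :
    Module.finrank ℝ (LinearMap.ker (A : V →ₗ[ℝ] V')) = N := by
  have h1 := (A : V →ₗ[ℝ] V').finrank_range_add_finrank_ker
  have h2 := finrank_commonKer hf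
  have h3 : LinearMap.range (A : V →ₗ[ℝ] V') = commonKer f :=
    le_antisymm (range_le_commonKer hA) fun w hw => hsurj w hw
  rw [h3] at h1
  omega

end Covectors

theorem finrank_prod_dual (E : Type*) [NormedAddCommGroup E] [NormedSpace ℝ E]
    [FiniteDimensional ℝ E] :
    Module.finrank ℝ (E × E) = Module.finrank ℝ (E × (E →L[ℝ] ℝ)) := by
  have h : Module.finrank ℝ (E →L[ℝ] ℝ) = Module.finrank ℝ E := by
    rw [← (LinearMap.toContinuousLinearMap : (E →ₗ[ℝ] ℝ) ≃ₗ[ℝ] (E →L[ℝ] ℝ)).finrank_eq]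
    exact Subspace.dual_finrank_eq
  rw [Module.finrank_prod, Module.finrank_prod, h]

variable {D : ℕ} {Q : Type*} [TopologicalSpace Q] [ChartedSpace (Coord D) Q]
  [IsManifold (𝓡 D) ∞ Q] {L : VelocitySpace D Q → ℝ}

/-! ### The canonical form in an arbitrary bundle chart -/

theorem coframe_eq_mfderiv {q₀ q : Q} (hq : q ∈ (chartAt (Coord D) q₀).source) :
    coframe q₀ q = mfderiv (𝓡 D) 𝓘(ℝ, Coord D) (extChartAt (𝓡 D) q₀) q :=
  TangentBundle.continuousLinearMapAt_trivializationAt hq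

/-- The canonical form is the standard symplectic form in every bundle chart. -/
theorem canonicalForm_eq_coordC {s₀ s : PhaseSpace D Q}
    (hs : s.1 ∈ (chartAt (Coord D) s₀.1).source) (X Y : TC s) :
    canonicalForm s X Y = stdForm (coordC s₀ s X) (coordC s₀ s Y) := by
  set φ := extChartAt (𝓡 D) s.1 with hφ
  set φ₀ := extChartAt (𝓡 D) s₀.1 with hφ₀
  set Φ := extChartAt (modelC D) s with hΦ
  have hsΦ : s ∈ Φ.source := mem_extChartAt_source s
  have hsrc : s.1 ∈ φ₀.source := by rwa [hφ₀, extChartAt_source]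
  -- The canonical form is defined in the chart at s itself. The passage to the bundle chart at s₀
  -- is the cotangent lift of this transition map, with `R` the inverse of its derivative written
  -- through the frames.
  let τ : Coord D → Coord D := φ₀ ∘ φ.symm
  let R : Coord D → Coord D →L[ℝ] Coord D := fun x =>
    (coframe s.1 (φ.symm x)).comp (frame s₀.1 (φ.symm x))
  have hpt : Φ s = (φ s.1, (Φ s).2) := by rw [hΦ, extChartAt_C_apply]
  have hO := isOpen_chart_symm_preimage (I := 𝓡 D) (isOpen_extChartAt_source (I := 𝓡 D) s₀.1) s.1
  have hx : φ s.1 ∈ φ.target ∩ φ.symm ⁻¹' φ₀.source :=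
    ⟨φ.map_source (mem_extChartAt_source s.1), by
      rw [mem_preimage, φ.left_inv (mem_extChartAt_source s.1)]; exact hsrc⟩
  have hτ : ContDiffAt ℝ ∞ τ (φ s.1) := by
    have h1 : ContMDiffOn (𝓡 D) 𝓘(ℝ, Coord D) ∞ φ₀ φ₀.source := by
      rw [hφ₀, extChartAt_source]; exact contMDiffOn_extChartAt
    exact (contDiffOn_comp_chart_symm h1 s.1).contDiffAt (hO.mem_nhds hx)
  have hRτ : ∀ᶠ x in 𝓝 (φ s.1),
      (R x).comp (fderiv ℝ τ x) = ContinuousLinearMap.id ℝ (Coord D) := by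
    filter_upwards [hO.mem_nhds hx] with x hx
    set q := φ.symm x with hq
    have hqφ : q ∈ φ.source := φ.map_target hx.1
    have hq1 : q ∈ (chartAt (Coord D) s.1).source := by rwa [hφ, extChartAt_source] at hqφ
    have hq0 : q ∈ (chartAt (Coord D) s₀.1).source := by
      have := hx.2
      rwa [mem_preimage, extChartAt_source] at this
    have hxq : φ q = x := φ.right_inv hx.1
    ext1 w
    have h1 := mfderiv_apply_eq_fderiv_chart (f := φ₀) hqφ
      (mdifferentiableAt_extChartAt_of_mem (𝓡 D) (hx.2 : q ∈ φ₀.source)) (frame s.1 q w)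
    have h2 : coframe s₀.1 q (frame s.1 q w) = fderiv ℝ τ x (coframe s.1 q (frame s.1 q w)) := by
      rw [coframe_eq_mfderiv hq0, coframe_eq_mfderiv hq1, ← hxq]
      exact h1
    rw [coframe_frame hq1] at h2
    simp only [ContinuousLinearMap.comp_apply, ← h2, R, ← hq]
    rw [frame_coframe hq0, coframe_frame hq1]
    rfl
  have hΨ : extChartAt (modelC D) s₀ ∘ Φ.symm =ᶠ[𝓝 (φ s.1, (Φ s).2)]
      fun y => (τ y.1, y.2.comp (R y.1)) := by
    have h1 : IsOpen ((extChartAt (modelC D) s₀).source) := isOpen_extChartAt_source s₀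
    have h2 := isOpen_chart_symm_preimage (I := modelC D) h1 s
    have h3 : Φ s ∈ Φ.target ∩ Φ.symm ⁻¹' (extChartAt (modelC D) s₀).source :=
      ⟨Φ.map_source hsΦ, by
        rw [mem_preimage, Φ.left_inv hsΦ]; exact mem_extChartAt_source_C.2 hs⟩
    rw [← hpt]
    filter_upwards [h2.mem_nhds h3] with y hy
    set s' := Φ.symm y with hs'
    have hs1 : s'.1 ∈ (chartAt (Coord D) s.1).source :=
      mem_extChartAt_source_C.1 (Φ.map_target hy.1)
    have h4 : y = (φ s'.1, s'.2.comp (frame s.1 s'.1)) := by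
      rw [← extChartAt_C_apply, ← hΦ, hs', Φ.right_inv hy.1]
    have h5 : φ.symm y.1 = s'.1 := by
      rw [h4]
      exact φ.left_inv (by rwa [hφ, extChartAt_source])
    simp only [Function.comp_apply, ← hs', extChartAt_C_apply, τ, R, h5]
    refine Prod.ext rfl (ContinuousLinearMap.ext fun w => ?_)
    rw [h4]
    exact congrArg (fun v : Coord D => (s'.2 : Coord D →L[ℝ] ℝ) v)
      (frame_coframe hs1 (frame s₀.1 s'.1 w)).symm
  have hcoord : ∀ Z : TC s, coordC s₀ s Z =
      fderiv ℝ (extChartAt (modelC D) s₀ ∘ Φ.symm) (φ s.1, (Φ s).2) Z := by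
    intro Z
    have h1 := mfderiv_apply_eq_fderiv_chart (f := extChartAt (modelC D) s₀) hsΦ
      (mdifferentiableAt_extChartAt_of_mem (modelC D) (mem_extChartAt_source_C.2 hs)) Z
    rw [← hpt]
    refine h1.trans ?_
    exact congrArg _ (coordC_self s Z)
  rw [hcoord, hcoord]
  exact (stdForm_cotangentLift hτ hRτ hΨ X Y).symm

end SingularLagrangian

namespace SingularLagrangian

variable {D : ℕ} {Q : Type*} [TopologicalSpace Q] [ChartedSpace (Coord D) Q]
  [IsManifold (𝓡 D) ∞ Q] {L : VelocitySpace D Q → ℝ}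

theorem coordC_zero (s₀ s : PhaseSpace D Q) : coordC s₀ s 0 = 0 :=
  ContinuousLinearMap.map_zero _

/-! ### Functions on the phase spaces -/

theorem SmoothFunOn.mdifferentiableAt {h : PhaseSpace D Q → ℝ} {W : Set (PhaseSpace D Q)}
    (hh : SmoothFunOn h W) (hW : IsOpen W) {s : PhaseSpace D Q} (hs : s ∈ W) :
    MDifferentiableAt (modelC D) 𝓘(ℝ, ℝ) h s :=
  (ContMDiffOn.contMDiffAt hh (hW.mem_nhds hs)).mdifferentiableAt (by simp)

theorem dC_eq_fderiv {h : PhaseSpace D Q → ℝ} {s₀ s : PhaseSpace D Q}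
    (hs : s.1 ∈ (chartAt (Coord D) s₀.1).source) (hh : MDifferentiableAt (modelC D) 𝓘(ℝ, ℝ) h s)
    (w : TC s) : dC h s w = fderiv ℝ (h ∘ (extChartAt (modelC D) s₀).symm)
      (extChartAt (modelC D) s₀ s) (coordC s₀ s w) :=
  mfderiv_apply_eq_fderiv_chart (mem_extChartAt_source_C.2 hs) hh w

theorem isOpen_fibreDerivative_preimage (hL : ContMDiff (modelL D) 𝓘(ℝ, ℝ) ∞ L)
    {W : Set (PhaseSpace D Q)} (hW : IsOpen W) : IsOpen (fibreDerivative L ⁻¹' W) :=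
  hW.preimage (contMDiff_fibreDerivative hL).continuous

theorem dL_comp_fibreDerivative (hL : ContMDiff (modelL D) 𝓘(ℝ, ℝ) ∞ L)
    {h : PhaseSpace D Q → ℝ} {u : VelocitySpace D Q}
    (hh : MDifferentiableAt (modelC D) 𝓘(ℝ, ℝ) h (fibreDerivative L u)) (Y : TL u) :
    dL (h ∘ fibreDerivative L) u Y = dC h (fibreDerivative L u) (push L u Y) := by
  rw [dL, mfderiv_comp u hh ((contMDiff_fibreDerivative hL).mdifferentiableAt (by simp))]
  rfl

/-- The function γ_n ∘ 𝓛 vanishes identically on an open set. So tangency to the primary surface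
holds for the push of any vector, not only for SOELVFs. -/
theorem dC_push_eq_zero (hL : ContMDiff (modelL D) 𝓘(ℝ, ℝ) ∞ L) {W : Set (PhaseSpace D Q)}
    {c : ℕ} {γ : Fin c → PhaseSpace D Q → ℝ} (hγ : IsDefiningSystem (primarySurface L) W γ)
    {u : VelocitySpace D Q} (hu : fibreDerivative L u ∈ W) (n : Fin c) (Y : TL u) :
    dC (γ n) (fibreDerivative L u) (push L u Y) = 0 := by
  obtain ⟨hW, hsm, hzero, -⟩ := hγ
  rw [← dL_comp_fibreDerivative hL ((hsm n).mdifferentiableAt hW hu)]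
  have heq : γ n ∘ fibreDerivative L =ᶠ[𝓝 u] fun _ => 0 := by
    filter_upwards [(isOpen_fibreDerivative_preimage hL hW).mem_nhds hu] with u' hu'
    exact (hzero _ hu').1 ⟨u', rfl⟩ n
  rw [dL, heq.mfderiv_eq, mfderiv_const]
  rfl

theorem finrank_ker_push (hL : ContMDiff (modelL D) 𝓘(ℝ, ℝ) ∞ L) {N : ℕ}
    (hN : ∀ u, Module.finrank ℝ (kerHessian L u) = N) (u : VelocitySpace D Q) :
    Module.finrank ℝ (LinearMap.ker (push L u : TL u →ₗ[ℝ] TC (fibreDerivative L u))) = N := by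
  rw [ker_push hL, finrank_verticalKernel, hN]

/-- The image of the differential of the fibre derivative is the tangent space of the primary
constraint surface. -/
theorem exists_push_eq (hL : ContMDiff (modelL D) 𝓘(ℝ, ℝ) ∞ L) {N : ℕ}
    (hN : ∀ u, Module.finrank ℝ (kerHessian L u) = N) {W : Set (PhaseSpace D Q)}
    {γ : Fin N → PhaseSpace D Q → ℝ} (hγ : IsDefiningSystem (primarySurface L) W γ)
    {u : VelocitySpace D Q} (hu : fibreDerivative L u ∈ W) (w : TC (fibreDerivative L u))
    (hw : ∀ n, dC (γ n) (fibreDerivative L u) w = 0) : ∃ Y : TL u, push L u Y = w :=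
  exists_apply_eq_of_finrank_ker (V := Coord D × Coord D) (V' := Coord D × (Coord D →L[ℝ] ℝ))
    (f := fun n => dC (γ n) (fibreDerivative L u)) (A := push L u) (hγ.2.2.2 _ hu ⟨u, rfl⟩)
    (dC_push_eq_zero hL hγ hu) (finrank_prod_dual (Coord D)) (finrank_ker_push hL hN u) hw

/-- The number of constraints in the definition of almost regularity is forced: the image of d𝓛 is
the common kernel of c independent covectors, while ker d𝓛 has dimension N. As TQ and T*Q have equal
dimension, c = N. -/
theorem exists_definingSystem (hL : IsAlmostRegular L) {N : ℕ}
    (hN : ∀ u, Module.finrank ℝ (kerHessian L u) = N) {s : PhaseSpace D Q}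
    (hs : s ∈ primarySurface L) : ∃ (W : Set (PhaseSpace D Q)) (γ : Fin N → PhaseSpace D Q → ℝ),
      s ∈ W ∧ IsDefiningSystem (primarySurface L) W γ := by
  obtain ⟨W, c, γ, hsW, hγ, hsub⟩ := hL.submersion s hs
  obtain ⟨u, rfl⟩ := hs
  have h1 := eq_finrank_ker_of_forall_exists (V := Coord D × Coord D)
    (V' := Coord D × (Coord D →L[ℝ] ℝ))
    (f := fun n => dC (γ n) (fibreDerivative L u)) (A := push L u) (hγ.2.2.2 _ hsW ⟨u, rfl⟩)
    (dC_push_eq_zero hL.smooth hγ hsW) (finrank_prod_dual (Coord D)) (hsub u hsW)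
  have h2 := finrank_ker_push hL.smooth hN u
  obtain rfl : c = N := h1.symm.trans h2
  exact ⟨W, γ, hsW, hγ⟩

theorem IsDefiningSystem.mono {S W W' : Set (PhaseSpace D Q)} {c : ℕ}
    {γ : Fin c → PhaseSpace D Q → ℝ} (hγ : IsDefiningSystem S W γ) (hW' : IsOpen W')
    (hsub : W' ⊆ W) : IsDefiningSystem S W' γ :=
  ⟨hW', fun n => ContMDiffOn.mono (hγ.2.1 n) hsub, fun s hs => hγ.2.2.1 s (hsub hs),
    fun s hs => hγ.2.2.2 s (hsub hs)⟩

/-! ### Descent of functions along the fibre derivative -/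

theorem finrank_ker_localFibreDerivative (hL : ContMDiff (modelL D) 𝓘(ℝ, ℝ) ∞ L) {N : ℕ}
    (hN : ∀ u, Module.finrank ℝ (kerHessian L u) = N) {u₀ : VelocitySpace D Q}
    {u : VelocitySpace D Q} (hu : u.1 ∈ (chartAt (Coord D) u₀.1).source) :
    Module.finrank ℝ (LinearMap.ker (fderiv ℝ (localFibreDerivative L u₀)
      (extChartAt (modelL D) u₀ u) : Coord D × Coord D →ₗ[ℝ] Coord D × (Coord D →L[ℝ] ℝ))) = N := by
  rw [← finrank_ker_push hL hN u]
  have hmap : (LinearMap.ker (push L u : TL u →ₗ[ℝ] TC (fibreDerivative L u))).map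
      (coordL u₀ u : TL u →ₗ[ℝ] Coord D × Coord D) =
      LinearMap.ker (fderiv ℝ (localFibreDerivative L u₀) (extChartAt (modelL D) u₀ u) :
        Coord D × Coord D →ₗ[ℝ] Coord D × (Coord D →L[ℝ] ℝ)) := by
    ext c
    constructor
    · rintro ⟨w, hw, rfl⟩
      have hw' : push L u w = 0 := hw
      have h1 := coordC_push hL hu w
      rw [hw'] at h1
      exact h1.symm.trans (coordC_zero _ _)
    · intro hc
      obtain ⟨w, rfl⟩ := coordL_surjective hu c
      have h1 := coordC_push hL hu w
      have hc' : fderiv ℝ (localFibreDerivative L u₀) (extChartAt (modelL D) u₀ u)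
        (coordL u₀ u w) = 0 := hc
      rw [hc'] at h1
      exact ⟨w, coordC_injective (s₀ := fibreDerivative L u₀) (s := fibreDerivative L u) hu
        (h1.trans (coordC_zero _ _).symm), rfl⟩
  rw [← hmap]
  exact (Submodule.equivMapOfInjective _ (coordL_injective hu) _).finrank_eq.symm

theorem fderiv_localFibreDerivative_eq_zero (hL : ContMDiff (modelL D) 𝓘(ℝ, ℝ) ∞ L)
    {u₀ u : VelocitySpace D Q} (hu : u.1 ∈ (chartAt (Coord D) u₀.1).source) {w : TL u}
    (hw : fderiv ℝ (localFibreDerivative L u₀) (extChartAt (modelL D) u₀ u) (coordL u₀ u w) = 0) :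
    push L u w = 0 := by
  exact coordC_injective (s₀ := fibreDerivative L u₀) (s := fibreDerivative L u) hu
    (((coordC_push hL hu w).trans hw).trans (coordC_zero _ _).symm)

variable {F : Type*} [NormedAddCommGroup F] [NormedSpace ℝ F]

theorem eventually_eq_of_mfderiv_ker (hL : ContMDiff (modelL D) 𝓘(ℝ, ℝ) ∞ L) {N : ℕ}
    (hN : ∀ u, Module.finrank ℝ (kerHessian L u) = N) {O : Set (VelocitySpace D Q)} (hO : IsOpen O)
    {h : VelocitySpace D Q → F} (hh : ContMDiffOn (modelL D) 𝓘(ℝ, F) ∞ h O)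
    (hker : ∀ u ∈ O, ∀ w : TL u, push L u w = 0 → mfderiv (modelL D) 𝓘(ℝ, F) h u w = 0)
    {u₀ : VelocitySpace D Q} (hu₀ : u₀ ∈ O) :
    ∀ᶠ u in 𝓝 u₀, fibreDerivative L u = fibreDerivative L u₀ → h u = h u₀ := by
  set Φ := extChartAt (modelL D) u₀ with hΦ
  have hO' := isOpen_chart_symm_preimage (I := modelL D) hO u₀
  have hy₀ : Φ u₀ ∈ Φ.target ∩ Φ.symm ⁻¹' O :=
    ⟨mem_extChartAt_target u₀, by
      rw [mem_preimage, Φ.left_inv (mem_extChartAt_source u₀)]; exact hu₀⟩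
  have hsrc : ∀ y ∈ Φ.target ∩ Φ.symm ⁻¹' O,
      (Φ.symm y).1 ∈ (chartAt (Coord D) u₀.1).source ∧ Φ (Φ.symm y) = y := fun y hy =>
    ⟨mem_extChartAt_source_L.1 (Φ.map_target hy.1), Φ.right_inv hy.1⟩
  have hF := (contDiffOn_localFibreDerivative hL u₀).mono
    (inter_subset_left : Φ.target ∩ Φ.symm ⁻¹' O ⊆ Φ.target)
  have hh' := contDiffOn_comp_chart_symm hh u₀
  have hrank : ∀ y ∈ Φ.target ∩ Φ.symm ⁻¹' O,
      Module.finrank ℝ (LinearMap.ker (fderiv ℝ (localFibreDerivative L u₀) y :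
        Coord D × Coord D →ₗ[ℝ] Coord D × (Coord D →L[ℝ] ℝ))) = N := by
    intro y hy
    have := finrank_ker_localFibreDerivative hL hN (hsrc y hy).1
    rwa [← hΦ, (hsrc y hy).2] at this
  have hkey := eventually_eq_of_ker_le (h := h ∘ Φ.symm) hO' hF (hh'.differentiableOn (by simp)) hy₀
    (fun y hy => (hrank y hy).trans (hrank _ hy₀).symm) (by
      intro y hy c hc
      obtain ⟨h1, h2⟩ := hsrc y hy
      obtain ⟨w, rfl⟩ := coordL_surjective h1 c
      have h3 := mfderiv_apply_eq_fderiv_chart (mem_extChartAt_source_L.2 h1)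
        ((hh.contMDiffAt (hO.mem_nhds hy.2)).mdifferentiableAt (by simp)) w
      rw [← hΦ, h2] at h3
      refine h3.symm.trans (hker _ hy.2 w (fderiv_localFibreDerivative_eq_zero hL h1 ?_))
      rw [← hΦ, h2]
      exact hc)
  have hcont : Filter.Tendsto Φ (𝓝 u₀) (𝓝 (Φ u₀)) := continuousAt_extChartAt u₀
  filter_upwards [hcont.eventually hkey, extChartAt_source_mem_nhds (I := modelL D) u₀]
    with u hu husrc heq
  have h4 : localFibreDerivative L u₀ (Φ u) = localFibreDerivative L u₀ (Φ u₀) := by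
    rw [← extChartAt_fibreDerivative hL (mem_extChartAt_source_L.1 husrc),
      ← extChartAt_fibreDerivative hL (base_mem_source u₀.1), heq]
  have h5 := hu h4
  simp only [Function.comp_apply] at h5
  rwa [Φ.left_inv husrc, Φ.left_inv (mem_extChartAt_source u₀)] at h5

/-- A function whose differential kills the kernel of the differential of the fibre derivative is
constant on the preimages of points. -/
theorem eq_of_fibreDerivative_eq (hL : IsAlmostRegular L) {N : ℕ}
    (hN : ∀ u, Module.finrank ℝ (kerHessian L u) = N) {W : Set (PhaseSpace D Q)} (hW : IsOpen W)
    {h : VelocitySpace D Q → F} (hh : ContMDiffOn (modelL D) 𝓘(ℝ, F) ∞ h (fibreDerivative L ⁻¹' W))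
    (hker : ∀ u, fibreDerivative L u ∈ W → ∀ w : TL u, push L u w = 0 →
      mfderiv (modelL D) 𝓘(ℝ, F) h u w = 0) {u u' : VelocitySpace D Q}
    (hu : fibreDerivative L u ∈ W) (heq : fibreDerivative L u' = fibreDerivative L u) :
    h u' = h u := by
  have hconn := (hL.connected_fibres _ ⟨u, rfl⟩).isPreconnected
  have : PreconnectedSpace (fibreDerivative L ⁻¹' {fibreDerivative L u}) :=
    isPreconnected_iff_preconnectedSpace.1 hconn
  -- The rank theorem gives constancy only near each point of the fibre; connectedness of the fibre
  -- makes it global.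
  have hloc : IsLocallyConstant
      (fun x : fibreDerivative L ⁻¹' {fibreDerivative L u} => h x.1) := by
    rw [IsLocallyConstant.iff_eventually_eq]
    rintro ⟨x, hx⟩
    have hx' : fibreDerivative L x = fibreDerivative L u := hx
    have h1 := eventually_eq_of_mfderiv_ker hL.smooth hN
      (isOpen_fibreDerivative_preimage hL.smooth hW) hh hker
      (show x ∈ fibreDerivative L ⁻¹' W by rwa [mem_preimage, hx'])
    have h2 : Filter.Tendsto (Subtype.val : fibreDerivative L ⁻¹' {fibreDerivative L u} → _)
      (𝓝 ⟨x, hx⟩) (𝓝 x) := continuous_subtype_val.continuousAt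
    filter_upwards [h2.eventually h1] with y hy
    exact hy ((show fibreDerivative L y.1 = fibreDerivative L u from y.2).trans hx'.symm)
  exact hloc.apply_eq_of_preconnectedSpace ⟨u', heq⟩ ⟨u, rfl⟩

/-- A smooth function on the velocity phase space whose differential kills the kernel of the
differential of the fibre derivative comes locally from a smooth function on the phase space. -/
theorem exists_descent (hL : IsAlmostRegular L) {N : ℕ}
    (hN : ∀ u, Module.finrank ℝ (kerHessian L u) = N) {W : Set (PhaseSpace D Q)} (hW : IsOpen W)
    {h : VelocitySpace D Q → F} (hh : ContMDiffOn (modelL D) 𝓘(ℝ, F) ∞ h (fibreDerivative L ⁻¹' W))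
    (hker : ∀ u, fibreDerivative L u ∈ W → ∀ w : TL u, push L u w = 0 →
      mfderiv (modelL D) 𝓘(ℝ, F) h u w = 0) {s₀ : PhaseSpace D Q} (hs₀ : s₀ ∈ primarySurface L)
    (hs₀W : s₀ ∈ W) : ∃ (W' : Set (PhaseSpace D Q)) (k : PhaseSpace D Q → F), IsOpen W' ∧
      s₀ ∈ W' ∧ W' ⊆ W ∧ ContMDiffOn (modelC D) 𝓘(ℝ, F) ∞ k W' ∧
        ∀ u, fibreDerivative L u ∈ W' → k (fibreDerivative L u) = h u := by
  obtain ⟨W₁, γ, hs₁, hγ⟩ := exists_definingSystem hL hN hs₀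
  obtain ⟨u₀, rfl⟩ := hs₀
  set Φ := extChartAt (modelL D) u₀ with hΦ
  set Ψ := extChartAt (modelC D) (fibreDerivative L u₀) with hΨ
  have hFΨ : ∀ u ∈ Φ.source, Ψ (fibreDerivative L u) = localFibreDerivative L u₀ (Φ u) :=
    fun u hu => extChartAt_fibreDerivative hL.smooth (mem_extChartAt_source_L.1 hu)
  have hFsrc : ∀ u ∈ Φ.source, fibreDerivative L u ∈ Ψ.source := fun u hu =>
    mem_extChartAt_source_C.2 (mem_extChartAt_source_L.1 hu)
  have hO := isOpen_chart_symm_preimage (I := modelL D)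
    (isOpen_fibreDerivative_preimage hL.smooth (hW.inter hγ.1)) u₀
  have hy₀ : Φ u₀ ∈ Φ.target ∩ Φ.symm ⁻¹' (fibreDerivative L ⁻¹' (W ∩ W₁)) :=
    ⟨mem_extChartAt_target u₀, by
      rw [mem_preimage, Φ.left_inv (mem_extChartAt_source u₀)]; exact ⟨hs₀W, hs₁⟩⟩
  have hFy₀ : localFibreDerivative L u₀ (Φ u₀) = Ψ (fibreDerivative L u₀) :=
    (hFΨ u₀ (mem_extChartAt_source u₀)).symm
  let g : Coord D × (Coord D →L[ℝ] ℝ) → Fin N → ℝ := fun y n => γ n (Ψ.symm y)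
  have hgO := isOpen_chart_symm_preimage (I := modelC D) hγ.1 (fibreDerivative L u₀)
  have hgn : ∀ n, ContDiffOn ℝ ∞ (γ n ∘ Ψ.symm) (Ψ.target ∩ Ψ.symm ⁻¹' W₁) := fun n =>
    contDiffOn_comp_chart_symm (hγ.2.1 n) (fibreDerivative L u₀)
  have hg : ContDiffOn ℝ ∞ g (Ψ.target ∩ Ψ.symm ⁻¹' W₁) := contDiffOn_pi.2 hgn
  have hgy₀ : localFibreDerivative L u₀ (Φ u₀) ∈ Ψ.target ∩ Ψ.symm ⁻¹' W₁ := by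
    rw [hFy₀]
    exact ⟨mem_extChartAt_target _, by
      rw [mem_preimage, Ψ.left_inv (mem_extChartAt_source _)]; exact hs₁⟩
  obtain ⟨σ, U, hU, hy₀U, -, hσ, hσ₀, hσmaps, hσsec⟩ := exists_smooth_section hO
    ((contDiffOn_localFibreDerivative hL.smooth u₀).mono inter_subset_left) hy₀ hgO hg hgy₀ (by
      intro y hy hFy
      have h1 : Φ.symm y ∈ Φ.source := Φ.map_target hy.1
      have h2 := hFΨ _ h1
      rw [Φ.right_inv hy.1] at h2
      funext n
      change γ n (Ψ.symm (localFibreDerivative L u₀ y)) = 0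
      rw [← h2, Ψ.left_inv (hFsrc _ h1)]
      exact (hγ.2.2.1 _ hy.2.2).1 ⟨_, rfl⟩ n) (by
      intro w hw
      have hwn : ∀ n, fderiv ℝ (γ n ∘ Ψ.symm) (Ψ (fibreDerivative L u₀)) w = 0 := by
        intro n
        have h1 : fderiv ℝ g (localFibreDerivative L u₀ (Φ u₀)) w n =
            fderiv ℝ (γ n ∘ Ψ.symm) (localFibreDerivative L u₀ (Φ u₀)) w := by
          have h2 := fderiv_pi (φ := fun n y => (γ n ∘ Ψ.symm) y) fun n =>
            ((hgn n).contDiffAt (hgO.mem_nhds hgy₀)).differentiableAt (by simp)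
          exact congrFun (congrArg (fun A => A w) h2) n
        rw [← hFy₀, ← h1, hw]
        rfl
      have hbase := base_mem_source (D := D) (fibreDerivative L u₀).1
      obtain ⟨w', rfl⟩ := coordC_surjective hbase w
      obtain ⟨Y, rfl⟩ := exists_push_eq hL.smooth hN hγ hs₁ w' fun n => by
        rw [dC_eq_fderiv hbase ((hγ.2.1 n).mdifferentiableAt hγ.1 hs₁)]
        exact hwn n
      exact ⟨coordL u₀ u₀ Y, (coordC_push hL.smooth (base_mem_source u₀.1) Y).symm⟩)
  -- The descended function is h evaluated along the local section σ. The section is smooth on an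
  -- open set of T*Q, so this also supplies values off the primary surface.
  refine ⟨(W ∩ W₁) ∩ (Ψ.source ∩ Ψ ⁻¹' U), fun s => h (Φ.symm (σ (Ψ s))),
    (hW.inter hγ.1).inter (isOpen_chart_preimage hU _), ⟨⟨hs₀W, hs₁⟩, mem_extChartAt_source _, ?_⟩,
    fun s hs => hs.1.1, ?_, ?_⟩
  · rw [mem_preimage, ← hFy₀]
    exact hy₀U
  · have h1 : ContMDiffOn (modelC D) 𝓘(ℝ, F) ∞ ((h ∘ Φ.symm) ∘ σ ∘ Ψ) (Ψ.source ∩ Ψ ⁻¹' U) := by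
      refine contMDiffOn_comp_chart (g := (h ∘ Φ.symm) ∘ σ) ?_ _
      exact (contDiffOn_comp_chart_symm hh u₀).comp hσ fun y hy =>
        ⟨(hσmaps hy).1, (hσmaps hy).2.1⟩
    exact h1.mono inter_subset_right
  · rintro u ⟨⟨huW, huW₁⟩, huΨ, huU⟩
    have h1 : g (Ψ (fibreDerivative L u)) = 0 := by
      funext n
      change γ n (Ψ.symm (Ψ (fibreDerivative L u))) = 0
      rw [Ψ.left_inv huΨ]
      exact (hγ.2.2.1 _ huW₁).1 ⟨_, rfl⟩ n
    have h2 := hσsec _ huU h1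
    have hmem := hσmaps huU
    have h3 : Φ.symm (σ (Ψ (fibreDerivative L u))) ∈ Φ.source := Φ.map_target hmem.1
    have h4 := hFΨ _ h3
    rw [Φ.right_inv hmem.1, h2] at h4
    -- The point chosen by the section and u lie in one fibre of 𝓛 but need not be close to each
    -- other; hence the appeal to constancy along whole fibres.
    exact eq_of_fibreDerivative_eq hL hN hW hh hker huW (Ψ.injOn (hFsrc _ h3) huΨ h4)

end SingularLagrangian

namespace SingularLagrangian

/-! ### Vector fields in charts -/

section ChartFields

variable {E H M : Type*} [NormedAddCommGroup E] [NormedSpace ℝ E] [TopologicalSpace H]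
  {I : ModelWithCorners ℝ E H} [I.Boundaryless] [TopologicalSpace M] [ChartedSpace H M]
  [IsManifold I ∞ M]

/-- The coordinates of a vector field in the chart at `x₀`, as a function on the manifold. -/
noncomputable def chartField (X : (x : M) → TangentSpace I x) (x₀ x : M) : E :=
  mfderiv I 𝓘(ℝ, E) (extChartAt I x₀) x (X x)

theorem contMDiffOn_field_iff {X : (x : M) → TangentSpace I x} {x₀ : M} {O : Set M} (hO : IsOpen O)
    (hsub : O ⊆ (extChartAt I x₀).source) :
    ContMDiffOn I I.tangent ∞ (fun x => (⟨x, X x⟩ : TangentBundle I M)) O ↔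
      ContMDiffOn I 𝓘(ℝ, E) ∞ (chartField X x₀) O := by
  rw [extChartAt_source] at hsub
  have h := (trivializationAt E (TangentSpace I) x₀).contMDiffOn_section_iff (IB := I) (n := ∞)
    (s := X) (a := O) hO (by rwa [TangentBundle.trivializationAt_baseSet])
  refine h.trans (contMDiffOn_congr fun x hx => ?_)
  have h1 := congrArg (fun A => A (X x))
    (TangentBundle.continuousLinearMapAt_trivializationAt (I := I) (hsub hx))
  have h2 := Trivialization.continuousLinearMapAt_apply ℝ
    (trivializationAt E (TangentSpace I) x₀) x
  rw [Trivialization.coe_linearMapAt_of_mem (trivializationAt E (TangentSpace I) x₀)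
    (by rw [TangentBundle.trivializationAt_baseSet]; exact hsub hx)] at h2
  exact (congrFun h2 (X x)).symm.trans h1

theorem mfderiv_extChartAt_mlieBracket {G X : (x : M) → TangentSpace I x} {x₀ : M} {y : E}
    (hy : y ∈ (extChartAt I x₀).target)
    (hG : MDifferentiableAt I I.tangent (fun x => (⟨x, G x⟩ : TangentBundle I M))
      ((extChartAt I x₀).symm y))
    (hX : MDifferentiableAt I I.tangent (fun x => (⟨x, X x⟩ : TangentBundle I M))
      ((extChartAt I x₀).symm y)) [CompleteSpace E] :
    mfderiv I 𝓘(ℝ, E) (extChartAt I x₀) ((extChartAt I x₀).symm y)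
        (VectorField.mlieBracket I G X ((extChartAt I x₀).symm y)) =
      VectorField.lieBracket ℝ (chartField G x₀ ∘ (extChartAt I x₀).symm)
        (chartField X x₀ ∘ (extChartAt I x₀).symm) y := by
  set Φ := extChartAt I x₀ with hΦ
  have hinv : ∀ y ∈ Φ.target,
      (mfderiv 𝓘(ℝ, E) I Φ.symm y).inverse = mfderiv I 𝓘(ℝ, E) Φ (Φ.symm y) := by
    intro y hy
    have h1 := mfderiv_extChartAt_comp_mfderivWithin_extChartAt_symm (I := I) hy
    have h2 := mfderivWithin_extChartAt_symm_comp_mfderiv_extChartAt (I := I) hy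
    rw [I.range_eq_univ, mfderivWithin_univ] at h1 h2
    exact ContinuousLinearMap.inverse_eq h2 h1
  have hsmooth : ContMDiffAt 𝓘(ℝ, E) I ∞ Φ.symm y :=
    (contMDiffOn_extChartAt_symm x₀).contMDiffAt ((isOpen_extChartAt_target x₀).mem_nhds hy)
  have : IsManifold I (minSmoothness ℝ 3) M := by
    rw [minSmoothness_of_isRCLikeNormedField]
    exact IsManifold.of_le (n := ∞) (WithTop.coe_le_coe.2 (le_top : (3 : ℕ∞) ≤ ⊤))
  have key := VectorField.mpullback_mlieBracket (I := 𝓘(ℝ, E)) (I' := I) (f := Φ.symm) (x₀ := y)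
    hG hX hsmooth (by
      rw [minSmoothness_of_isRCLikeNormedField]
      exact WithTop.coe_le_coe.2 (le_top : (2 : ℕ∞) ≤ ⊤))
  rw [VectorField.mpullback_apply, hinv y hy] at key
  refine key.trans ?_
  have hflat : ∀ Z Z' : (y : E) → TangentSpace 𝓘(ℝ, E) y, VectorField.mlieBracket 𝓘(ℝ, E) Z Z' =
      VectorField.lieBracket ℝ (Z : E → E) (Z' : E → E) := fun Z Z' =>
    (VectorField.mlieBracketWithin_univ (I := 𝓘(ℝ, E)) (V := Z) (W := Z')).symm.trans
      ((VectorField.mlieBracketWithin_eq_lieBracketWithin (V := Z) (W := Z')).trans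
        (VectorField.lieBracketWithin_univ (𝕜 := ℝ) (V := (Z : E → E)) (W := (Z' : E → E))))
  refine (congrFun (hflat _ _) y).trans ?_
  have hev : ∀ Z : (x : M) → TangentSpace I x,
      VectorField.mpullback 𝓘(ℝ, E) I Φ.symm Z =ᶠ[𝓝 y] chartField Z x₀ ∘ Φ.symm := by
    intro Z
    filter_upwards [(isOpen_extChartAt_target x₀).mem_nhds hy] with y' hy'
    rw [VectorField.mpullback_apply, hinv y' hy']
    rfl
  exact (hev G).lieBracket_vectorField_eq (hev X)

end ChartFields

variable {D : ℕ} {Q : Type*} [TopologicalSpace Q] [ChartedSpace (Coord D) Q]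
  [IsManifold (𝓡 D) ∞ Q] {L : VelocitySpace D Q → ℝ}

theorem smoothFieldOn_iff {X : VectorFieldL D Q} {u₀ : VelocitySpace D Q}
    {O : Set (VelocitySpace D Q)} (hO : IsOpen O)
    (hsub : O ⊆ (extChartAt (modelL D) u₀).source) :
    SmoothFieldOn X O ↔ ContMDiffOn (modelL D) 𝓘(ℝ, Coord D × Coord D) ∞
      (fun u => coordL u₀ u (X u)) O :=
  contMDiffOn_field_iff hO hsub

theorem SmoothFieldOn.mdifferentiableAt {X : VectorFieldL D Q} {O : Set (VelocitySpace D Q)}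
    (hX : SmoothFieldOn X O) (hO : IsOpen O) {u : VelocitySpace D Q} (hu : u ∈ O) :
    MDifferentiableAt (modelL D) (modelL D).tangent
      (fun u => (⟨u, X u⟩ : TangentBundle (modelL D) (VelocitySpace D Q))) u :=
  (ContMDiffOn.contMDiffAt hX (hO.mem_nhds hu)).mdifferentiableAt (by simp)

/-- The horizontal coordinates of a vector field in the bundle chart at `u₀`. -/
noncomputable def horizontalPart (u₀ : VelocitySpace D Q) (X : VectorFieldL D Q)
    (u : VelocitySpace D Q) : Coord D :=
  (coordL u₀ u (X u)).1

theorem contMDiffOn_horizontalPart {X : VectorFieldL D Q} {O : Set (VelocitySpace D Q)}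
    (hX : SmoothFieldOn X O) (hO : IsOpen O) (u₀ : VelocitySpace D Q) :
    ContMDiffOn (modelL D) 𝓘(ℝ, Coord D) ∞ (horizontalPart u₀ X)
      (O ∩ (extChartAt (modelL D) u₀).source) := by
  have h := (smoothFieldOn_iff (hO.inter (isOpen_extChartAt_source u₀)) inter_subset_right).1
    (ContMDiffOn.mono hX inter_subset_left)
  exact contDiff_fst.contMDiff.comp_contMDiffOn h

theorem coordL_eq_zero_of_mem_verticalKernel (hL : ContMDiff (modelL D) 𝓘(ℝ, ℝ) ∞ L)
    {u₀ u : VelocitySpace D Q} (hu : u.1 ∈ (chartAt (Coord D) u₀.1).source) {w : TL u}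
    (hw : w ∈ verticalKernel L u) : (coordL u₀ u w).1 = 0 := by
  rw [← coordC_push_fst hL hu, (push_eq_zero_iff hL u w).2 hw]
  exact congrArg Prod.fst (coordC_zero (fibreDerivative L u₀) (fibreDerivative L u))

/-- The horizontal part of the bracket with a vertical field. -/
theorem coordL_mlieBracket_fst (hL : ContMDiff (modelL D) 𝓘(ℝ, ℝ) ∞ L) {X G : VectorFieldL D Q}
    {V : Set (VelocitySpace D Q)} (hV : IsOpen V) (hX : SmoothFieldOn X V) (hG : SmoothFieldOn G V)
    (hGker : ∀ u ∈ V, G u ∈ verticalKernel L u) {u₀ u : VelocitySpace D Q} (hu : u ∈ V)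
    (husrc : u.1 ∈ (chartAt (Coord D) u₀.1).source) :
    (coordL u₀ u (VectorField.mlieBracket (modelL D) G X u)).1 =
      mfderiv (modelL D) 𝓘(ℝ, Coord D) (horizontalPart u₀ X) u (G u) := by
  have hsrc := mem_extChartAt_source_L.2 husrc
  set Φ := extChartAt (modelL D) u₀ with hΦ
  obtain ⟨y, hy, rfl⟩ : ∃ y ∈ Φ.target, Φ.symm y = u :=
    ⟨Φ u, Φ.map_source hsrc, Φ.left_inv hsrc⟩
  have hO := isOpen_chart_symm_preimage (I := modelL D) hV u₀
  have hyO : y ∈ Φ.target ∩ Φ.symm ⁻¹' V := ⟨hy, hu⟩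
  have hsm : ∀ Z : VectorFieldL D Q, SmoothFieldOn Z V →
      DifferentiableAt ℝ (chartField Z u₀ ∘ Φ.symm) y := by
    intro Z hZ
    have h1 := (smoothFieldOn_iff (hV.inter (isOpen_extChartAt_source u₀)) inter_subset_right).1
      (ContMDiffOn.mono hZ (inter_subset_left (t := Φ.source)))
    refine ((contDiffOn_comp_chart_symm h1 u₀).contDiffAt (IsOpen.mem_nhds
      (isOpen_chart_symm_preimage (hV.inter (isOpen_extChartAt_source u₀)) u₀) ?_)).differentiableAt
        (by simp)
    exact ⟨hy, hu, hsrc⟩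
  have h1 := mfderiv_extChartAt_mlieBracket hy (hG.mdifferentiableAt hV hu)
    (hX.mdifferentiableAt hV hu)
  -- In the chart [G, X] = DX(G) - DG(X). The base components of G vanish identically, so only DX(G)
  -- contributes to the base components of the bracket.
  have h2 : fderiv ℝ (fun y => (chartField G u₀ (Φ.symm y)).1) y = 0 := by
    have : (fun y => (chartField G u₀ (Φ.symm y)).1) =ᶠ[𝓝 y] fun _ => 0 := by
      filter_upwards [hO.mem_nhds hyO] with y' hy'
      exact coordL_eq_zero_of_mem_verticalKernel hL
        (mem_extChartAt_source_L.1 (Φ.map_target hy'.1)) (hGker _ hy'.2)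
    rw [this.fderiv_eq]
    exact fderiv_const_apply 0
  have h3 : ∀ (Z : VectorFieldL D Q), SmoothFieldOn Z V → ∀ c,
      fderiv ℝ (fun y => (chartField Z u₀ (Φ.symm y)).1) y c =
        (fderiv ℝ (chartField Z u₀ ∘ Φ.symm) y c).1 := by
    intro Z hZ c
    have := ((ContinuousLinearMap.fst ℝ (Coord D) (Coord D)).hasFDerivAt.comp y
      (hsm Z hZ).hasFDerivAt).fderiv
    exact congrArg (fun A => A c) this
  refine (congrArg Prod.fst h1).trans ?_
  rw [VectorField.lieBracket]
  have h4 := mfderiv_apply_eq_fderiv_chart (f := horizontalPart u₀ X) hsrc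
    (((contMDiffOn_horizontalPart hX hV u₀).contMDiffAt
      ((hV.inter (isOpen_extChartAt_source u₀)).mem_nhds ⟨hu, hsrc⟩)).mdifferentiableAt (by simp))
    (G (Φ.symm y))
  rw [h4, ← hΦ, Φ.right_inv hy]
  rw [Prod.fst_sub, ← h3 G hG, h2, zero_apply, sub_zero, ← h3 X hX]
  rfl

/-- There are smooth local sections of `𝒢` through all of its elements. -/
theorem exists_section_verticalKernel (hL : ContMDiff (modelL D) 𝓘(ℝ, ℝ) ∞ L) {N : ℕ}
    (hN : ∀ u, Module.finrank ℝ (kerHessian L u) = N) {O : Set (VelocitySpace D Q)} (hO : IsOpen O)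
    {u : VelocitySpace D Q} (hu : u ∈ O) {w : TL u} (hw : push L u w = 0) :
    ∃ (V : Set (VelocitySpace D Q)) (G : VectorFieldL D Q), IsOpen V ∧ u ∈ V ∧ V ⊆ O ∧
      SmoothFieldOn G V ∧ (∀ u' ∈ V, G u' ∈ verticalKernel L u') ∧ G u = w := by
  set Φ := extChartAt (modelL D) u with hΦ
  -- The differential of 𝓛 in the chart has constant rank, so w can be transported to kernel vectors
  -- Z w at nearby points. The value of the field off the chart domain plays no role and is set to
  -- 0.
  obtain ⟨U, Z, hU, huU, hUt, hZ, hZ0, hZker⟩ := exists_kernel_transport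
    (isOpen_extChartAt_target (I := modelL D) u)
    ((contDiffOn_localFibreDerivative hL u).fderiv_of_isOpen (m := ∞) (isOpen_extChartAt_target u)
      (by simp)) (extChartAt_self_mem_target u)
  have hsymm : ∀ u' : VelocitySpace D Q, ∃ w' : TL u', u' ∈ Φ.source →
      coordL u u' w' = Z (Φ u') (w : Coord D × Coord D) := by
    intro u'
    by_cases h : u' ∈ Φ.source
    · obtain ⟨w', hw'⟩ := coordL_surjective (mem_extChartAt_source_L.1 h)
        (Z (Φ u') (w : Coord D × Coord D))
      exact ⟨w', fun _ => hw'⟩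
    · exact ⟨0, fun h' => absurd h' h⟩
  choose G hG using hsymm
  have hV : IsOpen (Φ.source ∩ Φ ⁻¹' U) := isOpen_chart_preimage hU u
  refine ⟨O ∩ (Φ.source ∩ Φ ⁻¹' U), G, hO.inter hV, ⟨hu, mem_extChartAt_source u, huU⟩,
    inter_subset_left, ?_, ?_, ?_⟩
  · rw [smoothFieldOn_iff (hO.inter hV) (fun u' hu' => hu'.2.1)]
    have h1 : ContMDiffOn (modelL D) 𝓘(ℝ, Coord D × Coord D) ∞
        ((fun y => Z y (w : Coord D × Coord D)) ∘ Φ) (Φ.source ∩ Φ ⁻¹' U) :=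
      contMDiffOn_comp_chart (hZ.clm_apply contDiffOn_const) u
    exact (h1.mono inter_subset_right).congr fun u' hu' => hG u' hu'.2.1
  · intro u' hu'
    rw [← push_eq_zero_iff hL]
    have hb := mem_extChartAt_source_L.1 hu'.2.1
    refine fderiv_localFibreDerivative_eq_zero hL hb ?_
    rw [hG u' hu'.2.1]
    refine (hZker _ hu'.2.2).2 ?_ _ ?_
    · exact (finrank_ker_localFibreDerivative hL hN hb).trans
        (finrank_ker_localFibreDerivative hL hN (base_mem_source u.1)).symm
    · exact (push_eq hL u w).symm.trans hw
  · have h1 := hG u (mem_extChartAt_source u)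
    rw [hZ0] at h1
    exact (coordL_self u (G u)).symm.trans h1

/-- The differential of the horizontal part of a field with vertical brackets kills `𝒢`. -/
theorem mfderiv_horizontalPart_eq_zero (hL : ContMDiff (modelL D) 𝓘(ℝ, ℝ) ∞ L) {N : ℕ}
    (hN : ∀ u, Module.finrank ℝ (kerHessian L u) = N) {O : Set (VelocitySpace D Q)} (hO : IsOpen O)
    {X : VectorFieldL D Q} (hX : SmoothFieldOn X O) (hbr : BracketsVertical L O X)
    {u₀ u : VelocitySpace D Q} (hu : u ∈ O) (husrc : u.1 ∈ (chartAt (Coord D) u₀.1).source)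
    {w : TL u} (hw : push L u w = 0) :
    mfderiv (modelL D) 𝓘(ℝ, Coord D) (horizontalPart u₀ X) u w = 0 := by
  obtain ⟨V, G, hV, huV, hVO, hG, hGker, rfl⟩ := exists_section_verticalKernel hL hN hO hu hw
  rw [← coordL_mlieBracket_fst hL hV (ContMDiffOn.mono hX hVO) hG hGker huV husrc]
  exact (mem_verticalSpace_iff husrc _).1 (hbr V G hV hVO hG hGker u huV)

/-- A field has vertical brackets with `𝒢` if its horizontal part is, in a chart, a function of the
image under the fibre derivative. -/
theorem bracketsVertical_of_horizontalPart (hL : ContMDiff (modelL D) 𝓘(ℝ, ℝ) ∞ L)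
    {O : Set (VelocitySpace D Q)} {X : VectorFieldL D Q} (hX : SmoothFieldOn X O)
    (hker : ∀ u ∈ O, ∃ u₀ : VelocitySpace D Q, u.1 ∈ (chartAt (Coord D) u₀.1).source ∧
      ∀ w : TL u, push L u w = 0 →
        mfderiv (modelL D) 𝓘(ℝ, Coord D) (horizontalPart u₀ X) u w = 0) :
    BracketsVertical L O X := by
  intro V G hV hVO hG hGker u hu
  obtain ⟨u₀, husrc, h⟩ := hker u (hVO hu)
  rw [mem_verticalSpace_iff husrc,
    coordL_mlieBracket_fst hL hV (ContMDiffOn.mono hX hVO) hG hGker hu husrc]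
  exact h _ ((push_eq_zero_iff hL u _).2 (hGker u hu))

/-! ### The canonical Hamiltonian -/

/-- The preimage picked in the definition is immaterial, since E is constant on the preimages of 𝓛.
-/
theorem canonicalHamiltonian_fibreDerivative (hL : IsAlmostRegular L) {N : ℕ}
    (hN : ∀ u, Module.finrank ℝ (kerHessian L u) = N) (u : VelocitySpace D Q) :
    canonicalHamiltonian L (fibreDerivative L u) = energy L u := by
  have h : ∃ u', fibreDerivative L u' = fibreDerivative L u := ⟨u, rfl⟩
  rw [canonicalHamiltonian, dif_pos h]
  exact eq_of_fibreDerivative_eq hL hN isOpen_univ (contMDiff_energy hL.smooth).contMDiffOn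
    (fun u _ w hw => dL_energy_eq_zero hL.smooth u hw) (mem_univ _) h.choose_spec

theorem exists_representsCanonical (hL : IsAlmostRegular L) {N : ℕ}
    (hN : ∀ u, Module.finrank ℝ (kerHessian L u) = N) {W₀ : Set (PhaseSpace D Q)}
    (hW₀ : IsOpen W₀) {s : PhaseSpace D Q} (hs : s ∈ primarySurface L) (hsW : s ∈ W₀) :
    ∃ W H, s ∈ W ∧ W ⊆ W₀ ∧ RepresentsCanonical L W H := by
  obtain ⟨W, H, hW, hsW, hsub, hH, hHE⟩ := exists_descent hL hN hW₀
    (contMDiff_energy hL.smooth).contMDiffOn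
    (fun u _ w hw => dL_energy_eq_zero hL.smooth u hw) hs hsW
  refine ⟨W, H, hsW, hsub, hW, hH, ?_⟩
  rintro _ hW' ⟨u, rfl⟩
  rw [hHE u hW', canonicalHamiltonian_fibreDerivative hL hN]

theorem RepresentsCanonical.dC_push (hL : IsAlmostRegular L) {N : ℕ}
    (hN : ∀ u, Module.finrank ℝ (kerHessian L u) = N) {W : Set (PhaseSpace D Q)}
    {H : PhaseSpace D Q → ℝ} (hH : RepresentsCanonical L W H) {u : VelocitySpace D Q}
    (hu : fibreDerivative L u ∈ W) (Y : TL u) :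
    dC H (fibreDerivative L u) (push L u Y) = dL (energy L) u Y := by
  obtain ⟨hW, hsm, heq⟩ := hH
  rw [← dL_comp_fibreDerivative hL.smooth (SmoothFunOn.mdifferentiableAt hsm hW hu)]
  have h : H ∘ fibreDerivative L =ᶠ[𝓝 u] energy L := by
    filter_upwards [(isOpen_fibreDerivative_preimage hL.smooth hW).mem_nhds hu] with u' hu'
    exact (heq _ hu' ⟨u', rfl⟩).trans (canonicalHamiltonian_fibreDerivative hL hN u')
  rw [dL, h.mfderiv_eq]
  rfl

/-- The energy equation transported by 𝓛: Ω_L is the pullback of ω, and E that of H. It yields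
Hamilton's equation only against vectors tangent to the primary surface. -/
theorem IsSOELVF.canonicalForm_push (hL : IsAlmostRegular L) {N : ℕ}
    (hN : ∀ u, Module.finrank ℝ (kerHessian L u) = N) {X : VectorFieldL D Q} (hX : IsSOELVF L X)
    {W : Set (PhaseSpace D Q)} {H : PhaseSpace D Q → ℝ} (hH : RepresentsCanonical L W H)
    {u : VelocitySpace D Q} (hu : u ∈ firstOrderSurface L) (huW : fibreDerivative L u ∈ W)
    (Y : TL u) : canonicalForm (fibreDerivative L u) (push L u (X u)) (push L u Y) =
      dC H (fibreDerivative L u) (push L u Y) := by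
  rw [← lagrangeForm_eq hL.smooth, hX.energy_equation u hu, hH.dC_push hL hN huW]

end SingularLagrangian

/-! ### Smooth coefficients with respect to independent covectors -/

namespace SingularLagrangian

/-- A smooth family of vectors, independent at one point, has a smooth family of coordinate
functions near it. -/
theorem exists_smooth_coordinates {S V : Type*} [NormedAddCommGroup S] [NormedSpace ℝ S]
    [NormedAddCommGroup V] [NormedSpace ℝ V] [FiniteDimensional ℝ V] {N : ℕ} {α : Fin N → S → V}
    {O : Set S} (hO : IsOpen O) (hα : ∀ n, ContDiffOn ℝ ∞ (α n) O) {s₀ : S} (hs₀ : s₀ ∈ O)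
    (hind : LinearIndependent ℝ fun n => α n s₀) :
    ∃ (U : Set S) (R : S → V →L[ℝ] Fin N → ℝ), IsOpen U ∧ s₀ ∈ U ∧ U ⊆ O ∧ ContDiffOn ℝ ∞ R U ∧
      ∀ s ∈ U, ∀ c : Fin N → ℝ, R s (∑ n, c n • α n s) = c := by
  let A : S → (Fin N → ℝ) →L[ℝ] V := fun s =>
    ∑ n, ContinuousLinearMap.smulRightL ℝ (Fin N → ℝ) V (ContinuousLinearMap.proj n) (α n s)
  have hAapply : ∀ s c, A s c = ∑ n, c n • α n s := fun s c => by simp [A]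
  have hA : ContDiffOn ℝ ∞ A O := ContDiffOn.sum fun n _ =>
    (ContinuousLinearMap.contDiff _).comp_contDiffOn (hα n)
  have hinj : Function.Injective (A s₀) := by
    refine (injective_iff_map_eq_zero _).2 fun c hc => ?_
    rw [hAapply] at hc
    exact funext (Fintype.linearIndependent_iff.1 hind c hc)
  obtain ⟨U, R, hU, hsU, hUO, hR, hRA⟩ := exists_smooth_leftInverse hO hA hs₀ hinj
  exact ⟨U, R, hU, hsU, hUO, hR, fun s hs c => by rw [← hAapply]; exact hRA s hs c⟩

/-- Evaluation of covectors. -/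
noncomputable def evalCLM {E : Type*} [NormedAddCommGroup E] [NormedSpace ℝ E] :
    E →L[ℝ] (E →L[ℝ] ℝ) →L[ℝ] ℝ :=
  ContinuousLinearMap.apply ℝ ℝ

/-- The covector `i_X ω` for the standard symplectic form `ω`. -/
noncomputable def stdFlat {E : Type*} [NormedAddCommGroup E] [NormedSpace ℝ E]
    (X : E × (E →L[ℝ] ℝ)) : E × (E →L[ℝ] ℝ) →L[ℝ] ℝ :=
  (evalCLM X.1).comp (ContinuousLinearMap.snd ℝ E (E →L[ℝ] ℝ)) -
    X.2.comp (ContinuousLinearMap.fst ℝ E (E →L[ℝ] ℝ))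

theorem exists_eq_add_sum_of_commonKer_le {E : Type*} [NormedAddCommGroup E] [NormedSpace ℝ E]
    [FiniteDimensional ℝ E] {N : ℕ} {f : Fin N → E × (E →L[ℝ] ℝ) →L[ℝ] ℝ}
    {α : E × (E →L[ℝ] ℝ) →L[ℝ] ℝ} {X : E × (E →L[ℝ] ℝ)}
    (h : ∀ w, (∀ n, f n w = 0) → stdForm X w = α w) :
    ∃ c : Fin N → ℝ, ∀ w, stdForm X w = α w + ∑ n, c n * f n w := by
  obtain ⟨c, hc⟩ := exists_eq_sum_of_commonKer_le (f := f) (α := stdFlat X - α)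
    fun w hw => sub_eq_zero.2 (h w hw)
  exact ⟨c, fun w => sub_eq_iff_eq_add'.1 (hc w)⟩

/-- Covectors on `E × V` that are independent are so on `V`, if their values are attained there. -/
theorem linearIndependent_comp_inr {E V T : Type*} [NormedAddCommGroup E] [NormedSpace ℝ E]
    [NormedAddCommGroup V] [NormedSpace ℝ V] [NormedAddCommGroup T] [NormedSpace ℝ T] {N : ℕ}
    {φ : Fin N → E × V →L[ℝ] ℝ} {f : Fin N → T →L[ℝ] ℝ} (hf : LinearIndependent ℝ f)
    (h : ∀ w, ∃ η, ∀ n, f n w = φ n (0, η)) :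
    LinearIndependent ℝ fun n => (φ n).comp (ContinuousLinearMap.inr ℝ E V) := by
  rw [Fintype.linearIndependent_iff] at hf ⊢
  intro t ht
  refine hf t (ContinuousLinearMap.ext fun w => ?_)
  obtain ⟨η, hη⟩ := h w
  have h5 := congrArg (fun A : V →L[ℝ] ℝ => A η) ht
  rw [sum_apply] at h5 ⊢
  refine Eq.trans (Finset.sum_congr rfl fun n _ => ?_) h5
  rw [smul_apply, smul_apply, hη n]
  rfl

/-- A smooth left inverse of b ↦ ∑ b_n ∂γ_n/∂p recovers b from `ev a` - ∂H/∂p. The recovered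
function is smooth on an open set, even though multipliers b need exist only at some of its points;
this is how data on the image of P_L^[1] acquire smooth extensions. -/
theorem exists_smooth_covector_multipliers {E V : Type*} [NormedAddCommGroup E] [NormedSpace ℝ E]
    [FiniteDimensional ℝ E] [NormedAddCommGroup V] [NormedSpace ℝ V] [FiniteDimensional ℝ V]
    {N : ℕ} {γ : Fin N → E × V → ℝ} {H : E × V → ℝ} {a : E × V → E}
    {O : Set (E × V)} (ev : E →L[ℝ] V →L[ℝ] ℝ)
    (hO : IsOpen O) (hγ : ∀ n, ContDiffOn ℝ ∞ (γ n) O) (hH : ContDiffOn ℝ ∞ H O)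
    (ha : ContDiffOn ℝ ∞ a O) {y₀ : E × V} (hy₀ : y₀ ∈ O)
    (hind : LinearIndependent ℝ fun n =>
      (fderiv ℝ (γ n) y₀).comp (ContinuousLinearMap.inr ℝ E V)) :
    ∃ (U : Set (E × V)) (c : Fin N → E × V → ℝ), IsOpen U ∧ y₀ ∈ U ∧ U ⊆ O ∧
      (∀ n, ContDiffOn ℝ ∞ (c n) U) ∧ ∀ y ∈ U, ∀ b : Fin N → ℝ,
        (∀ η, ev (a y) η = fderiv ℝ H y (0, η) + ∑ n, b n * fderiv ℝ (γ n) y (0, η)) →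
          ∀ n, c n y = b n := by
  have hvert : ∀ h : E × V → ℝ, ContDiffOn ℝ ∞ h O → ContDiffOn ℝ ∞ (fun y =>
      (fderiv ℝ h y).comp (ContinuousLinearMap.inr ℝ E V)) O := fun h hh =>
    (hh.fderiv_of_isOpen hO (by simp)).clm_comp contDiffOn_const
  obtain ⟨U, R, hU, hsU, hUO, hR, hRα⟩ := exists_smooth_coordinates hO
    (fun n => hvert (γ n) (hγ n)) hy₀ hind
  have hβ : ContDiffOn ℝ ∞ (fun y => ev (a y)) O := ev.contDiff.comp_contDiffOn ha
  refine ⟨U, fun n y => R y (ev (a y) - (fderiv ℝ H y).comp (ContinuousLinearMap.inr ℝ E V)) n, hU, hsU,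
    hUO, fun n => contDiffOn_pi.1 (hR.clm_apply ((hβ.sub (hvert H hH)).mono hUO)) n, ?_⟩
  intro y hy b hb n
  have h1 : ev (a y) - (fderiv ℝ H y).comp (ContinuousLinearMap.inr ℝ E V) =
      ∑ n, b n • (fderiv ℝ (γ n) y).comp (ContinuousLinearMap.inr ℝ E V) := by
    refine ContinuousLinearMap.ext fun η => ?_
    rw [sum_apply, sub_apply, hb η]
    simp
  change R y (ev (a y) - (fderiv ℝ H y).comp (ContinuousLinearMap.inr ℝ E V)) n = b n
  rw [h1, hRα y hy b]

theorem exists_smooth_multipliers_flat {E : Type*} [NormedAddCommGroup E] [NormedSpace ℝ E]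
    [FiniteDimensional ℝ E] {N : ℕ} {γ : Fin N → E × (E →L[ℝ] ℝ) → ℝ} {H : E × (E →L[ℝ] ℝ) → ℝ}
    {a : E × (E →L[ℝ] ℝ) → E} {O : Set (E × (E →L[ℝ] ℝ))} (hO : IsOpen O)
    (hγ : ∀ n, ContDiffOn ℝ ∞ (γ n) O) (hH : ContDiffOn ℝ ∞ H O) (ha : ContDiffOn ℝ ∞ a O)
    {y₀ : E × (E →L[ℝ] ℝ)} (hy₀ : y₀ ∈ O) (hind : LinearIndependent ℝ fun n =>
      (fderiv ℝ (γ n) y₀).comp (ContinuousLinearMap.inr ℝ E (E →L[ℝ] ℝ))) :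
    ∃ (U : Set (E × (E →L[ℝ] ℝ))) (c : Fin N → E × (E →L[ℝ] ℝ) → ℝ), IsOpen U ∧ y₀ ∈ U ∧ U ⊆ O ∧
      (∀ n, ContDiffOn ℝ ∞ (c n) U) ∧ ∀ y ∈ U, ∀ b : Fin N → ℝ,
        (∀ η : E →L[ℝ] ℝ, η (a y) = fderiv ℝ H y (0, η) + ∑ n, b n * fderiv ℝ (γ n) y (0, η)) →
          ∀ n, c n y = b n :=
  exists_smooth_covector_multipliers evalCLM hO hγ hH ha hy₀ hind

variable {D : ℕ} {Q : Type*} [TopologicalSpace Q] [ChartedSpace (Coord D) Q]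
  [IsManifold (𝓡 D) ∞ Q] {L : VelocitySpace D Q → ℝ}

/-! ### Projectability -/

theorem horizontalPart_eq_coordC_push (hL : ContMDiff (modelL D) 𝓘(ℝ, ℝ) ∞ L)
    {u₀ u : VelocitySpace D Q} (hu : u.1 ∈ (chartAt (Coord D) u₀.1).source) (X : VectorFieldL D Q) :
    (coordC (fibreDerivative L u₀) (fibreDerivative L u) (push L u (X u))).1 =
      horizontalPart u₀ X u :=
  coordC_push_fst hL hu (X u)

theorem isOpen_chart_source_C (s₀ : PhaseSpace D Q) :
    IsOpen {s : PhaseSpace D Q | s.1 ∈ (chartAt (Coord D) s₀.1).source} := by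
  have h : {s : PhaseSpace D Q | s.1 ∈ (chartAt (Coord D) s₀.1).source} =
      (extChartAt (modelC D) s₀).source := by
    ext s
    exact mem_extChartAt_source_C.symm
  rw [h]
  exact isOpen_extChartAt_source s₀

theorem contMDiffOn_horizontalPart_source {X : VectorFieldL D Q} (hX : SmoothFieldOn X univ)
    (u₀ : VelocitySpace D Q) : ContMDiffOn (modelL D) 𝓘(ℝ, Coord D) ∞ (horizontalPart u₀ X)
      (fibreDerivative L ⁻¹' {s | s.1 ∈ (chartAt (Coord D) (fibreDerivative L u₀).1).source}) :=
  (contMDiffOn_horizontalPart hX isOpen_univ u₀).mono fun _ hu =>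
    ⟨mem_univ _, mem_extChartAt_source_L.2 hu⟩

/-- Verticality of the brackets with 𝒢 says that the differential of each base component kills ker
d𝓛. No restriction to P_L^[1] is needed here. -/
theorem IsSOELVF.horizontalPart_eq (hL : IsAlmostRegular L) {N : ℕ}
    (hN : ∀ u, Module.finrank ℝ (kerHessian L u) = N) {X : VectorFieldL D Q} (hX : IsSOELVF L X)
    {u₀ u u' : VelocitySpace D Q} (hu : u.1 ∈ (chartAt (Coord D) u₀.1).source)
    (heq : fibreDerivative L u' = fibreDerivative L u) :
    horizontalPart u₀ X u' = horizontalPart u₀ X u :=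
  eq_of_fibreDerivative_eq hL hN (isOpen_chart_source_C (fibreDerivative L u₀))
    (contMDiffOn_horizontalPart_source hX.smooth u₀)
    (fun _ hu _ hw => mfderiv_horizontalPart_eq_zero hL.smooth hN isOpen_univ hX.smooth hX.bracket
      (mem_univ _) hu hw) hu heq

theorem IsSOELVF.exists_descent_horizontalPart (hL : IsAlmostRegular L) {N : ℕ}
    (hN : ∀ u, Module.finrank ℝ (kerHessian L u) = N) {X : VectorFieldL D Q} (hX : IsSOELVF L X)
    (u₀ : VelocitySpace D Q) : ∃ (W : Set (PhaseSpace D Q)) (a : PhaseSpace D Q → Coord D),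
      IsOpen W ∧ fibreDerivative L u₀ ∈ W ∧ ContMDiffOn (modelC D) 𝓘(ℝ, Coord D) ∞ a W ∧
        ∀ u, fibreDerivative L u ∈ W → u.1 ∈ (chartAt (Coord D) u₀.1).source ∧
          a (fibreDerivative L u) = horizontalPart u₀ X u := by
  obtain ⟨W, a, hW, hu₀, hsub, ha, h⟩ := exists_descent hL hN
    (isOpen_chart_source_C (fibreDerivative L u₀))
    (contMDiffOn_horizontalPart_source hX.smooth u₀)
    (fun _ hu _ hw => mfderiv_horizontalPart_eq_zero hL.smooth hN isOpen_univ hX.smooth hX.bracket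
      (mem_univ _) hu hw) ⟨u₀, rfl⟩ (base_mem_source (fibreDerivative L u₀).1)
  exact ⟨W, a, hW, hu₀, ha, fun u hu => ⟨hsub hu, h u hu⟩⟩

/-- The tangent space of the primary surface projects onto all base directions, because 𝓛 covers the
identity of Q. -/
theorem exists_push_fst_eq (hL : ContMDiff (modelL D) 𝓘(ℝ, ℝ) ∞ L) (u : VelocitySpace D Q)
    (a : Coord D) : ∃ Y : TL u, (push L u Y : Coord D × (Coord D →L[ℝ] ℝ)).1 = a :=
  ⟨horizontal u a, congrArg Prod.fst (push_eq_prod hL u (horizontal u a))⟩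

/-- A separate point s with 𝓛(u) = s allows the pushes from different points of one fibre to be
tested against the same tangent vector at s. -/
theorem IsSOELVF.stdForm_push (hL : IsAlmostRegular L) {N : ℕ}
    (hN : ∀ u, Module.finrank ℝ (kerHessian L u) = N) {X : VectorFieldL D Q} (hX : IsSOELVF L X)
    {W : Set (PhaseSpace D Q)} {γ : Fin N → PhaseSpace D Q → ℝ}
    (hγ : IsDefiningSystem (primarySurface L) W γ) {W' : Set (PhaseSpace D Q)}
    {H : PhaseSpace D Q → ℝ} (hH : RepresentsCanonical L W' H) {s : PhaseSpace D Q} (hsW : s ∈ W)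
    (hsW' : s ∈ W') {u : VelocitySpace D Q} (hu : u ∈ firstOrderSurface L)
    (hus : fibreDerivative L u = s) (w : TC s) (hw : ∀ n, dC (γ n) s w = 0) :
    stdForm (push L u (X u) : Coord D × (Coord D →L[ℝ] ℝ)) w = dC H s w := by
  subst hus
  obtain ⟨Y, rfl⟩ := exists_push_eq hL.smooth hN hγ hsW w hw
  exact hX.canonicalForm_push hL hN hH hu hsW' Y

/-- The base components agree because they descend. The momentum components are then determined by
the energy equation, tested on vectors tangent to the primary surface; this second step needs both
points in P_L^[1]. -/
theorem IsSOELVF.push_eq_of_fibreDerivative_eq (hL : IsAlmostRegular L) {N : ℕ}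
    (hN : ∀ u, Module.finrank ℝ (kerHessian L u) = N) {X : VectorFieldL D Q} (hX : IsSOELVF L X)
    {u u' : VelocitySpace D Q} (hu : u ∈ firstOrderSurface L) (hu' : u' ∈ firstOrderSurface L)
    (heq : fibreDerivative L u' = fibreDerivative L u) :
    (push L u (X u) : Coord D × (Coord D →L[ℝ] ℝ)) = push L u' (X u') := by
  obtain ⟨W, γ, hsW, hγ⟩ := exists_definingSystem hL hN ⟨u, rfl⟩
  obtain ⟨W', H, hsW', -, hH⟩ := exists_representsCanonical hL hN isOpen_univ
    (⟨u, rfl⟩ : fibreDerivative L u ∈ primarySurface L) (mem_univ _)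
  have hbase : u'.1 ∈ (chartAt (Coord D) u.1).source := by
    have h : u'.1 = u.1 := congrArg (fun s : PhaseSpace D Q => s.1) heq
    rw [h]
    exact base_mem_source u.1
  have hcoord : ∀ s, s = fibreDerivative L u → ∀ w : TC s, coordC (fibreDerivative L u) s w = w := by
    rintro _ rfl w
    exact coordC_self _ w
  obtain ⟨A, hA⟩ : ∃ A : Coord D × (Coord D →L[ℝ] ℝ), A = push L u (X u) := ⟨_, rfl⟩
  obtain ⟨A', hA'⟩ : ∃ A' : Coord D × (Coord D →L[ℝ] ℝ), A' = push L u' (X u') := ⟨_, rfl⟩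
  rw [← hA, ← hA']
  have h1 : A.1 = A'.1 := by
    rw [hA, hA']
    refine (congrArg Prod.fst (hcoord _ rfl _)).symm.trans ?_
    refine (horizontalPart_eq_coordC_push hL.smooth (base_mem_source u.1) X).trans ?_
    refine (hX.horizontalPart_eq hL hN (base_mem_source u.1) heq).symm.trans ?_
    refine (horizontalPart_eq_coordC_push hL.smooth hbase X).symm.trans ?_
    exact congrArg Prod.fst (hcoord _ heq _)
  refine Prod.ext h1 (ContinuousLinearMap.ext fun a => ?_)
  -- For a tangent vector B with base component a, ω(A, B) = B.2(A.1) - A.2(a). The values of ω and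
  -- the base components of A and A' agree, so A.2(a) = A'.2(a).
  obtain ⟨Y, hY⟩ := exists_push_fst_eq hL.smooth u a
  have h2 := hX.stdForm_push hL hN hγ hH hsW hsW' hu rfl (push L u Y)
    fun n => dC_push_eq_zero hL.smooth hγ hsW n Y
  have h3 := hX.stdForm_push hL hN hγ hH hsW hsW' hu' heq (push L u Y)
    fun n => dC_push_eq_zero hL.smooth hγ hsW n Y
  obtain ⟨B, hB⟩ : ∃ B : Coord D × (Coord D →L[ℝ] ℝ), B = push L u Y := ⟨_, rfl⟩
  rw [← hB] at hY
  have h4 : stdForm A' B = stdForm A B := by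
    rw [hA, hA', hB]
    exact h3.trans h2.symm
  rw [stdForm, stdForm, hY, h1] at h4
  linarith

open Classical in
theorem IsSOELVF.exists_projectsTo (hL : IsAlmostRegular L) {N : ℕ}
    (hN : ∀ u, Module.finrank ℝ (kerHessian L u) = N) {X : VectorFieldL D Q}
    (hX : IsSOELVF L X) : ∃ 𝔛, ProjectsTo L X 𝔛 := by
  refine ⟨fun s => if h : ∃ u ∈ firstOrderSurface L, fibreDerivative L u = s then
    (push L h.choose (X h.choose) : Coord D × (Coord D →L[ℝ] ℝ)) else
      (0 : Coord D × (Coord D →L[ℝ] ℝ)), fun u hu => ?_⟩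
  have h : ∃ u' ∈ firstOrderSurface L, fibreDerivative L u' = fibreDerivative L u := ⟨u, hu, rfl⟩
  refine Eq.trans ?_ (dif_pos h).symm
  exact hX.push_eq_of_fibreDerivative_eq hL hN hu h.choose_spec.1 h.choose_spec.2

/-! ### Hamiltonian vector fields -/

/-- At a common zero of the k_i the product rule loses the terms with dg_i. Hence the derivatives of
multipliers never enter the equations of motion on the constraint surface. -/
theorem dC_add_sum_mul {ι : Type*} [Fintype ι] {H : PhaseSpace D Q → ℝ}
    {g k : ι → PhaseSpace D Q → ℝ} {s : PhaseSpace D Q}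
    (hH : MDifferentiableAt (modelC D) 𝓘(ℝ, ℝ) H s)
    (hg : ∀ i, MDifferentiableAt (modelC D) 𝓘(ℝ, ℝ) (g i) s)
    (hk : ∀ i, MDifferentiableAt (modelC D) 𝓘(ℝ, ℝ) (k i) s) (hk0 : ∀ i, k i s = 0) (w : TC s) :
    dC (fun t => H t + ∑ i, g i t * k i t) s w = dC H s w + ∑ i, g i s * dC (k i) s w := by
  set Ψ := extChartAt (modelC D) s with hΨ
  have hbase := base_mem_source (D := D) s.1
  have hpt : Ψ.symm (Ψ s) = s := Ψ.left_inv (mem_extChartAt_source s)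
  have hsymm : MDifferentiableAt 𝓘(ℝ, Coord D × (Coord D →L[ℝ] ℝ)) (modelC D) Ψ.symm (Ψ s) :=
    mdifferentiableAt_extChartAt_symm_of_mem (modelC D) (mem_extChartAt_target s)
  have hd : ∀ h : PhaseSpace D Q → ℝ, MDifferentiableAt (modelC D) 𝓘(ℝ, ℝ) h s →
      HasFDerivAt (h ∘ Ψ.symm) (fderiv ℝ (h ∘ Ψ.symm) (Ψ s)) (Ψ s) := by
    intro h hh
    rw [← hpt] at hh
    exact (mdifferentiableAt_iff_differentiableAt.1 (hh.comp (Ψ s) hsymm)).hasFDerivAt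
  have h1 : HasFDerivAt ((fun t => H t + ∑ i, g i t * k i t) ∘ Ψ.symm) _ (Ψ s) :=
    (hd H hH).add (HasFDerivAt.fun_sum (u := Finset.univ)
      fun i _ => (hd (g i) (hg i)).mul (hd (k i) (hk i)))
  have hmd : MDifferentiableAt (modelC D) 𝓘(ℝ, ℝ) (fun t => H t + ∑ i, g i t * k i t) s := by
    have h2 := (mdifferentiableAt_iff_differentiableAt.2 h1.differentiableAt).comp s
      (mdifferentiableAt_extChartAt_of_mem (modelC D) (mem_extChartAt_source s))
    refine h2.congr_of_eventuallyEq ?_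
    filter_upwards [extChartAt_source_mem_nhds (I := modelC D) s] with t ht
    simp only [Function.comp_apply]
    rw [Ψ.left_inv ht]
  rw [dC_eq_fderiv hbase hmd, ← hΨ, h1.fderiv, dC_eq_fderiv hbase hH, add_apply,
    sum_apply]
  refine congrArg₂ _ rfl (Finset.sum_congr rfl fun i _ => ?_)
  rw [dC_eq_fderiv hbase (hk i)]
  simp only [Function.comp_apply, hpt, hk0 i, zero_smul, add_zero]
  rfl

theorem smoothFunOn_add_sum_mul {ι : Type*} [Fintype ι] {W : Set (PhaseSpace D Q)}
    {H : PhaseSpace D Q → ℝ} {g k : ι → PhaseSpace D Q → ℝ} (hH : SmoothFunOn H W)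
    (hg : ∀ i, SmoothFunOn (g i) W) (hk : ∀ i, SmoothFunOn (k i) W) :
    SmoothFunOn (fun t => H t + ∑ i, g i t * k i t) W := by
  have h : ContMDiffOn (modelC D) 𝓘(ℝ, ℝ) ∞ (fun t => ∑ i, g i t * k i t) W :=
    contMDiffOn_finsetSum fun i _ => ContMDiffOn.mul (hg i) (hk i)
  exact ContMDiffOn.add hH h

/-- Along the primary constraint surface, the derivatives of independent primary constraints in the
direction of the momenta are independent. -/
theorem linearIndependent_fderiv_inr (hL : ContMDiff (modelL D) 𝓘(ℝ, ℝ) ∞ L) {N : ℕ}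
    {W : Set (PhaseSpace D Q)} {γ : Fin N → PhaseSpace D Q → ℝ}
    (hγ : IsDefiningSystem (primarySurface L) W γ) {u₀ u : VelocitySpace D Q}
    (hu : u.1 ∈ (chartAt (Coord D) u₀.1).source) (huW : fibreDerivative L u ∈ W) :
    LinearIndependent ℝ fun n => (fderiv ℝ
      (γ n ∘ (extChartAt (modelC D) (fibreDerivative L u₀)).symm)
        (extChartAt (modelC D) (fibreDerivative L u₀) (fibreDerivative L u))).comp
          (ContinuousLinearMap.inr ℝ (Coord D) (Coord D →L[ℝ] ℝ)) := by
  set Ψ := extChartAt (modelC D) (fibreDerivative L u₀) with hΨ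
  refine linearIndependent_comp_inr (T := Coord D × (Coord D →L[ℝ] ℝ))
    (f := fun n => dC (γ n) (fibreDerivative L u)) (hγ.2.2.2 _ huW ⟨u, rfl⟩) fun w => ?_
  -- Subtracting from w a pushed vector with the same base component leaves a pure momentum
  -- direction and does not change the values of the dγ_n, which vanish on pushes.
  obtain ⟨Y, hY⟩ : ∃ Y : TL u, (coordL u₀ u Y).1 =
      (coordC (fibreDerivative L u₀) (fibreDerivative L u) w).1 := by
    obtain ⟨Y, hY⟩ := coordL_surjective hu
      ((coordC (fibreDerivative L u₀) (fibreDerivative L u) w).1, 0)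
    exact ⟨Y, congrArg Prod.fst hY⟩
  have h2 : coordC (fibreDerivative L u₀) (fibreDerivative L u) w =
      coordC (fibreDerivative L u₀) (fibreDerivative L u) (push L u Y) +
        (0, (coordC (fibreDerivative L u₀) (fibreDerivative L u) w).2 -
          (coordC (fibreDerivative L u₀) (fibreDerivative L u) (push L u Y)).2) := by
    refine Prod.ext ?_ (add_sub_cancel _ _).symm
    rw [Prod.fst_add, add_zero, coordC_push_fst hL hu, hY]
  refine ⟨(coordC (fibreDerivative L u₀) (fibreDerivative L u) w).2 -
    (coordC (fibreDerivative L u₀) (fibreDerivative L u) (push L u Y)).2, fun n => ?_⟩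
  have hmd := SmoothFunOn.mdifferentiableAt (hγ.2.1 n) hγ.1 huW
  have h4 := dC_push_eq_zero hL hγ huW n Y
  rw [dC_eq_fderiv (s₀ := fibreDerivative L u₀) (s := fibreDerivative L u) hu hmd] at h4
  refine (dC_eq_fderiv (s₀ := fibreDerivative L u₀) (s := fibreDerivative L u) hu hmd w).trans ?_
  rw [h2]
  refine (ContinuousLinearMap.map_add _ _ _).trans ?_
  rw [h4, zero_add]
  congr 2
  rw [Prod.snd_add, add_sub_cancel_left]

theorem canonicalForm_of_coordC_fst_eq_zero {s₀ s : PhaseSpace D Q}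
    (hs : s.1 ∈ (chartAt (Coord D) s₀.1).source) (A w : TC s) {η : Coord D →L[ℝ] ℝ}
    (hw : coordC s₀ s w = (0, η)) : canonicalForm s A w = η (coordC s₀ s A).1 := by
  rw [canonicalForm_eq_coordC hs, hw, stdForm, map_zero, sub_zero]

/-- If `i_A ω = dH + ∑ c_n dγ_n` at points of the primary constraint surface, where the horizontal
part of `A` is a smooth function, then the `c_n` are smooth functions. -/
theorem exists_smooth_multipliers (hL : ContMDiff (modelL D) 𝓘(ℝ, ℝ) ∞ L) {N : ℕ}
    {W : Set (PhaseSpace D Q)} {γ : Fin N → PhaseSpace D Q → ℝ}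
    (hγ : IsDefiningSystem (primarySurface L) W γ) {u₀ : VelocitySpace D Q}
    (hu₀ : fibreDerivative L u₀ ∈ W) {H : PhaseSpace D Q → ℝ} (hH : SmoothFunOn H W)
    {a : PhaseSpace D Q → Coord D} (ha : ContMDiffOn (modelC D) 𝓘(ℝ, Coord D) ∞ a W) :
    ∃ (W' : Set (PhaseSpace D Q)) (c : Fin N → PhaseSpace D Q → ℝ), IsOpen W' ∧
      fibreDerivative L u₀ ∈ W' ∧ W' ⊆ W ∧ (∀ n, SmoothFunOn (c n) W') ∧
        ∀ t ∈ W', ∀ (A : TC t) (b : Fin N → ℝ), (coordC (fibreDerivative L u₀) t A).1 = a t →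
          (∀ w, canonicalForm t A w = dC H t w + ∑ n, b n * dC (γ n) t w) → ∀ n, c n t = b n := by
  set Ψ := extChartAt (modelC D) (fibreDerivative L u₀) with hΨ
  have hO := isOpen_chart_symm_preimage (I := modelC D) hγ.1 (fibreDerivative L u₀)
  have hs₀ : Ψ (fibreDerivative L u₀) ∈ Ψ.target ∩ Ψ.symm ⁻¹' W :=
    ⟨mem_extChartAt_target _, by
      rw [mem_preimage, Ψ.left_inv (mem_extChartAt_source _)]; exact hu₀⟩
  have hγΨ : ∀ n, ContDiffOn ℝ ∞ (γ n ∘ Ψ.symm) (Ψ.target ∩ Ψ.symm ⁻¹' W) := fun n =>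
    contDiffOn_comp_chart_symm (hγ.2.1 n) _
  obtain ⟨U, c, hU, hsU, hUO, hc, hcb⟩ := exists_smooth_multipliers_flat hO hγΨ
    (contDiffOn_comp_chart_symm hH _) (contDiffOn_comp_chart_symm ha _) hs₀
      (linearIndependent_fderiv_inr hL hγ (base_mem_source u₀.1) hu₀)
  have hWO : IsOpen (Ψ.source ∩ Ψ ⁻¹' U) := isOpen_chart_preimage hU _
  refine ⟨Ψ.source ∩ Ψ ⁻¹' U, fun n t => c n (Ψ t), hWO,
    ⟨mem_extChartAt_source _, hsU⟩, ?_, ?_, ?_⟩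
  · intro t ht
    have h1 : Ψ.symm (Ψ t) ∈ W := (hUO ht.2).2
    rwa [Ψ.left_inv ht.1] at h1
  · intro n
    exact contMDiffOn_comp_chart (hc n) _
  · intro t ht A b hA hb n
    have hbase := mem_extChartAt_source_C.1 ht.1
    have htW : t ∈ W := by
      have h1 : Ψ.symm (Ψ t) ∈ W := (hUO ht.2).2
      rwa [Ψ.left_inv ht.1] at h1
    refine hcb _ ht.2 b (fun η => ?_) n
    -- Tested on momentum directions, the identity involves A only through its base component, which
    -- is the one known to be smooth.
    obtain ⟨w, hw⟩ := coordC_surjective hbase (0, η)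
    have h2 := hb w
    rw [canonicalForm_of_coordC_fst_eq_zero hbase A w hw, hA,
      dC_eq_fderiv hbase (SmoothFunOn.mdifferentiableAt hH hγ.1 htW), hw] at h2
    have h3 : ∀ n, dC (γ n) t w = fderiv ℝ (γ n ∘ Ψ.symm) (Ψ t) (0, η) := fun n => by
      rw [dC_eq_fderiv hbase (SmoothFunOn.mdifferentiableAt (hγ.2.1 n) hγ.1 htW), hw]
    simp only [h3] at h2
    simp only [Function.comp_apply]
    rw [Ψ.left_inv ht.1]
    exact h2

/-- The projection of a SOELVF is the Hamiltonian vector field of a suitable extension of the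
canonical Hamiltonian. -/
theorem IsSOELVF.exists_isHamiltonianFieldOn (hL : IsAlmostRegular L) {N : ℕ}
    (hN : ∀ u, Module.finrank ℝ (kerHessian L u) = N) {X : VectorFieldL D Q} (hX : IsSOELVF L X)
    {𝔛 : VectorFieldC D Q} (h𝔛 : ProjectsTo L X 𝔛) {s : PhaseSpace D Q}
    (hs : s ∈ primarySurface L) : ∃ W H, s ∈ W ∧ RepresentsCanonical L W H ∧
      IsHamiltonianFieldOn 𝔛 H (projectedSurface L ∩ W) := by
  obtain ⟨W₁, γ, hs₁, hγ₁⟩ := exists_definingSystem hL hN hs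
  obtain ⟨u₀, rfl⟩ := hs
  obtain ⟨W₂, a, hW₂, hs₂, ha, haX⟩ := hX.exists_descent_horizontalPart hL hN u₀
  obtain ⟨W₃, H, hs₃, hW₃, hH⟩ := exists_representsCanonical hL hN (hγ₁.1.inter hW₂)
    (⟨u₀, rfl⟩ : fibreDerivative L u₀ ∈ primarySurface L) ⟨hs₁, hs₂⟩
  have hγ := hγ₁.mono hH.1 fun t ht => (hW₃ ht).1
  obtain ⟨W, c, hW, hsW, hWW₃, hc, hcb⟩ := exists_smooth_multipliers hL.smooth hγ hs₃ hH.2.1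
    (ha.mono fun t ht => (hW₃ ht).2)
  -- The correction vanishes on the primary surface, so the sum still represents H_C, while its
  -- differential there acquires the missing combination of the dγ_n.
  refine ⟨W, fun t => H t + ∑ n, c n t * γ n t, hsW, ⟨hW, ?_, ?_⟩, ?_⟩
  · exact smoothFunOn_add_sum_mul (ContMDiffOn.mono hH.2.1 hWW₃) hc
      fun n => ContMDiffOn.mono (hγ.2.1 n) hWW₃
  · intro t ht htS
    rw [← hH.2.2 t (hWW₃ ht) htS]
    simp only [(hγ.2.2.1 t (hWW₃ ht)).1 htS, mul_zero, Finset.sum_const_zero, add_zero]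
  · rintro _ ⟨⟨u, hu, rfl⟩, ht⟩ w
    have ht₃ := hWW₃ ht
    have htγ := (hγ.2.2.1 _ ht₃).1 ⟨u, rfl⟩
    rw [← h𝔛 u hu]
    -- The multipliers b exist pointwise, as i_𝔛 ω - dH kills the tangent space of the primary
    -- surface; `hcb'` identifies them with the values of the smooth c_n.
    obtain ⟨b, hb⟩ := exists_eq_add_sum_of_commonKer_le (E := Coord D)
      (f := fun n => dC (γ n) (fibreDerivative L u)) (α := dC H (fibreDerivative L u))
      (X := push L u (X u)) (hX.stdForm_push hL hN hγ hH ht₃ ht₃ hu rfl)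
    have hb' : ∀ w, canonicalForm (fibreDerivative L u) (push L u (X u)) w =
        dC H (fibreDerivative L u) w + ∑ n, b n * dC (γ n) (fibreDerivative L u) w := hb
    have hcb' := hcb _ ht (push L u (X u)) b
      ((horizontalPart_eq_coordC_push hL.smooth (haX u (hW₃ ht₃).2).1 X).trans
        (haX u (hW₃ ht₃).2).2.symm) hb'
    rw [hb' w, dC_add_sum_mul (SmoothFunOn.mdifferentiableAt hH.2.1 hH.1 ht₃)
      (fun n => SmoothFunOn.mdifferentiableAt (hc n) hW ht)
      (fun n => SmoothFunOn.mdifferentiableAt (hγ.2.1 n) hγ.1 ht₃) htγ]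
    simp only [hcb']

end SingularLagrangian

namespace SingularLagrangian

theorem stdForm_map_add_sum {E V ι : Type*} [NormedAddCommGroup E] [NormedSpace ℝ E]
    [FiniteDimensional ℝ E] [NormedAddCommGroup V] [NormedSpace ℝ V] [Fintype ι]
    (A : V →L[ℝ] E × (E →L[ℝ] ℝ)) (x : V) (c : ι → ℝ) (p : ι → V) (w : E × (E →L[ℝ] ℝ)) :
    stdForm (A (x + ∑ i, c i • p i)) w = stdForm (A x) w + ∑ i, c i * stdForm (A (p i)) w := by
  have h : ∀ X, stdForm X w = (stdBilin E).flip w X := fun X => rfl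
  simp only [h, map_add, map_sum, map_smul, smul_eq_mul]

variable {D : ℕ} {Q : Type*} [TopologicalSpace Q] [ChartedSpace (Coord D) Q]
  [IsManifold (𝓡 D) ∞ Q] {L : VelocitySpace D Q → ℝ}

/-! ### Total Hamiltonians -/

theorem push_eq_of_sub_mem_verticalKernel (hL : ContMDiff (modelL D) 𝓘(ℝ, ℝ) ∞ L)
    {u : VelocitySpace D Q} {x y : TL u} (h : x - y ∈ verticalKernel L u) :
    push L u x = push L u y := by
  have h1 := (push_eq_zero_iff hL u _).2 h
  exact sub_eq_zero.1 ((ContinuousLinearMap.map_sub (push L u) x y).symm.trans h1)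

theorem canonicalForm_push_add_sum {ι : Type*} [Fintype ι] {u : VelocitySpace D Q} (x : TL u)
    (c : ι → ℝ) (p : ι → TL u) (w : TC (fibreDerivative L u)) :
    canonicalForm (fibreDerivative L u) (push L u (x + ∑ i, c i • p i)) w =
      canonicalForm (fibreDerivative L u) (push L u x) w +
        ∑ i, c i * canonicalForm (fibreDerivative L u) (push L u (p i)) w :=
  stdForm_map_add_sum (E := Coord D) (V := Coord D × Coord D) (push L u) x c p w

section Adapted

variable {W : Set (PhaseSpace D Q)} {N r : ℕ} {γ : Fin N → PhaseSpace D Q → ℝ} {e : Fin r ↪ Fin N}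
  {P : Fin r → VectorFieldL D Q} {f : Fin r → PhaseSpace D Q → ℝ}

/-- By nondegeneracy of ω, f_m = 0 would give d𝓛(P_m) = 0, i.e. P_m in 𝒢, against the independence
of the classes modulo 𝒢. -/
theorem IsAdaptedSystem.ne_zero (hL : ContMDiff (modelL D) 𝓘(ℝ, ℝ) ∞ L)
    (hA : IsAdaptedSystem L W γ e P f) {u : VelocitySpace D Q} (hu : fibreDerivative L u ∈ W)
    (m : Fin r) : f m (fibreDerivative L u) ≠ 0 := by
  intro h0
  have h1 : push L u (P m u) = 0 := eq_zero_of_stdForm_eq_zero (E := Coord D) fun w =>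
    (hA.contraction m u hu w).trans (by rw [h0, zero_mul])
  refine (hA.independent u hu).ne_zero m ?_
  rw [Submodule.mkQ_apply, Submodule.Quotient.mk_eq_zero]
  exact (push_eq_zero_iff hL u _).1 h1

/-- On P_L^[1] both fields solve the same energy equation, so their difference lies in ker Ω_L and
is ∑ d_m P_m modulo 𝒢. Contracting its push with ω gives ∑ d_m f_m dγ_{e m}, so the d_m f_m are
multipliers of a vector with smooth base components and extend smoothly. -/
theorem exists_isDecompositionOn (hL : IsAlmostRegular L)
    (hN : ∀ u, Module.finrank ℝ (kerHessian L u) = N) {X X₀ : VectorFieldL D Q}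
    (hX : IsSOELVF L X) (hX₀ : IsSOELVF L X₀) (hA : IsAdaptedSystem L W γ e P f)
    {s : PhaseSpace D Q} (hs : s ∈ primarySurface L) (hsW : s ∈ W) :
    ∃ (W' : Set (PhaseSpace D Q)) (c : Fin r → PhaseSpace D Q → ℝ), IsOpen W' ∧ s ∈ W' ∧ W' ⊆ W ∧
      IsDecompositionOn L W' X X₀ P c := by
  obtain ⟨u₀, rfl⟩ := hs
  obtain ⟨W₁, a, hW₁, hs₁, ha, haX⟩ := hX.exists_descent_horizontalPart hL hN u₀
  obtain ⟨W₂, a₀, hW₂, hs₂, ha₀, haX₀⟩ := hX₀.exists_descent_horizontalPart hL hN u₀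
  have hγ := hA.constraints.mono (hA.constraints.1.inter (hW₁.inter hW₂)) inter_subset_left
  -- The Hamiltonian is 0 here: the contributions of dH_C to the two fields cancel in their
  -- difference.
  obtain ⟨W₃, c, hW₃, hs₃, hsub₃, hc, hcb⟩ := exists_smooth_multipliers hL.smooth hγ
    ⟨hsW, hs₁, hs₂⟩ (H := fun _ => 0) contMDiffOn_const (a := fun t => a t - a₀ t)
    ((ha.mono fun t ht => ht.2.1).sub (ha₀.mono fun t ht => ht.2.2))
  -- Each f_m is nonzero on the primary surface only. Nonvanishing of the product selects an open
  -- neighbourhood on which division by every f_m is smooth.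
  have hcont : ContinuousOn (fun t => ∏ m, f m t) W₃ := continuousOn_finsetProd _ fun m _ =>
    (ContMDiffOn.continuousOn (hA.smooth m)).mono fun t ht => (hsub₃ ht).1
  have hne : ∀ t ∈ W₃ ∩ (fun t => ∏ m, f m t) ⁻¹' {0}ᶜ, ∀ m, f m t ≠ 0 := fun t ht m =>
    Finset.prod_ne_zero_iff.1 ht.2 m (Finset.mem_univ m)
  refine ⟨W₃ ∩ (fun t => ∏ m, f m t) ⁻¹' {0}ᶜ, fun m t => c (e m) t / f m t,
    hcont.isOpen_inter_preimage hW₃ isOpen_compl_singleton,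
    ⟨hs₃, Finset.prod_ne_zero_iff.2 fun m _ => hA.ne_zero hL.smooth hsW m⟩,
    fun t ht => (hsub₃ ht.1).1, fun m => ?_, fun u hu ht => ?_⟩
  · exact ContMDiffOn.div₀ (ContMDiffOn.mono (hc (e m)) inter_subset_left)
      (ContMDiffOn.mono (hA.smooth m) fun t ht => (hsub₃ ht.1).1) fun t ht => hne t ht m
  · obtain ⟨htW, ht₁, ht₂⟩ := hsub₃ ht.1
    have hker : X u - X₀ u ∈ kerForm L u := by
      refine LinearMap.mem_ker.2 ?_
      refine (ContinuousLinearMap.map_sub (lagrangeForm L u) _ _).trans ?_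
      rw [hX.energy_equation u hu, hX₀.energy_equation u hu]
      exact sub_self _
    rw [← hA.spanning u htW, Submodule.mem_sup] at hker
    obtain ⟨g, hg, p, hp, hgp⟩ := hker
    obtain ⟨d, rfl⟩ := (Submodule.mem_span_range_iff_exists_fun ℝ).1 hp
    have hpush : ∀ w, canonicalForm (fibreDerivative L u) (push L u (X u - X₀ u)) w =
        ∑ m, d m * (f m (fibreDerivative L u) * dC (γ (e m)) (fibreDerivative L u) w) := by
      intro w
      rw [← hgp, canonicalForm_push_add_sum, (push_eq_zero_iff hL.smooth u g).2 hg]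
      have h0 : canonicalForm (fibreDerivative L u) 0 w = 0 := by
        rw [canonicalForm_eq_stdForm]
        exact (congrArg₂ (· - ·) (ContinuousLinearMap.map_zero _) rfl).trans (sub_self _)
      rw [h0, zero_add]
      exact Finset.sum_congr rfl fun m _ => by rw [hA.contraction m u htW w]
    -- The multipliers at this point are d_m f_m in place e m and 0 elsewhere, so the quotient by
    -- f_m returns d_m.
    have hcoef := hcb _ ht.1 (push L u (X u - X₀ u))
      (fun n => ∑ m, if e m = n then d m * f m (fibreDerivative L u) else 0) (by
        rw [coordC_push_fst hL.smooth (haX u ht₁).1, (haX u ht₁).2, (haX₀ u ht₂).2]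
        exact congrArg Prod.fst (ContinuousLinearMap.map_sub (coordL u₀ u) (X u) (X₀ u))) (by
        intro w
        have h0 : dC (fun _ => (0 : ℝ)) (fibreDerivative L u) w = 0 := by
          rw [dC, mfderiv_const]
          rfl
        rw [hpush w, h0, zero_add]
        simp only [Finset.sum_mul, ite_mul, zero_mul]
        rw [Finset.sum_comm]
        simp only [Finset.sum_ite_eq, Finset.mem_univ, if_true, mul_assoc])
    have hd : ∀ m, c (e m) (fibreDerivative L u) / f m (fibreDerivative L u) = d m := by
      intro m
      rw [hcoef (e m)]
      simp only [e.injective.eq_iff, Finset.sum_ite_eq', Finset.mem_univ, if_true]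
      exact mul_div_cancel_right₀ _ (hne _ ht m)
    simp only [hd]
    rw [← sub_sub, ← hgp, add_sub_cancel_right]
    exact hg

/-- The push ignores the part in 𝒢, each P_m contributes f_m dγ_{e m}, and at zeros of the
constraints the differential of the added terms is exactly ∑ c_m f_m dγ_{e m}. -/
theorem isHamiltonianFieldOn_totalHamiltonian (hL : ContMDiff (modelL D) 𝓘(ℝ, ℝ) ∞ L)
    {X X₀ : VectorFieldL D Q} {𝔛 𝔛₀ : VectorFieldC D Q} (h𝔛₀ : ProjectsTo L X₀ 𝔛₀)
    (h𝔛 : ProjectsTo L X 𝔛) {H : PhaseSpace D Q → ℝ} (hH : RepresentsCanonical L W H)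
    (hHam : IsHamiltonianFieldOn 𝔛₀ H (projectedSurface L ∩ W))
    (hA : IsAdaptedSystem L W γ e P f) {W' : Set (PhaseSpace D Q)}
    {c : Fin r → PhaseSpace D Q → ℝ} (hW' : IsOpen W') (hsub : W' ⊆ W)
    (hc : IsDecompositionOn L W' X X₀ P c) :
    IsHamiltonianFieldOn 𝔛 (totalHamiltonian H c f γ e) (projectedSurface L ∩ W') := by
  rintro _ ⟨⟨u, hu, rfl⟩, ht⟩ w
  have htW := hsub ht
  have h0 : ∀ m, γ (e m) (fibreDerivative L u) = 0 := fun m =>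
    (hA.constraints.2.2.1 _ htW).1 ⟨u, rfl⟩ (e m)
  have h1 : dC (totalHamiltonian H c f γ e) (fibreDerivative L u) w = _ :=
    dC_add_sum_mul (g := fun m t => c m t * f m t) (k := fun m => γ (e m))
      (SmoothFunOn.mdifferentiableAt hH.2.1 hH.1 htW)
      (fun m => ((SmoothFunOn.mdifferentiableAt (hc.1 m) hW' ht).mul
        (SmoothFunOn.mdifferentiableAt (hA.smooth m) hH.1 htW)))
      (fun m => SmoothFunOn.mdifferentiableAt (hA.constraints.2.1 (e m)) hH.1 htW) h0 w
  rw [h1, ← h𝔛 u hu, push_eq_of_sub_mem_verticalKernel hL (hc.2 u hu ht),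
    canonicalForm_push_add_sum, h𝔛₀ u hu, hHam _ ⟨⟨u, hu, rfl⟩, htW⟩ w]
  refine congrArg _ (Finset.sum_congr rfl fun m _ => ?_)
  rw [hA.contraction m u htW w, mul_assoc]

end Adapted

end SingularLagrangian

namespace SingularLagrangian

/-! ### Bases adapted to a subspace -/

section Linear

variable {V : Type*} [AddCommGroup V] [Module ℝ V] [FiniteDimensional ℝ V]

theorem exists_basis_extending {N r : ℕ} (hV : Module.finrank ℝ V = N) {K : Submodule ℝ V}
    (hK : Module.finrank ℝ K = r) :
    ∃ (b : Module.Basis (Fin N) ℝ V) (e : Fin r ↪ Fin N), ∀ m, b (e m) ∈ K := by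
  obtain ⟨K', hK'⟩ := K.exists_isCompl
  have h1 := Submodule.finrank_add_eq_of_isCompl hK'
  obtain ⟨r', hr'⟩ : ∃ r', Module.finrank ℝ K' = r' := ⟨_, rfl⟩
  have h2 : r + r' = N := by omega
  let bK := Module.finBasisOfFinrankEq ℝ K hK
  let bK' := Module.finBasisOfFinrankEq ℝ K' hr'
  let i : Fin r ⊕ Fin r' ≃ Fin N := finSumFinEquiv.trans (finCongr h2)
  refine ⟨((bK.prod bK').map (Submodule.prodEquivOfIsCompl K K' hK')).reindex i,
    Function.Embedding.inl.trans i.toEmbedding, fun m => ?_⟩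
  have h3 : (((bK.prod bK').map (Submodule.prodEquivOfIsCompl K K' hK')).reindex i)
      ((Function.Embedding.inl.trans i.toEmbedding) m) = bK m := by
    simp [i]
  rw [h3]
  exact (bK m).2

/-- Vectors of `K` that are independent modulo `G ≤ K` span `K` modulo `G`, by dimension. -/
theorem sup_span_eq_of_finrank {N r : ℕ} {G K : Submodule ℝ V} (hGK : G ≤ K)
    (hG : Module.finrank ℝ G = N) (hK : Module.finrank ℝ K = N + r) {p : Fin r → V}
    (hp : ∀ m, p m ∈ K) (hind : LinearIndependent ℝ fun m => G.mkQ (p m)) :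
    G ⊔ Submodule.span ℝ (range p) = K := by
  have hle : Submodule.span ℝ (range p) ≤ K := Submodule.span_le.2 (by
    rintro _ ⟨m, rfl⟩
    exact hp m)
  have hp' : LinearIndependent ℝ p := LinearIndependent.of_comp G.mkQ hind
  have hspan := finrank_span_eq_card hp'
  rw [Fintype.card_fin] at hspan
  have hdisj : G ⊓ Submodule.span ℝ (range p) = ⊥ := by
    rw [Submodule.eq_bot_iff]
    rintro x ⟨hxG, hxp⟩
    obtain ⟨c, rfl⟩ := (Submodule.mem_span_range_iff_exists_fun ℝ).1 hxp
    have h1 : ∑ m, c m • G.mkQ (p m) = 0 := by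
      have h2 : G.mkQ (∑ m, c m • p m) = 0 := by
        rw [Submodule.mkQ_apply, Submodule.Quotient.mk_eq_zero]
        exact hxG
      rwa [map_sum] at h2
    exact Finset.sum_eq_zero fun m _ => by
      rw [Fintype.linearIndependent_iff.1 hind c h1 m, zero_smul]
  have h3 := Submodule.finrank_sup_add_finrank_inf_eq G (Submodule.span ℝ (range p))
  rw [hdisj, finrank_bot, hG, hspan] at h3
  exact Submodule.eq_of_le_of_finrank_eq (sup_le hGK hle) (by omega)

/-- A subspace that contains the kernel of a map has the dimension of the kernel plus that of its
image. -/
theorem finrank_eq_finrank_ker_add_finrank_map {V' : Type*} [AddCommGroup V'] [Module ℝ V']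
    {A : V →ₗ[ℝ] V'} {K : Submodule ℝ V} (hK : LinearMap.ker A ≤ K) :
    Module.finrank ℝ K = Module.finrank ℝ (LinearMap.ker A) + Module.finrank ℝ (K.map A) := by
  have h1 := (A.domRestrict K).finrank_range_add_finrank_ker
  rw [LinearMap.range_domRestrict, LinearMap.ker_domRestrict] at h1
  have h2 := (Submodule.submoduleOfEquivOfLe hK).finrank_eq
  rw [← h2, ← h1, add_comm]
  rfl

end Linear

/-! ### The matrix of brackets of the constraints -/

section Brackets

variable {V' : Type*} [NormedAddCommGroup V'] [NormedSpace ℝ V'] {N : ℕ}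

/-- The matrix `f_n(♯ f_n')` of a family of covectors, as a linear map. -/
noncomputable def bracketMap (sharp : (V' →L[ℝ] ℝ) →L[ℝ] V') (f : Fin N → V' →L[ℝ] ℝ) :
    (Fin N → ℝ) →L[ℝ] (Fin N → ℝ) :=
  ∑ n', ContinuousLinearMap.smulRightL ℝ (Fin N → ℝ) (Fin N → ℝ) (ContinuousLinearMap.proj n')
    fun n => f n (sharp (f n'))

theorem bracketMap_apply (sharp : (V' →L[ℝ] ℝ) →L[ℝ] V') (f : Fin N → V' →L[ℝ] ℝ)
    (z : Fin N → ℝ) (n : Fin N) : bracketMap sharp f z n = f n (sharp (∑ n', z n' • f n')) := by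
  simp [bracketMap, map_sum]

theorem sum_smul_covector_apply (f : Fin N → V' →L[ℝ] ℝ) (z : Fin N → ℝ) (w : V') :
    (∑ n, z n • f n) w = ∑ n, z n * f n w := by
  rw [sum_apply]
  rfl

/-- The linear combinations of the vectors `♯ f_n`. -/
noncomputable def sharpComb (sharp : (V' →L[ℝ] ℝ) →L[ℝ] V') (f : Fin N → V' →L[ℝ] ℝ) :
    (Fin N → ℝ) →ₗ[ℝ] V' :=
  (sharp : (V' →L[ℝ] ℝ) →ₗ[ℝ] V') ∘ₗ Fintype.linearCombination ℝ f

theorem sharpComb_apply (sharp : (V' →L[ℝ] ℝ) →L[ℝ] V') (f : Fin N → V' →L[ℝ] ℝ)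
    (z : Fin N → ℝ) : sharpComb sharp f z = sharp (∑ n, z n • f n) :=
  rfl

theorem linearIndependent_covectors {f : Fin N → V' →L[ℝ] ℝ} (hf : LinearIndependent ℝ f)
    {z : Fin N → ℝ} (hz : ∀ w, ∑ n, z n * f n w = 0) : z = 0 :=
  funext (Fintype.linearIndependent_iff.1 hf z (ContinuousLinearMap.ext fun w => by
    rw [sum_smul_covector_apply, hz w]
    rfl))

theorem contDiffOn_bracketMap {S : Type*} [NormedAddCommGroup S] [NormedSpace ℝ S]
    (sharp : (V' →L[ℝ] ℝ) →L[ℝ] V') {f : Fin N → S → V' →L[ℝ] ℝ} {O : Set S}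
    (hf : ∀ n, ContDiffOn ℝ ∞ (f n) O) :
    ContDiffOn ℝ ∞ (fun s => bracketMap sharp fun n => f n s) O :=
  ContDiffOn.sum fun n' _ => (ContinuousLinearMap.contDiff _).comp_contDiffOn
    (contDiffOn_pi.2 fun n => (hf n).clm_apply (sharp.contDiff.comp_contDiffOn (hf n')))

end Brackets

section Symplectic

variable {E V : Type*} [NormedAddCommGroup E] [NormedSpace ℝ E] [FiniteDimensional ℝ E]
  [NormedAddCommGroup V] [NormedSpace ℝ V] [FiniteDimensional ℝ V] {N : ℕ}

theorem eq_stdSharp_of_stdForm_eq {X : E × (E →L[ℝ] ℝ)} {α : E × (E →L[ℝ] ℝ) →L[ℝ] ℝ}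
    (h : ∀ Y, stdForm X Y = α Y) : X = stdSharp α := by
  refine sub_eq_zero.1 (eq_zero_of_stdForm_eq_zero fun Y => ?_)
  rw [stdForm_sub_left, h, stdForm_stdSharp, sub_self]

/-- The dimension of the kernel of the pullback of the symplectic form to a constraint surface is
determined by the kernel of the matrix of brackets of the constraints. -/
theorem finrank_ker_pullback {A : V →L[ℝ] E × (E →L[ℝ] ℝ)} {f : Fin N → E × (E →L[ℝ] ℝ) →L[ℝ] ℝ}
    (hf : LinearIndependent ℝ f) (hA : ∀ n v, f n (A v) = 0)
    (hrange : ∀ w, (∀ n, f n w = 0) → ∃ v, A v = w)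
    (hN : Module.finrank ℝ (LinearMap.ker (A : V →ₗ[ℝ] E × (E →L[ℝ] ℝ))) = N)
    {K : Submodule ℝ V} (hK : ∀ v, v ∈ K ↔ ∀ v', stdForm (A v) (A v') = 0) :
    Module.finrank ℝ K = N + Module.finrank ℝ
      (LinearMap.ker (bracketMap stdSharp f : (Fin N → ℝ) →ₗ[ℝ] (Fin N → ℝ))) := by
  let Θ : (Fin N → ℝ) →ₗ[ℝ] E × (E →L[ℝ] ℝ) := sharpComb stdSharp f
  have hΘ : ∀ z, Θ z = stdSharp (∑ n, z n • f n) := sharpComb_apply stdSharp f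
  have hΘform : ∀ z Y, stdForm (Θ z) Y = ∑ n, z n * f n Y := fun z Y => by
    rw [hΘ, stdForm_stdSharp, sum_smul_covector_apply]
  have hΘinj : Function.Injective Θ := by
    refine (injective_iff_map_eq_zero Θ).2 fun z hz => linearIndependent_covectors hf fun Y => ?_
    rw [← hΘform, hz]
    simp [stdForm]
  -- Let T be the image of A. The image of K is T ∩ T^ω, and T^ω consists of the vectors ♯(∑ c_n
  -- f_n). Such a vector lies in T exactly when every f_n kills it, i.e. when c is in the kernel of
  -- the bracket matrix.
  have hmap : K.map (A : V →ₗ[ℝ] E × (E →L[ℝ] ℝ)) =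
      (LinearMap.ker (bracketMap stdSharp f : (Fin N → ℝ) →ₗ[ℝ] (Fin N → ℝ))).map Θ := by
    ext X
    constructor
    · rintro ⟨v, hv, rfl⟩
      obtain ⟨c, hc⟩ := exists_eq_add_sum_of_commonKer_le (f := f) (α := 0) (X := A v) (by
        intro w hw
        obtain ⟨v', rfl⟩ := hrange w hw
        exact (hK v).1 hv v')
      have h1 : A v = Θ c := (eq_stdSharp_of_stdForm_eq (α := ∑ n, c n • f n) fun Y => by
        rw [hc Y, zero_apply, zero_add, sum_smul_covector_apply]).trans (hΘ c).symm
      refine ⟨c, LinearMap.mem_ker.2 (funext fun n => ?_), h1.symm⟩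
      rw [ContinuousLinearMap.coe_coe, bracketMap_apply, ← hΘ, ← h1]
      exact hA n v
    · rintro ⟨c, hc, rfl⟩
      obtain ⟨v, hv⟩ := hrange (Θ c) fun n => by
        rw [hΘ, ← bracketMap_apply]
        exact congrFun hc n
      refine ⟨v, (hK v).2 fun v' => ?_, hv⟩
      rw [hv, hΘform]
      exact Finset.sum_eq_zero fun n _ => by rw [hA, mul_zero]
  have hker : LinearMap.ker (A : V →ₗ[ℝ] E × (E →L[ℝ] ℝ)) ≤ K := fun v hv => (hK v).2 fun v' => by
    have : A v = 0 := hv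
    rw [this]
    simp [stdForm]
  rw [finrank_eq_finrank_ker_add_finrank_map hker, hN, hmap]
  exact congrArg _ (Submodule.equivMapOfInjective Θ hΘinj _).finrank_eq.symm

end Symplectic

/-! ### Constraints adapted to the kernel of the bracket matrix -/

section Adapted

variable {V' : Type*} [NormedAddCommGroup V'] [NormedSpace ℝ V'] {N r : ℕ}

/-- Independent constraints with a bracket matrix of constant rank can be recombined so that some
of them have vanishing brackets with all constraints. -/
theorem exists_adapted_constraints (sharp : (V' →L[ℝ] ℝ) →L[ℝ] V') {g : Fin N → V' → ℝ}
    {O T : Set V'} (hO : IsOpen O) (hg : ∀ n, ContDiffOn ℝ ∞ (g n) O) {y₀ : V'} (hy₀ : y₀ ∈ O)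
    (hy₀T : y₀ ∈ T) (hzero : ∀ y ∈ O ∩ T, ∀ n, g n y = 0)
    (hind : ∀ y ∈ O ∩ T, LinearIndependent ℝ fun n => fderiv ℝ (g n) y)
    (hr : ∀ y ∈ O ∩ T, Module.finrank ℝ (LinearMap.ker (bracketMap sharp
      (fun n => fderiv ℝ (g n) y) : (Fin N → ℝ) →ₗ[ℝ] (Fin N → ℝ))) = r) :
    ∃ (U : Set V') (G : Fin N → V' → ℝ) (e : Fin r ↪ Fin N), IsOpen U ∧ y₀ ∈ U ∧ U ⊆ O ∧
      (∀ i, ContDiffOn ℝ ∞ (G i) U) ∧ (∀ y ∈ U, (∀ i, G i y = 0) ↔ ∀ n, g n y = 0) ∧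
      ∀ y ∈ U ∩ T, LinearIndependent ℝ (fun i => fderiv ℝ (G i) y) ∧
        ∀ m n, fderiv ℝ (g n) y (sharp (fderiv ℝ (G (e m)) y)) = 0 := by
  have hdg : ∀ n, ContDiffOn ℝ ∞ (fderiv ℝ (g n)) O := fun n =>
    (hg n).fderiv_of_isOpen hO (by simp)
  -- The new constraints are G_i = ∑_j (Z b_i)_j g_j, where the basis b contains r vectors of the
  -- kernel of the bracket matrix at y₀ and Z transports them. Z b_{e m} remains in the kernel at
  -- points of T, where the rank is constant; off T nothing is claimed.
  obtain ⟨U, Z, hU, hyU, hUO, hZ, hZ0, hZker⟩ := exists_kernel_transport hO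
    (contDiffOn_bracketMap sharp hdg) hy₀
  obtain ⟨b, e, hbe⟩ := exists_basis_extending (V := Fin N → ℝ) (Module.finrank_fin_fun ℝ)
    (hr y₀ ⟨hy₀, hy₀T⟩)
  have hT : ∀ i j, ContDiffOn ℝ ∞ (fun y => Z y (b i) j) U := fun i j =>
    contDiffOn_pi.1 (hZ.clm_apply contDiffOn_const) j
  have hcomb : ∀ (y : V') (t : Fin N → ℝ) (h : Fin N → ℝ),
      ∑ i, t i * ∑ j, Z y (b i) j * h j = ∑ j, Z y (∑ i, t i • b i) j * h j := by
    intro y t h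
    simp only [Finset.mul_sum, map_sum, map_smul, Finset.sum_apply, Pi.smul_apply, smul_eq_mul,
      Finset.sum_mul]
    rw [Finset.sum_comm]
    simp only [mul_assoc]
  -- On T the g_j vanish, so the derivatives of the variable coefficients drop out.
  have hfderiv : ∀ y ∈ U ∩ T, ∀ i, fderiv ℝ (fun y => ∑ j, Z y (b i) j * g j y) y =
      ∑ j, Z y (b i) j • fderiv ℝ (g j) y := by
    intro y hy i
    have h1 : HasFDerivAt (fun y => ∑ j, Z y (b i) j * g j y) _ y :=
      HasFDerivAt.fun_sum (u := Finset.univ) fun j _ =>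
        ((((hT i j).contDiffAt (hU.mem_nhds hy.1)).differentiableAt (by simp)).hasFDerivAt).mul
          ((((hg j).contDiffAt (hO.mem_nhds (hUO hy.1))).differentiableAt (by simp)).hasFDerivAt)
    rw [h1.fderiv]
    refine Finset.sum_congr rfl fun j _ => ?_
    rw [hzero y ⟨hUO hy.1, hy.2⟩ j, zero_smul, add_zero]
  refine ⟨U, fun i y => ∑ j, Z y (b i) j * g j y, e, hU, hyU, hUO, fun i =>
    ContDiffOn.sum fun j _ => (hT i j).mul ((hg j).mono hUO), fun y hy => ⟨fun h => ?_, fun h i =>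
      Finset.sum_eq_zero fun j _ => by rw [h j, mul_zero]⟩, fun y hy => ⟨?_, fun m n => ?_⟩⟩
  -- Since Z is invertible, the Z b_i still form a basis, so the recombined constraints have the
  -- same common zeros. The next item derives independence of their differentials in the same way.
  · have hinv := (hZker y hy).1
    have h1 : ∀ v : Fin N → ℝ, ∑ j, v j * g j y = 0 := by
      intro v
      have h2 := hcomb y (b.repr ((Z y).inverse v)) fun j => g j y
      rw [b.sum_repr, hinv.self_apply_inverse] at h2
      rw [← h2]
      exact Finset.sum_eq_zero fun i _ => mul_eq_zero_of_right _ (h i)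
    intro n
    have h2 := h1 (Pi.single n 1)
    simpa [Pi.single_apply] using h2
  · have hinv := (hZker y hy.1).1
    rw [Fintype.linearIndependent_iff]
    intro t ht
    simp only [hfderiv y hy] at ht
    have h1 : ∑ j, Z y (∑ i, t i • b i) j • fderiv ℝ (g j) y = 0 := by
      refine ContinuousLinearMap.ext fun w => ?_
      have h2 := congrArg (fun A : V' →L[ℝ] ℝ => A w) ht
      simp only [sum_apply, smul_apply, smul_eq_mul, zero_apply] at h2 ⊢
      rw [← hcomb, h2]
    have h2 : Z y (∑ i, t i • b i) = 0 :=
      funext (Fintype.linearIndependent_iff.1 (hind y ⟨hUO hy.1, hy.2⟩) _ h1)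
    have h3 : ∑ i, t i • b i = 0 := by
      rw [← hinv.inverse_apply_self (∑ i, t i • b i), h2, map_zero]
    exact Fintype.linearIndependent_iff.1 b.linearIndependent t h3
  · rw [hfderiv y hy, ← bracketMap_apply sharp (fun n => fderiv ℝ (g n) y)]
    exact congrFun ((hZker y hy.1).2 ((hr y ⟨hUO hy.1, hy.2⟩).trans
      (hr y₀ ⟨hy₀, hy₀T⟩).symm) _ (hbe m)) n

end Adapted

/-! ### Smooth lifts -/

section Lift

variable {E : Type*} [NormedAddCommGroup E] [InnerProductSpace ℝ E] [FiniteDimensional ℝ E] {N : ℕ}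

/-- A symmetric form `M` with kernel spanned by `z_n`, made nondegenerate. -/
noncomputable def regularize (M : E →L[ℝ] E →L[ℝ] ℝ) (z : Fin N → E) : E →L[ℝ] E →L[ℝ] ℝ :=
  M + ∑ n, (innerSL ℝ (z n)).smulRight (innerSL ℝ (z n))

theorem regularize_apply (M : E →L[ℝ] E →L[ℝ] ℝ) (z : Fin N → E) (b c : E) :
    regularize M z b c = M b c + inner ℝ (∑ n, inner ℝ (z n) b • z n) c := by
  simp [regularize, sum_inner, inner_smul_left]

/-- A linear combination of the z_k that is orthogonal to every z_k has zero norm. -/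
theorem sum_inner_smul_eq_zero {z : Fin N → E} {b : E}
    (h : ∀ k, inner ℝ (∑ n, inner ℝ (z n) b • z n) (z k) = 0) :
    ∑ n, inner ℝ (z n) b • z n = 0 := by
  refine inner_self_eq_zero (𝕜 := ℝ).1 ?_
  rw [inner_sum]
  exact Finset.sum_eq_zero fun k _ => by rw [inner_smul_right, h k, mul_zero]

/-- If the regularized form kills b, pairing with the z_k removes M and shows that the added part
vanishes on b; by independence b is orthogonal to all z_k. Then M b = 0, so b is also in the span of
the z_k, hence zero. -/
theorem regularize_isInvertible {M : E →L[ℝ] E →L[ℝ] ℝ} {z : Fin N → E}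
    (hz : LinearIndependent ℝ z) (hMz : ∀ b n, M b (z n) = 0)
    (hspan : ∀ b, M b = 0 → b ∈ Submodule.span ℝ (range z)) :
    (regularize M z).IsInvertible := by
  have hinj : Function.Injective (regularize M z) := by
    refine (injective_iff_map_eq_zero _).2 fun b hb => ?_
    have hb' : ∀ c, M b c + inner ℝ (∑ n, inner ℝ (z n) b • z n) c = 0 := fun c => by
      rw [← regularize_apply, hb]
      rfl
    have h1 : ∑ n, inner ℝ (z n) b • z n = 0 := sum_inner_smul_eq_zero fun k => by
      rw [← hb' (z k), hMz, zero_add]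
    have h2 := Fintype.linearIndependent_iff.1 hz _ h1
    have h3 : M b = 0 := ContinuousLinearMap.ext fun c => by
      have h3 := hb' c
      rwa [h1, inner_zero_left, add_zero] at h3
    obtain ⟨c, rfl⟩ := (Submodule.mem_span_range_iff_exists_fun ℝ).1 (hspan b h3)
    refine inner_self_eq_zero (𝕜 := ℝ).1 ?_
    rw [sum_inner]
    exact Finset.sum_eq_zero fun k _ => by rw [inner_smul_left, h2 k, mul_zero]
  have hdim : Module.finrank ℝ E = Module.finrank ℝ (E →L[ℝ] ℝ) := by
    rw [← (LinearMap.toContinuousLinearMap : (E →ₗ[ℝ] ℝ) ≃ₗ[ℝ] (E →L[ℝ] ℝ)).finrank_eq]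
    exact Subspace.dual_finrank_eq.symm
  exact ⟨(LinearEquiv.ofInjectiveOfFinrankEq (regularize M z : E →ₗ[ℝ] (E →L[ℝ] ℝ)) hinj
    hdim).toContinuousLinearEquiv, by ext; rfl⟩

/-- For a covector annihilating the z_k, the solution of the regularized equation makes the added
term vanish, so it already solves the equation for M. Solutions of a degenerate equation thus depend
smoothly on the data. -/
theorem apply_inverse_regularize {M : E →L[ℝ] E →L[ℝ] ℝ} {z : Fin N → E}
    (hinv : (regularize M z).IsInvertible) (hMz : ∀ b n, M b (z n) = 0) {η : E →L[ℝ] ℝ}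
    (hη : ∀ n, η (z n) = 0) : M ((regularize M z).inverse η) = η := by
  set b := (regularize M z).inverse η with hb
  have h1 : ∀ c, M b c + inner ℝ (∑ n, inner ℝ (z n) b • z n) c = η c := fun c => by
    rw [← regularize_apply, hb, hinv.self_apply_inverse]
  have h2 : ∑ n, inner ℝ (z n) b • z n = 0 := sum_inner_smul_eq_zero fun k => by
    rw [← hη k, ← h1, hMz, zero_add]
  refine ContinuousLinearMap.ext fun c => ?_
  rw [← h1 c, h2, inner_zero_left, add_zero]

/-- Smooth lifts along the differential of a fibre derivative with constant rank. -/
theorem exists_smooth_lift {A : E × E → E × E →L[ℝ] E × (E →L[ℝ] ℝ)} {O : Set (E × E)}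
    (hA : ContDiffOn ℝ ∞ A O) (hfst : ∀ x ∈ O, ∀ c, (A x c).1 = c.1)
    (hsymm : ∀ x ∈ O, ∀ b b', (A x (0, b)).2 b' = (A x (0, b')).2 b) {z : Fin N → E × E → E}
    (hz : ∀ n, ContDiffOn ℝ ∞ (z n) O) (hind : ∀ x ∈ O, LinearIndependent ℝ fun n => z n x)
    (hAz : ∀ x ∈ O, ∀ n, A x (0, z n x) = 0)
    (hN : ∀ x ∈ O, Module.finrank ℝ (LinearMap.ker (A x : E × E →ₗ[ℝ] E × (E →L[ℝ] ℝ))) = N)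
    {S : E × E → E × (E →L[ℝ] ℝ)} (hS : ContDiffOn ℝ ∞ S O) (hSA : ∀ x ∈ O, ∃ c, A x c = S x) :
    ∃ P : E × E → E × E, ContDiffOn ℝ ∞ P O ∧ ∀ x ∈ O, A x (P x) = S x := by
  let M : E × E → E →L[ℝ] E →L[ℝ] ℝ := fun x => (ContinuousLinearMap.snd ℝ E (E →L[ℝ] ℝ)).comp
    ((A x).comp (ContinuousLinearMap.inr ℝ E E))
  have hM : ContDiffOn ℝ ∞ M O := contDiffOn_const.clm_comp (hA.clm_comp contDiffOn_const)
  have hMapply : ∀ x b, M x b = (A x (0, b)).2 := fun x b => rfl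
  have hMz : ∀ x ∈ O, ∀ b n, M x b (z n x) = 0 := fun x hx b n => by
    rw [hMapply, hsymm x hx, hAz x hx]
    rfl
  have hspan : ∀ x ∈ O, ∀ b, M x b = 0 → b ∈ Submodule.span ℝ (range fun n => z n x) := by
    intro x hx b hb
    have h1 : (Submodule.span ℝ (range fun n => z n x)).map (LinearMap.inr ℝ E E) ≤
        LinearMap.ker (A x : E × E →ₗ[ℝ] E × (E →L[ℝ] ℝ)) := by
      rw [Submodule.map_span, Submodule.span_le]
      rintro _ ⟨_, ⟨n, rfl⟩, rfl⟩
      exact hAz x hx n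
    have h2 := Submodule.eq_of_le_of_finrank_eq h1 (by
      rw [hN x hx, ← (Submodule.equivMapOfInjective _ LinearMap.inr_injective _).finrank_eq,
        finrank_span_eq_card (hind x hx), Fintype.card_fin])
    have h3 : ((0, b) : E × E) ∈ LinearMap.ker (A x : E × E →ₗ[ℝ] E × (E →L[ℝ] ℝ)) :=
      LinearMap.mem_ker.2 (Prod.ext (hfst x hx _) hb)
    rw [← h2] at h3
    obtain ⟨b', hb', heq⟩ := h3
    obtain rfl : b' = b := congrArg Prod.snd heq
    exact hb'
  have hinv : ∀ x ∈ O, (regularize (M x) fun n => z n x).IsInvertible := fun x hx =>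
    regularize_isInvertible (hind x hx) (hMz x hx) (hspan x hx)
  have hK : ContDiffOn ℝ ∞ (fun x => regularize (M x) fun n => z n x) O :=
    hM.add (ContDiffOn.sum fun n _ =>
      (((innerSL ℝ).contDiff.comp_contDiffOn (hz n)).smulRight
        ((innerSL ℝ).contDiff.comp_contDiffOn (hz n))))
  have hS1 : ContDiffOn ℝ ∞ (fun x => (S x).1) O := contDiff_fst.comp_contDiffOn hS
  have hη : ContDiffOn ℝ ∞ (fun x => (S x).2 - (A x ((S x).1, 0)).2) O :=
    (contDiff_snd.comp_contDiffOn hS).sub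
      (contDiff_snd.comp_contDiffOn (hA.clm_apply (hS1.prodMk contDiffOn_const)))
  -- The base component of the lift is forced to be that of S. The vertical component b must solve M
  -- b = S.2 - A(S.1, 0).2, whose right side annihilates ker M because some lift exists.
  refine ⟨fun x => ((S x).1, (regularize (M x) fun n => z n x).inverse
    ((S x).2 - (A x ((S x).1, 0)).2)), hS1.prodMk ((contDiffOn_inverse hK hinv).clm_apply hη), ?_⟩
  intro x hx
  have hsplit : ∀ a b, A x (a, b) = A x (a, 0) + A x (0, b) := fun a b => by
    rw [← map_add, Prod.mk_add_mk, add_zero, zero_add]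
  obtain ⟨⟨a, b⟩, hab⟩ := hSA x hx
  have ha : (S x).1 = a := by rw [← hab, hfst x hx]
  have h1 : (S x).2 - (A x ((S x).1, 0)).2 = M x b := by
    rw [ha, ← hab, hsplit, Prod.snd_add, add_sub_cancel_left, hMapply]
  have h2 := apply_inverse_regularize (hinv x hx) (hMz x hx)
    (η := (S x).2 - (A x ((S x).1, 0)).2) fun n => by rw [h1, hMz x hx]
  refine Prod.ext (hfst x hx _) ?_
  rw [hsplit, Prod.snd_add, ← hMapply, h2, add_sub_cancel]

end Lift

end SingularLagrangian

/-! ### Independence of covectors and of their symplectic duals -/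

namespace SingularLagrangian

section Independence

variable {T V' : Type*} [NormedAddCommGroup T] [NormedSpace ℝ T] [NormedAddCommGroup V']
  [NormedSpace ℝ V'] {N : ℕ} {f : Fin N → T →L[ℝ] ℝ} {φ : Fin N → V' →L[ℝ] ℝ} {B : T → V'}

theorem linearIndependent_of_forall_apply_eq (hf : LinearIndependent ℝ f)
    (h : ∀ n w, f n w = φ n (B w)) : LinearIndependent ℝ φ := by
  rw [Fintype.linearIndependent_iff]
  intro t ht
  refine congrFun (linearIndependent_covectors hf (z := t) fun w => ?_)
  simp only [h]
  rw [← sum_smul_covector_apply, ht]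
  rfl

theorem linearIndependent_of_surjective (hφ : LinearIndependent ℝ φ) (hB : Function.Surjective B)
    (h : ∀ n w, f n w = φ n (B w)) : LinearIndependent ℝ f := by
  rw [Fintype.linearIndependent_iff]
  intro t ht
  refine congrFun (linearIndependent_covectors hφ (z := t) fun y => ?_)
  obtain ⟨w, rfl⟩ := hB y
  simp only [← h]
  rw [← sum_smul_covector_apply, ht]
  rfl

theorem linearIndependent_mkQ_of_map {V W ι : Type*} [AddCommGroup V] [Module ℝ V]
    [AddCommGroup W] [Module ℝ W] {A : V →ₗ[ℝ] W} {G : Submodule ℝ V} (hG : G ≤ LinearMap.ker A)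
    {p : ι → V} {q : ι → W} (hq : LinearIndependent ℝ q) (h : ∀ i, A (p i) = q i) :
    LinearIndependent ℝ fun i => G.mkQ (p i) := by
  refine LinearIndependent.of_comp (G.liftQ A hG) ?_
  have : (G.liftQ A hG) ∘ (fun i => G.mkQ (p i)) = q := funext h
  rwa [this]

variable {E : Type*} [NormedAddCommGroup E] [NormedSpace ℝ E] [FiniteDimensional ℝ E]

theorem stdSharp_injective : Function.Injective (stdSharp (E := E)) := by
  intro α β h
  refine ContinuousLinearMap.ext fun Y => ?_
  rw [← stdForm_stdSharp α Y, h, stdForm_stdSharp]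

theorem linearIndependent_sharp {r : ℕ} {sharp : (V' →L[ℝ] ℝ) →L[ℝ] V'}
    (hsharp : Function.Injective sharp) (hφ : LinearIndependent ℝ φ) (e : Fin r ↪ Fin N) :
    LinearIndependent ℝ fun m => sharp (φ (e m)) :=
  (hφ.comp e e.injective).map' (sharp : (V' →L[ℝ] ℝ) →ₗ[ℝ] V') (LinearMap.ker_eq_bot.2 hsharp)

theorem contDiffOn_sharp_comp {M : Type*} [NormedAddCommGroup M] [NormedSpace ℝ M]
    (sharp : (V' →L[ℝ] ℝ) →L[ℝ] V') {f : M → V' →L[ℝ] ℝ} {O : Set M} (hf : ContDiffOn ℝ ∞ f O) :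
    ContDiffOn ℝ ∞ (fun x => sharp (f x)) O :=
  sharp.contDiff.comp_contDiffOn hf

theorem contDiffOn_stdSharp_comp {M : Type*} [NormedAddCommGroup M] [NormedSpace ℝ M]
    {f : M → E × (E →L[ℝ] ℝ) →L[ℝ] ℝ} {O : Set M} (hf : ContDiffOn ℝ ∞ f O) :
    ContDiffOn ℝ ∞ (fun x => stdSharp (f x)) O :=
  contDiffOn_sharp_comp stdSharp hf

theorem linearIndependent_stdSharp {r : ℕ} {f : Fin N → E × (E →L[ℝ] ℝ) →L[ℝ] ℝ}
    (hf : LinearIndependent ℝ f) (e : Fin r ↪ Fin N) :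
    LinearIndependent ℝ fun m => stdSharp (f (e m)) :=
  linearIndependent_sharp stdSharp_injective hf e

/-- The base component of ♯f_n is the restriction of f_n to momentum directions, seen as an element
of the bidual. For constraints these are the gradients ∂γ_n/∂p. -/
theorem linearIndependent_stdSharp_fst {f : Fin N → E × (E →L[ℝ] ℝ) →L[ℝ] ℝ}
    (hf : LinearIndependent ℝ fun n => (f n).comp (ContinuousLinearMap.inr ℝ E (E →L[ℝ] ℝ))) :
    LinearIndependent ℝ fun n => (stdSharp (f n)).1 := by
  rw [Fintype.linearIndependent_iff]
  intro t ht
  refine congrFun (linearIndependent_covectors hf (z := t) fun η => ?_)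
  have h : ∀ n, ((f n).comp (ContinuousLinearMap.inr ℝ E (E →L[ℝ] ℝ))) η = η (stdSharp (f n)).1 :=
    fun n => (apply_stdSharp_fst (f n) η).symm
  simp only [h]
  rw [← map_zero η, ← ht, map_sum]
  simp only [map_smul, smul_eq_mul]

end Independence

variable {D : ℕ} {Q : Type*} [TopologicalSpace Q] [ChartedSpace (Coord D) Q]
  [IsManifold (𝓡 D) ∞ Q] {L : VelocitySpace D Q → ℝ}

/-! ### Existence of adapted systems -/

theorem dC_comp_chart {s₀ s : PhaseSpace D Q} (hs : s.1 ∈ (chartAt (Coord D) s₀.1).source)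
    {G : Coord D × (Coord D →L[ℝ] ℝ) → ℝ}
    (hG : DifferentiableAt ℝ G (extChartAt (modelC D) s₀ s)) (w : TC s) :
    dC (G ∘ extChartAt (modelC D) s₀) s w =
      fderiv ℝ G (extChartAt (modelC D) s₀ s) (coordC s₀ s w) := by
  rw [dC, mfderiv_comp s hG.mdifferentiableAt
    (mdifferentiableAt_extChartAt_of_mem (modelC D) (mem_extChartAt_source_C.2 hs)),
    mfderiv_eq_fderiv]
  rfl

/-- ker Ω_L is the kernel of the pullback of ω and has dimension N plus that of the kernel of the
bracket matrix. The hypothesis on ker Ω_L therefore makes the bracket matrix of constant rank along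
the primary surface. -/
theorem finrank_ker_bracketMap (hL : ContMDiff (modelL D) 𝓘(ℝ, ℝ) ∞ L) {N r : ℕ}
    (hN : ∀ u, Module.finrank ℝ (kerHessian L u) = N)
    (hr : ∀ u, Module.finrank ℝ (kerForm L u) = N + r) {W : Set (PhaseSpace D Q)}
    {γ : Fin N → PhaseSpace D Q → ℝ} (hγ : IsDefiningSystem (primarySurface L) W γ)
    {u₀ u : VelocitySpace D Q} (hu : u.1 ∈ (chartAt (Coord D) u₀.1).source)
    (huW : fibreDerivative L u ∈ W) :
    Module.finrank ℝ (LinearMap.ker (bracketMap stdSharp (fun n => fderiv ℝ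
      (γ n ∘ (extChartAt (modelC D) (fibreDerivative L u₀)).symm)
        (extChartAt (modelC D) (fibreDerivative L u₀) (fibreDerivative L u))) :
          (Fin N → ℝ) →ₗ[ℝ] (Fin N → ℝ))) = r := by
  have hbase : (fibreDerivative L u).1 ∈ (chartAt (Coord D) (fibreDerivative L u₀).1).source := hu
  have hd : ∀ n w, dC (γ n) (fibreDerivative L u) w = fderiv ℝ
      (γ n ∘ (extChartAt (modelC D) (fibreDerivative L u₀)).symm)
        (extChartAt (modelC D) (fibreDerivative L u₀) (fibreDerivative L u))
          (coordC (fibreDerivative L u₀) (fibreDerivative L u) w) := fun n w =>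
    dC_eq_fderiv hbase (SmoothFunOn.mdifferentiableAt (hγ.2.1 n) hγ.1 huW) w
  have hrange : ∀ w, (∀ n, fderiv ℝ (γ n ∘ (extChartAt (modelC D) (fibreDerivative L u₀)).symm)
      (extChartAt (modelC D) (fibreDerivative L u₀) (fibreDerivative L u)) w = 0) →
        ∃ v : TL u, coordC (fibreDerivative L u₀) (fibreDerivative L u) (push L u v) = w := by
    intro w hw
    obtain ⟨w', rfl⟩ := coordC_surjective hbase w
    obtain ⟨v, rfl⟩ := exists_push_eq hL hN hγ huW w' fun n => (hd n w').trans (hw n)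
    exact ⟨v, rfl⟩
  have hker : LinearMap.ker ((coordC (fibreDerivative L u₀) (fibreDerivative L u)).comp (push L u) :
      TL u →ₗ[ℝ] Coord D × (Coord D →L[ℝ] ℝ)) =
        LinearMap.ker (push L u : TL u →ₗ[ℝ] TC (fibreDerivative L u)) := by
    ext v
    constructor
    · intro hv
      have hv' : coordC (fibreDerivative L u₀) (fibreDerivative L u) (push L u v) = 0 := hv
      exact coordC_injective hbase (hv'.trans (coordC_zero _ _).symm)
    · intro hv
      have hv' : push L u v = 0 := hv
      exact (congrArg _ hv').trans (coordC_zero _ _)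
  have hK : ∀ v : TL u, v ∈ kerForm L u ↔ ∀ v' : TL u,
      stdForm (coordC (fibreDerivative L u₀) (fibreDerivative L u) (push L u v))
        (coordC (fibreDerivative L u₀) (fibreDerivative L u) (push L u v')) = 0 := by
    intro v
    constructor
    · intro hv v'
      have h1 : lagrangeForm L u v = 0 := hv
      have h2 := lagrangeForm_eq hL u v v'
      rw [h1, canonicalForm_eq_coordC hbase] at h2
      exact h2.symm
    · intro hv
      refine LinearMap.mem_ker.2 (ContinuousLinearMap.ext fun v' => ?_)
      refine (lagrangeForm_eq hL u v v').trans ?_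
      rw [canonicalForm_eq_coordC hbase]
      exact hv v'
  have hNker := congrArg (fun K : Submodule ℝ (TL u) => Module.finrank ℝ K) hker
  have h := finrank_ker_pullback (E := Coord D) (V := Coord D × Coord D)
    (A := (coordC (fibreDerivative L u₀) (fibreDerivative L u)).comp (push L u))
    (linearIndependent_of_forall_apply_eq (T := Coord D × (Coord D →L[ℝ] ℝ))
      (f := fun n => dC (γ n) (fibreDerivative L u)) (hγ.2.2.2 _ huW ⟨u, rfl⟩) hd)
    (fun n v => (hd n (push L u v)).symm.trans (dC_push_eq_zero hL hγ huW n v)) hrange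
    (hNker.trans (finrank_ker_push hL hN u)) (K := kerForm L u) hK
  have h' := (hr u).symm.trans h
  omega

/-- With z = ∂α/∂p one has (M z)(b) = (M b)(z) = α(0, M b) = α(d𝓛(0, b)) = 0. So the momentum
gradients of the constraints provide smooth elements of ker M. -/
theorem fderiv_localFibreDerivative_inr_eq_zero (hL : ContMDiff (modelL D) 𝓘(ℝ, ℝ) ∞ L)
    {u₀ : VelocitySpace D Q} {x : Coord D × Coord D} (hx : x ∈ (extChartAt (modelL D) u₀).target)
    {α : Coord D × (Coord D →L[ℝ] ℝ) →L[ℝ] ℝ}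
    (hα : ∀ c, α (fderiv ℝ (localFibreDerivative L u₀) x c) = 0) :
    fderiv ℝ (localFibreDerivative L u₀) x (0, (stdSharp α).1) = 0 := by
  have hfst : ∀ c, (fderiv ℝ (localFibreDerivative L u₀) x c).1 = c.1 := fun c => by
    rw [fderiv_localFibreDerivative_apply hL hx]
  refine Prod.ext (hfst _) (ContinuousLinearMap.ext fun b => ?_)
  rw [fderiv_localFibreDerivative_symm hL hx, apply_stdSharp_fst]
  refine Eq.trans ?_ (hα (0, b))
  exact congrArg α (Prod.ext (hfst (0, b)).symm rfl)

theorem mfderiv_comp_fibreDerivative_eq_zero (hL : ContMDiff (modelL D) 𝓘(ℝ, ℝ) ∞ L)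
    {F : Type*} [NormedAddCommGroup F] [NormedSpace ℝ F] {h : PhaseSpace D Q → F}
    {u : VelocitySpace D Q} (hh : MDifferentiableAt (modelC D) 𝓘(ℝ, F) h (fibreDerivative L u))
    {w : TL u} (hw : push L u w = 0) :
    mfderiv (modelL D) 𝓘(ℝ, F) (h ∘ fibreDerivative L) u w = 0 := by
  rw [mfderiv_comp u hh ((contMDiff_fibreDerivative hL).mdifferentiableAt (by simp))]
  refine (congrArg (mfderiv (modelC D) 𝓘(ℝ, F) h (fibreDerivative L u)) hw).trans ?_
  exact ContinuousLinearMap.map_zero _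

end SingularLagrangian

/-! ### Lifting tangent fields of the primary surface, and adapted systems -/

namespace SingularLagrangian

variable {D : ℕ} {Q : Type*} [TopologicalSpace Q] [ChartedSpace (Coord D) Q]
  [IsManifold (𝓡 D) ∞ Q] {L : VelocitySpace D Q → ℝ}

/-- A field whose chart coordinates are prescribed on the domain of the bundle chart. -/
theorem exists_field_of_coordinates (u₀ : VelocitySpace D Q)
    (P : Coord D × Coord D → Coord D × Coord D) :
    ∃ X : VectorFieldL D Q, ∀ u, u.1 ∈ (chartAt (Coord D) u₀.1).source →
      coordL u₀ u (X u) = P (extChartAt (modelL D) u₀ u) := by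
  have h : ∀ u : VelocitySpace D Q, ∃ w : TL u, u.1 ∈ (chartAt (Coord D) u₀.1).source →
      coordL u₀ u w = P (extChartAt (modelL D) u₀ u) := by
    intro u
    by_cases hu : u.1 ∈ (chartAt (Coord D) u₀.1).source
    · obtain ⟨w, hw⟩ := coordL_surjective hu (P (extChartAt (modelL D) u₀ u))
      exact ⟨w, fun _ => hw⟩
    · exact ⟨0, fun hu' => absurd hu' hu⟩
  choose X hX using h
  exact ⟨X, hX⟩

/-- Smooth families of tangent vectors of the primary constraint surface, given in a bundle chart as
functions on the phase space, lift to fields with vertical brackets with `𝒢`. -/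
theorem exists_lift_field (hL : ContMDiff (modelL D) 𝓘(ℝ, ℝ) ∞ L) {N : ℕ}
    (hN : ∀ u, Module.finrank ℝ (kerHessian L u) = N) {W : Set (PhaseSpace D Q)}
    {γ : Fin N → PhaseSpace D Q → ℝ} (hγ : IsDefiningSystem (primarySurface L) W γ)
    {u₀ : VelocitySpace D Q} {U : Set (Coord D × (Coord D →L[ℝ] ℝ))} (hU : IsOpen U)
    (hUW : ∀ y ∈ U, y ∈ (extChartAt (modelC D) (fibreDerivative L u₀)).target ∧
      (extChartAt (modelC D) (fibreDerivative L u₀)).symm y ∈ W)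
    {S : Coord D × (Coord D →L[ℝ] ℝ) → Coord D × (Coord D →L[ℝ] ℝ)} (hS : ContDiffOn ℝ ∞ S U)
    (htan : ∀ u, u.1 ∈ (chartAt (Coord D) u₀.1).source →
      extChartAt (modelC D) (fibreDerivative L u₀) (fibreDerivative L u) ∈ U → ∀ n,
        fderiv ℝ (γ n ∘ (extChartAt (modelC D) (fibreDerivative L u₀)).symm)
          (extChartAt (modelC D) (fibreDerivative L u₀) (fibreDerivative L u))
            (S (extChartAt (modelC D) (fibreDerivative L u₀) (fibreDerivative L u))) = 0) :
    ∃ X : VectorFieldL D Q,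
      SmoothFieldOn X (fibreDerivative L ⁻¹' ((extChartAt (modelC D) (fibreDerivative L u₀)).source ∩
        extChartAt (modelC D) (fibreDerivative L u₀) ⁻¹' U)) ∧
      BracketsVertical L (fibreDerivative L ⁻¹'
        ((extChartAt (modelC D) (fibreDerivative L u₀)).source ∩
          extChartAt (modelC D) (fibreDerivative L u₀) ⁻¹' U)) X ∧
      ∀ u, u.1 ∈ (chartAt (Coord D) u₀.1).source →
        extChartAt (modelC D) (fibreDerivative L u₀) (fibreDerivative L u) ∈ U →
          coordC (fibreDerivative L u₀) (fibreDerivative L u) (push L u (X u)) =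
            S (extChartAt (modelC D) (fibreDerivative L u₀) (fibreDerivative L u)) := by
  set Φ := extChartAt (modelL D) u₀ with hΦ
  set Ψ := extChartAt (modelC D) (fibreDerivative L u₀) with hΨ
  set W' : Set (PhaseSpace D Q) := Ψ.source ∩ Ψ ⁻¹' U with hW'
  have hW'o : IsOpen W' := isOpen_chart_preimage hU _
  have hOM : IsOpen (fibreDerivative L ⁻¹' W') := isOpen_fibreDerivative_preimage hL hW'o
  have hsrc : ∀ u ∈ fibreDerivative L ⁻¹' W', u.1 ∈ (chartAt (Coord D) u₀.1).source :=
    fun u hu => mem_extChartAt_source_C.1 hu.1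
  set O : Set (Coord D × Coord D) := Φ.target ∩ Φ.symm ⁻¹' (fibreDerivative L ⁻¹' W') with hOdef
  have hO : IsOpen O := isOpen_chart_symm_preimage hOM u₀
  have hFx : ∀ x ∈ O, Ψ (fibreDerivative L (Φ.symm x)) = localFibreDerivative L u₀ x := by
    intro x hx
    have h := extChartAt_fibreDerivative hL (hsrc _ hx.2)
    rwa [← hΦ, Φ.right_inv hx.1] at h
  have hFU : ∀ x ∈ O, localFibreDerivative L u₀ x ∈ U := fun x hx => hFx x hx ▸ hx.2.2
  have hF := (contDiffOn_localFibreDerivative hL u₀).mono (inter_subset_left : O ⊆ Φ.target)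
  have hgsm : ∀ n, ContDiffOn ℝ ∞ (fderiv ℝ (γ n ∘ Ψ.symm)) U := fun n =>
    ((contDiffOn_comp_chart_symm (hγ.2.1 n) _).mono fun y hy => hUW y hy).fderiv_of_isOpen hU
      (by simp)
  have hmem : ∀ x ∈ O, fibreDerivative L (Φ.symm x) ∈ W := by
    intro x hx
    have h := (hUW _ hx.2.2).2
    rwa [Ψ.left_inv hx.2.1] at h
  have hd : ∀ x ∈ O, ∀ n w, dC (γ n) (fibreDerivative L (Φ.symm x)) w =
      fderiv ℝ (γ n ∘ Ψ.symm) (localFibreDerivative L u₀ x)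
        (coordC (fibreDerivative L u₀) (fibreDerivative L (Φ.symm x)) w) := by
    intro x hx n w
    rw [← hFx x hx]
    exact dC_eq_fderiv (s₀ := fibreDerivative L u₀) (s := fibreDerivative L (Φ.symm x))
      (hsrc _ hx.2) (SmoothFunOn.mdifferentiableAt (hγ.2.1 n) hγ.1 (hmem x hx)) w
  have hpush : ∀ x ∈ O, ∀ Y : TL (Φ.symm x),
      coordC (fibreDerivative L u₀) (fibreDerivative L (Φ.symm x)) (push L (Φ.symm x) Y) =
        fderiv ℝ (localFibreDerivative L u₀) x (coordL u₀ (Φ.symm x) Y) := by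
    intro x hx Y
    have h := coordC_push hL (hsrc _ hx.2) Y
    rwa [← hΦ, Φ.right_inv hx.1] at h
  have hDF : ContDiffOn ℝ ∞ (fderiv ℝ (localFibreDerivative L u₀)) O :=
    hF.fderiv_of_isOpen hO (by simp)
  obtain ⟨P, hP, hPS⟩ := exists_smooth_lift (N := N) hDF
    (fun x hx c => by rw [fderiv_localFibreDerivative_apply hL hx.1])
    (fun x hx b b' => fderiv_localFibreDerivative_symm hL hx.1 b b')
    -- The frame of ker M needed for the lift is ∂γ_n/∂p along 𝓛: N independent elements of an
    -- N-dimensional kernel.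
    (z := fun n x => (stdSharp (fderiv ℝ (γ n ∘ Ψ.symm) (localFibreDerivative L u₀ x))).1)
    (fun n => contDiff_fst.comp_contDiffOn
      (contDiffOn_stdSharp_comp ((hgsm n).comp hF hFU)))
    (fun x hx => linearIndependent_stdSharp_fst (by
      have h := linearIndependent_fderiv_inr hL hγ (hsrc _ hx.2) (hmem x hx)
      rwa [← hΨ, hFx x hx] at h))
    (fun x hx n => fderiv_localFibreDerivative_inr_eq_zero hL hx.1 fun c => by
      obtain ⟨Y, rfl⟩ := coordL_surjective (hsrc _ hx.2) c
      rw [← hpush x hx, ← hd x hx]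
      exact dC_push_eq_zero hL hγ (hmem x hx) n Y)
    (fun x hx => by
      have h := finrank_ker_localFibreDerivative hL hN (hsrc _ hx.2)
      rwa [← hΦ, Φ.right_inv hx.1] at h)
    (S := fun x => S (localFibreDerivative L u₀ x)) (hS.comp hF hFU) (by
      intro x hx
      obtain ⟨w, hw⟩ := coordC_surjective (s₀ := fibreDerivative L u₀)
        (s := fibreDerivative L (Φ.symm x)) (hsrc _ hx.2) (S (localFibreDerivative L u₀ x))
      obtain ⟨Y, rfl⟩ := exists_push_eq hL hN hγ (hmem x hx) w fun n => by
        rw [hd x hx, hw]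
        have h := htan _ (hsrc _ hx.2) hx.2.2 n
        rwa [hFx x hx] at h
      exact ⟨coordL u₀ (Φ.symm x) Y, (hpush x hx Y).symm.trans hw⟩)
  obtain ⟨X, hX⟩ := exists_field_of_coordinates u₀ P
  have hmemO : ∀ u ∈ fibreDerivative L ⁻¹' W', Φ u ∈ O := fun u hu => by
    have h1 := mem_extChartAt_source_L.2 (hsrc u hu)
    exact ⟨Φ.map_source h1, by rw [mem_preimage, Φ.left_inv h1]; exact hu⟩
  have hXS : ∀ u, u.1 ∈ (chartAt (Coord D) u₀.1).source → Ψ (fibreDerivative L u) ∈ U →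
      coordC (fibreDerivative L u₀) (fibreDerivative L u) (push L u (X u)) =
        S (Ψ (fibreDerivative L u)) := by
    intro u hu huU
    have huM : u ∈ fibreDerivative L ⁻¹' W' := ⟨mem_extChartAt_source_C.2 hu, huU⟩
    rw [coordC_push hL hu, hX u hu, ← hΦ, hPS _ (hmemO u huM), hΨ,
      extChartAt_fibreDerivative hL hu]
  have hXsm : SmoothFieldOn X (fibreDerivative L ⁻¹' W') := by
    rw [smoothFieldOn_iff hOM fun u hu => mem_extChartAt_source_L.2 (hsrc u hu)]
    exact ((contMDiffOn_comp_chart hP u₀).mono fun u hu =>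
      ⟨mem_extChartAt_source_L.2 (hsrc u hu), hmemO u hu⟩).congr fun u hu => hX u (hsrc u hu)
  refine ⟨X, hXsm, bracketsVertical_of_horizontalPart hL hXsm fun u hu =>
    ⟨u₀, hsrc u hu, fun w hw => ?_⟩, hXS⟩
  -- The lift has the base components of S, which are functions of 𝓛(u) alone; their differentials
  -- kill 𝒢, whatever the choice of the vertical components.
  have heq : horizontalPart u₀ X =ᶠ[𝓝 u] (fun s => (S (Ψ s)).1) ∘ fibreDerivative L := by
    filter_upwards [hOM.mem_nhds hu] with u' hu'
    rw [← horizontalPart_eq_coordC_push hL (hsrc u' hu') X, hXS u' (hsrc u' hu') hu'.2]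
    rfl
  rw [heq.mfderiv_eq]
  refine mfderiv_comp_fibreDerivative_eq_zero hL ?_ hw
  exact ((contMDiffOn_comp_chart (g := fun y => (S y).1) (contDiff_fst.comp_contDiffOn hS)
    _).contMDiffAt (hW'o.mem_nhds hu)).mdifferentiableAt (by simp)

/-- Constraints recombined along the kernel of the bracket matrix have r members whose Hamiltonian
vectors are tangent to the primary surface. Lifts of these lie in ker Ω_L, since their contraction
with ω is a dγ, which kills all pushes. They are independent modulo 𝒢 because ♯ is injective, and
they span by dimension. -/
theorem exists_isAdaptedSystem (hL : IsAlmostRegular L) {N r : ℕ}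
    (hN : ∀ u, Module.finrank ℝ (kerHessian L u) = N)
    (hr : ∀ u, Module.finrank ℝ (kerForm L u) = N + r) {s : PhaseSpace D Q}
    (hs : s ∈ primarySurface L) :
    ∃ (W : Set (PhaseSpace D Q)) (γ : Fin N → PhaseSpace D Q → ℝ) (e : Fin r ↪ Fin N)
      (P : Fin r → VectorFieldL D Q) (f : Fin r → PhaseSpace D Q → ℝ),
      s ∈ W ∧ IsAdaptedSystem L W γ e P f := by
  obtain ⟨W₁, γ, hs₁, hγ⟩ := exists_definingSystem hL hN hs
  obtain ⟨u₀, rfl⟩ := hs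
  have hLs := hL.smooth
  set Ψ := extChartAt (modelC D) (fibreDerivative L u₀) with hΨ
  set O : Set (Coord D × (Coord D →L[ℝ] ℝ)) := Ψ.target ∩ Ψ.symm ⁻¹' W₁ with hOdef
  have hO : IsOpen O := isOpen_chart_symm_preimage hγ.1 _
  -- The part of the primary surface inside the chart, the only place where independence of the
  -- constraints and the rank of their bracket matrix are known.
  set T : Set (Coord D × (Coord D →L[ℝ] ℝ)) := {y | ∃ u : VelocitySpace D Q,
    u.1 ∈ (chartAt (Coord D) u₀.1).source ∧ fibreDerivative L u ∈ W₁ ∧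
      Ψ (fibreDerivative L u) = y} with hTdef
  have hleft : ∀ u : VelocitySpace D Q, u.1 ∈ (chartAt (Coord D) u₀.1).source →
      Ψ.symm (Ψ (fibreDerivative L u)) = fibreDerivative L u := fun u hu =>
    Ψ.left_inv (mem_extChartAt_source_C.2 hu)
  have hd : ∀ u : VelocitySpace D Q, u.1 ∈ (chartAt (Coord D) u₀.1).source →
      fibreDerivative L u ∈ W₁ → ∀ n w, dC (γ n) (fibreDerivative L u) w =
        fderiv ℝ (γ n ∘ Ψ.symm) (Ψ (fibreDerivative L u))
          (coordC (fibreDerivative L u₀) (fibreDerivative L u) w) := fun u hu huW n w =>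
    dC_eq_fderiv (s₀ := fibreDerivative L u₀) (s := fibreDerivative L u) hu
      (SmoothFunOn.mdifferentiableAt (hγ.2.1 n) hγ.1 huW) w
  obtain ⟨U, G, e, hU, hyU, hUO, hG, hGzero, hGind⟩ := exists_adapted_constraints
    (stdSharp (E := Coord D)) (T := T) (r := r) hO
    (fun n => contDiffOn_comp_chart_symm (hγ.2.1 n) (fibreDerivative L u₀))
    (y₀ := Ψ (fibreDerivative L u₀))
    ⟨mem_extChartAt_target _, by
      rw [mem_preimage, hleft u₀ (base_mem_source u₀.1)]; exact hs₁⟩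
    ⟨u₀, base_mem_source u₀.1, hs₁, rfl⟩
    (by
      rintro _ ⟨-, u, hu, huW, rfl⟩ n
      simp only [Function.comp_apply]
      rw [hleft u hu]
      exact (hγ.2.2.1 _ huW).1 ⟨u, rfl⟩ n)
    (by
      rintro _ ⟨-, u, hu, huW, rfl⟩
      exact linearIndependent_of_forall_apply_eq (T := Coord D × (Coord D →L[ℝ] ℝ))
        (f := fun n => dC (γ n) (fibreDerivative L u)) (hγ.2.2.2 _ huW ⟨u, rfl⟩) (hd u hu huW))
    (by
      rintro _ ⟨-, u, hu, huW, rfl⟩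
      exact finrank_ker_bracketMap hLs hN hr hγ hu huW)
  have hUW : ∀ y ∈ U, y ∈ Ψ.target ∧ Ψ.symm y ∈ W₁ := fun y hy => hUO hy
  set W : Set (PhaseSpace D Q) := Ψ.source ∩ Ψ ⁻¹' U with hWdef
  have hW : IsOpen W := isOpen_chart_preimage hU _
  have hWsrc : ∀ s ∈ W, s.1 ∈ (chartAt (Coord D) (fibreDerivative L u₀).1).source := fun s hs =>
    mem_extChartAt_source_C.1 hs.1
  have hWW₁ : ∀ s ∈ W, s ∈ W₁ := fun s hs => by
    have h := (hUW _ hs.2).2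
    rwa [Ψ.left_inv hs.1] at h
  have hT : ∀ u, fibreDerivative L u ∈ W → Ψ (fibreDerivative L u) ∈ U ∩ T := fun u hu =>
    ⟨hu.2, u, hWsrc _ hu, hWW₁ _ hu, rfl⟩
  have hdG : ∀ s ∈ W, ∀ i w, dC (G i ∘ Ψ) s w =
      fderiv ℝ (G i) (Ψ s) (coordC (fibreDerivative L u₀) s w) := fun s hs i w =>
    dC_comp_chart (hWsrc s hs)
      (((hG i).contDiffAt (hU.mem_nhds hs.2)).differentiableAt (by simp)) w
  have hγ' : IsDefiningSystem (primarySurface L) W fun i => G i ∘ Ψ := by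
    refine ⟨hW, fun i => contMDiffOn_comp_chart (hG i) _, fun s hs => ?_, ?_⟩
    · rw [hγ.2.2.1 s (hWW₁ s hs)]
      refine Iff.trans ?_ (hGzero _ hs.2).symm
      simp only [Function.comp_apply]
      rw [Ψ.left_inv hs.1]
    · rintro _ hs ⟨u, rfl⟩
      exact linearIndependent_of_surjective (T := Coord D × (Coord D →L[ℝ] ℝ))
        (hGind _ (hT u hs)).1 (coordC_surjective (hWsrc _ hs)) (hdG _ hs)
  have hfield : ∀ m, ∃ X : VectorFieldL D Q, SmoothFieldOn X (fibreDerivative L ⁻¹' W) ∧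
      BracketsVertical L (fibreDerivative L ⁻¹' W) X ∧
      ∀ u, u.1 ∈ (chartAt (Coord D) u₀.1).source → Ψ (fibreDerivative L u) ∈ U →
        coordC (fibreDerivative L u₀) (fibreDerivative L u) (push L u (X u)) =
          stdSharp (fderiv ℝ (G (e m)) (Ψ (fibreDerivative L u))) := fun m =>
    exists_lift_field hLs hN hγ hU hUW (S := fun y => stdSharp (fderiv ℝ (G (e m)) y))
      (contDiffOn_stdSharp_comp ((hG (e m)).fderiv_of_isOpen hU (by simp)))
      fun u hu huU n => (hGind _ ⟨huU, u, hu, by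
        have h := (hUW _ huU).2
        rwa [hleft u hu] at h, rfl⟩).2 m n
  choose P hPsm hPbr hPS using hfield
  have hcontr : ∀ m u, fibreDerivative L u ∈ W → ∀ w : TC (fibreDerivative L u),
      canonicalForm (fibreDerivative L u) (push L u (P m u)) w =
        dC (G (e m) ∘ Ψ) (fibreDerivative L u) w := by
    intro m u hu w
    rw [canonicalForm_eq_coordC (hWsrc _ hu), hPS m u (hWsrc _ hu) hu.2, stdForm_stdSharp,
      hdG _ hu]
  have hmem : ∀ m u, fibreDerivative L u ∈ W → P m u ∈ kerForm L u := by
    intro m u hu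
    refine LinearMap.mem_ker.2 (ContinuousLinearMap.ext fun v => ?_)
    refine (lagrangeForm_eq hLs u (P m u) v).trans ?_
    rw [hcontr m u hu]
    exact dC_push_eq_zero hLs hγ' hu (e m) v
  have hindep : ∀ u, fibreDerivative L u ∈ W →
      LinearIndependent ℝ fun m => (verticalKernel L u).mkQ (P m u) := by
    intro u hu
    refine linearIndependent_mkQ_of_map
      (A := ((coordC (fibreDerivative L u₀) (fibreDerivative L u)).comp (push L u) :
        TL u →ₗ[ℝ] Coord D × (Coord D →L[ℝ] ℝ))) ?_
      (linearIndependent_stdSharp (hGind _ (hT u hu)).1 e) fun m => hPS m u (hWsrc _ hu) hu.2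
    intro v hv
    exact (congrArg (coordC (fibreDerivative L u₀) (fibreDerivative L u))
      ((push_eq_zero_iff hLs u v).2 hv)).trans (coordC_zero _ _)
  -- The fields lift the Hamiltonian vectors of the recombined constraints themselves, so the
  -- factors f_m can be taken to be 1.
  refine ⟨W, fun i => G i ∘ Ψ, e, P, fun _ _ => 1, ⟨mem_extChartAt_source _, hyU⟩, hγ',
    fun m => ⟨hPsm m, fun u hu => hmem m u hu, hPbr m⟩, hindep, fun u hu => ?_,
    fun m => contMDiffOn_const, fun m u hu w => ?_⟩
  · have hle : verticalKernel L u ≤ kerForm L u := by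
      intro v hv
      refine LinearMap.mem_ker.2 (ContinuousLinearMap.ext fun v' => ?_)
      refine (lagrangeForm_eq hLs u v v').trans ?_
      rw [(push_eq_zero_iff hLs u v).2 hv, canonicalForm_eq_stdForm]
      exact (congrArg₂ (· - ·) (ContinuousLinearMap.map_zero _) rfl).trans (sub_self _)
    have : FiniteDimensional ℝ (TL u) := inferInstanceAs (FiniteDimensional ℝ (Coord D × Coord D))
    exact sup_span_eq_of_finrank (V := TL u) hle
      ((finrank_verticalKernel u).trans (hN u)) (hr u) (fun m => hmem m u hu) (hindep u hu)
  · rw [hcontr m u hu, one_mul]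

end SingularLagrangian

/-! ### The main theorem -/

theorem mainTheorem11 {D : ℕ} {Q : Type*} [TopologicalSpace Q] [T2Space Q]
    [SecondCountableTopology Q] [ChartedSpace (Coord D) Q] [IsManifold (𝓡 D) ∞ Q]
    (L : VelocitySpace D Q → ℝ) (hL : IsAlmostRegular L) (N r : ℕ)
    (hN : ∀ u, Module.finrank ℝ (kerHessian L u) = N)
    (hr : ∀ u, Module.finrank ℝ (kerForm L u) = N + r) :
    -- the canonical Hamiltonian is well defined and smooth on the primary constraint surface
    (∀ u, canonicalHamiltonian L (fibreDerivative L u) = energy L u) ∧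
    (∀ s ∈ primarySurface L, ∃ W H, s ∈ W ∧ RepresentsCanonical L W H) ∧
    -- primary constraints and kernel bases related by `π_m = f_m dγ_m` exist near each point
    (∀ s ∈ primarySurface L, ∃ (W : Set (PhaseSpace D Q)) (γ : Fin N → PhaseSpace D Q → ℝ)
      (e : Fin r ↪ Fin N) (P : Fin r → VectorFieldL D Q) (f : Fin r → PhaseSpace D Q → ℝ),
      s ∈ W ∧ IsAdaptedSystem L W γ e P f) ∧
    -- every SOELVF is projectable
    (∀ X, IsSOELVF L X → ∃ 𝔛, ProjectsTo L X 𝔛) ∧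
    -- the projection is tangent to the primary constraint surface
    (∀ X, IsSOELVF L X → ∀ (W : Set (PhaseSpace D Q)) (γ : Fin N → PhaseSpace D Q → ℝ),
      IsDefiningSystem (primarySurface L) W γ → ∀ u, fibreDerivative L u ∈ W →
        ∀ n, dC (γ n) (fibreDerivative L u) (push L u (X u)) = 0) ∧
    -- the projection of `X₀` is the Hamiltonian vector field of the canonical Hamiltonian
    (∀ X₀ 𝔛₀, IsSOELVF L X₀ → ProjectsTo L X₀ 𝔛₀ →
      (∀ W H, RepresentsCanonical L W H → ∀ u ∈ firstOrderSurface L, fibreDerivative L u ∈ W →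
        ∀ Y : TL u, canonicalForm (fibreDerivative L u) (𝔛₀ (fibreDerivative L u)) (push L u Y) =
          dC H (fibreDerivative L u) (push L u Y)) ∧
      ∀ s ∈ primarySurface L, ∃ W H, s ∈ W ∧ RepresentsCanonical L W H ∧
        IsHamiltonianFieldOn 𝔛₀ H (projectedSurface L ∩ W)) ∧
    -- every SOELVF projects to the Hamiltonian vector field of a total Hamiltonian
    (∀ X₀ 𝔛₀ X 𝔛, IsSOELVF L X₀ → ProjectsTo L X₀ 𝔛₀ → IsSOELVF L X → ProjectsTo L X 𝔛 →
      ∀ (W : Set (PhaseSpace D Q)) (H : PhaseSpace D Q → ℝ) (γ : Fin N → PhaseSpace D Q → ℝ)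
        (e : Fin r ↪ Fin N) (P : Fin r → VectorFieldL D Q) (f : Fin r → PhaseSpace D Q → ℝ),
        RepresentsCanonical L W H → IsHamiltonianFieldOn 𝔛₀ H (projectedSurface L ∩ W) →
        IsAdaptedSystem L W γ e P f →
        (∀ s ∈ primarySurface L ∩ W, ∃ (W' : Set (PhaseSpace D Q))
          (c : Fin r → PhaseSpace D Q → ℝ), IsOpen W' ∧ s ∈ W' ∧ W' ⊆ W ∧
            IsDecompositionOn L W' X X₀ P c) ∧
        ∀ (W' : Set (PhaseSpace D Q)) (c : Fin r → PhaseSpace D Q → ℝ), IsOpen W' → W' ⊆ W →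
          IsDecompositionOn L W' X X₀ P c →
            IsHamiltonianFieldOn 𝔛 (totalHamiltonian H c f γ e) (projectedSurface L ∩ W')) := by
  refine ⟨canonicalHamiltonian_fibreDerivative hL hN, fun s hs => ?_,
    fun s hs => exists_isAdaptedSystem hL hN hr hs, fun X hX => hX.exists_projectsTo hL hN,
    fun X _ W γ hγ u hu n => dC_push_eq_zero hL.smooth hγ hu n (X u),
    fun X₀ 𝔛₀ hX₀ h𝔛₀ => ⟨fun W H hH u hu huW Y => ?_,
      fun s hs => hX₀.exists_isHamiltonianFieldOn hL hN h𝔛₀ hs⟩,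
    fun X₀ 𝔛₀ X 𝔛 hX₀ h𝔛₀ hX h𝔛 W H γ e P f hH hHam hA =>
      ⟨fun s hs => exists_isDecompositionOn hL hN hX hX₀ hA hs.1 hs.2,
        fun W' c hW' hsub hc =>
          isHamiltonianFieldOn_totalHamiltonian hL.smooth h𝔛₀ h𝔛 hH hHam hA hW' hsub hc⟩⟩
  · obtain ⟨W, H, hsW, -, hH⟩ := exists_representsCanonical hL hN isOpen_univ hs (mem_univ s)
    exact ⟨W, H, hsW, hH⟩
  · rw [← h𝔛₀ u hu]
    exact hX₀.canonicalForm_push hL hN hH hu huW Y
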